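/- Let $F=\sum_{i=0}^3x_i^8+14\sum_{i<j}x_i^4x_j^4+168x_0^2x_1^2x_2^2x_3^2$, let $S=\{F=0\}\subset\mathbb P^3$ (over $\mathbb C$) be Maschke's octic surface and let $\pi:X\to\mathbb P^3$ be the double cover branched along $S$, that is $X=\{W^2=F(x)\}\subset\mathbb P(1,1,1,1,4)$. Call a line four-tangent to $S$ if it does not lie in $S$ and meets $S$ in exactly four points, each with intersection multiplicity two. For $c=((x:u),(y:v))\in\mathbb P^1\times\mathbb P^1$ let $l_c=\{(sx:su:ty:tv)\}\subset\mathbb P^3$; for $c=(x,y)\in\mathbb A^2$ (i.e. $u=v=1$) put $f_c(t)=F(x,1,ty,t)$. Let $$A=y^8+14y^4+1,\quad B=14(x^4y^4+x^4+y^4+12x^2y^2+1),\quad C=x^8+14x^4+1,\quad \Delta=B^2-4AC,$$ $$g_+=(2y^4+y^2+2)x^4-(y^4-24y^2+1)x^2+2y^4+y^2+2,$$ $$g_-=(2y^4-y^2+2)x^4+(y^4+24y^2+1)x^2+2y^4-y^2+2,$$ and let $C_\pm\subset\mathbb P^1\times\mathbb P^1$ be the Zariski closure of the affine curve $g_\pm=0$.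 A smooth irreducible projective curve has as genus the dimension of its space of everywhere regular differentials. Then: 1. $f_c(t)=At^8+Bt^4+C$; $\Delta=48\,g_+g_-$ in $\mathbb Z[x,y]$; $g_-(x,y)=g_+(ix,iy)$; and if $\Delta(c)=0$ then $f_c=(\lambda t^4+\mu)^2$ for some $\lambda,\mu\in\mathbb C$. 2. $C_+$ and $C_-$ are smooth curves of bidegree $(4,4)$, defined by the bihomogenizations of $g_+$ and $g_-$, and they are irreducible of genus $9$. 3. The map $c\mapsto l_c$ is injective on $\mathbb P^1\times\mathbb P^1$. The line $l_c$ is four-tangent to $S$ or contained in $S$ if and only if $c\in C_+\cup C_-$, and it is contained in $S$ if and only if $c\in C_+\cap C_-$. The map $c\mapsto l_c$ is an isomorphism of $C_\pm$ onto the Zariski closure, in the Grassmannian of lines in $\mathbb P^3$, of the locus of the lines $l_{(x,y)}$ with $g_\pm(x,y)=0$. 4. For every four-tangent line $L$ of $S$, $\pi^{-1}(L)$ is the union of two distinct rational curves, each mapped isomorphically to $L$ by $\pi$. 5. Let $\widetilde C_+\to C_+$ be the double cover defined by $\sqrt A$, that is $\widetilde C_+=\{((x:u),(y:v:w)) : ((x:u),(y:v))\in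 C_+,\ w^2=y^8+14y^4v^4+v^8\}\subset\mathbb P^1\times\mathbb P(1,1,4)$. Its fibres have one or two points, and exactly one point over exactly $32$ points of $C_+$. The curve $\widetilde C_+$ is smooth and irreducible, of genus $33$. 6. $\widetilde C_+$ parametrizes rational curves in $X$: with $A$, $B$ (bi)homogenized, let $\ell_{\tilde c}\subset X$, for $\tilde c=((x:u),(y:v:w))\in\widetilde C_+$ over $c\in C_+$, be the set of the points $(sx:su:ty:tv:W)$ of $X$ with $2wW=2At^4+Bs^4$. Then $\ell_{\tilde c}$ is a rational curve which $\pi$ maps isomorphically to $l_c$; for every $c\in C_+$, $\pi^{-1}(l_c)$ is the union of the $\ell_{\tilde c}$ with $\tilde c$ over $c$; and $\tilde c\mapsto\ell_{\tilde c}$ is a bijection from $\widetilde C_+$ to the set of the curves in $X$ that $\pi$ maps isomorphically to a line $l_c$ with $c\in C_+$. -/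

import Mathlib

noncomputable section

namespace Maschke

open MvPolynomial

/-! ## Projective spaces and weighted projective spaces -/

/-- The projective space `P^n` over `ℂ`. -/
abbrev PP (n : ℕ) : Type := Projectivization ℂ (Fin (n + 1) → ℂ)

/-- `v` is a vector of homogeneous coordinates of `p`. -/
def HasCoords {n : ℕ} (p : PP n) (v : Fin (n + 1) → ℂ) : Prop :=
  ∃ h : v ≠ 0, Projectivization.mk ℂ v h = p

/-- The vectors `(x, w)` and `(x', w')` define the same point of the weighted projective space
`P(1, …, 1, 4)`. -/
def wpSetoid (n : ℕ) : Setoid {v : (Fin n → ℂ) × ℂ // v ≠ 0} where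
  r v v' := ∃ a : ℂ, a ≠ 0 ∧ v'.1.1 = a • v.1.1 ∧ v'.1.2 = a ^ 4 * v.1.2
  iseqv :=
    { refl := fun v => ⟨1, one_ne_zero, by simp, by simp⟩
      symm := by
        rintro v v' ⟨a, ha, h1, h2⟩
        refine ⟨a⁻¹, inv_ne_zero ha, ?_, ?_⟩
        · rw [h1, smul_smul, inv_mul_cancel₀ ha, one_smul]
        · rw [h2]
          field_simp
      trans := by
        rintro v v' v'' ⟨a, ha, h1, h2⟩ ⟨b, hb, h3, h4⟩
        refine ⟨b * a, mul_ne_zero hb ha, ?_, ?_⟩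
        · rw [h3, h1, smul_smul]
        · rw [h4, h2]
          ring }

/-- The weighted projective space `P(1, …, 1, 4)` over `ℂ`, with `n` coordinates of weight `1`
and a last coordinate of weight `4`. -/
def WP (n : ℕ) : Type := Quotient (wpSetoid n)

/-- `(x, w)` is a vector of weighted homogeneous coordinates of `p ∈ P(1, …, 1, 4)`. -/
def WP.HasCoords {n : ℕ} (p : WP n) (x : Fin n → ℂ) (w : ℂ) : Prop :=
  ∃ h : (x, w) ≠ 0, (Quotient.mk (wpSetoid n) ⟨(x, w), h⟩ : WP n) = p

/-! ## The genus of an irreducible curve -/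

/-- The regular (everywhere holomorphic) differentials of a field extension `K` of `ℂ`: those
`ω ∈ Ω[K/ℂ]` that lie, for every valuation ring `V` of `K` containing `ℂ`, in the image of `Ω[V/ℂ]`,
i.e. are sums of differentials `f • dg` with `f, g ∈ V`. If `K` is the function field of a smooth
projective curve, these valuation rings are `K` and the local rings at the points of the curve. -/
def regularDifferentials (K : Type) [Field K] [Algebra ℂ K] : Submodule ℂ (Ω[K⁄ℂ]) :=
  ⨅ (V : ValuationSubring K) (_ : ∀ z : ℂ, algebraMap ℂ K z ∈ V),
    Submodule.span ℂ {ω | ∃ f ∈ V, ∃ g ∈ V, ω = f • KaehlerDifferential.D ℂ K g}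

/-- The genus of a function field in one variable over `ℂ`: the dimension of the space of its
regular differentials. -/
def genus (K : Type) [Field K] [Algebra ℂ K] : ℕ :=
  Module.finrank ℂ (regularDifferentials K)

/-- The ring of polynomial functions on a subset `Z` of affine space. -/
abbrev CoordRing {n : ℕ} (Z : Set (Fin n → ℂ)) : Type :=
  MvPolynomial (Fin n) ℂ ⧸ vanishingIdeal ℂ Z

/-- `Z` is an irreducible subset of affine space whose function field has genus `g`. For a smooth
projective curve having `Z` as a dense affine part, this says that it is irreducible
of genus `g`. -/
def HasGenus {n : ℕ} (Z : Set (Fin n → ℂ)) (g : ℕ) : Prop :=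
  ∃ _ : IsDomain (CoordRing Z), genus (FractionRing (CoordRing Z)) = g

/-! ## Curves in `P^1 × P^1` -/

/-- The coordinates `(x, u, y, v)` of a point `((x : u), (y : v))` of `P^1 × P^1`. -/
def coords (c : PP 1 × PP 1) : Fin 4 → ℂ :=
  ![c.1.rep 0, c.1.rep 1, c.2.rep 0, c.2.rep 1]

/-- The polynomial `H` in `x, u, y, v` is bihomogeneous of bidegree `d`. -/
def IsBihomogeneous (H : MvPolynomial (Fin 4) ℂ) (d : ℕ × ℕ) : Prop :=
  IsWeightedHomogeneous (![(1, 0), (1, 0), (0, 1), (0, 1)] : Fin 4 → ℕ × ℕ) H d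

/-- The Zariski closure of a subset of `P^1 × P^1`. -/
def biClosure (s : Set (PP 1 × PP 1)) : Set (PP 1 × PP 1) :=
  {c | ∀ (H : MvPolynomial (Fin 4) ℂ) (d : ℕ × ℕ), IsBihomogeneous H d →
    (∀ c' ∈ s, eval (coords c') H = 0) → eval (coords c) H = 0}

/-- The point `((x : 1), (y : 1))` of `P^1 × P^1`. -/
def affinePoint (x y : ℂ) : PP 1 × PP 1 :=
  (Projectivization.mk ℂ ![x, 1] (by simp), Projectivization.mk ℂ ![y, 1] (by simp))

/-- The part of a subset of `P^1 × P^1` that lies in the affine plane `u = v = 1`. -/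
def affinePart (C : Set (PP 1 × PP 1)) : Set (Fin 2 → ℂ) :=
  {a | affinePoint (a 0) (a 1) ∈ C}

/-- `C` is a smooth curve in `P^1 × P^1` with equation `G = 0` of bidegree `d`. -/
structure IsSmoothCurve (C : Set (PP 1 × PP 1)) (G : MvPolynomial (Fin 4) ℂ) (d : ℕ × ℕ) :
    Prop where
  bihomogeneous : IsBihomogeneous G d
  eq_zeros : C = {c | eval (coords c) G = 0}
  smooth : ∀ c ∈ C, ∃ i, eval (coords c) (pderiv i G) ≠ 0

/-! ## Maschke's surface, its double octic and lines -/

/-- Maschke's invariant of degree eight. -/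
def F : MvPolynomial (Fin 4) ℂ :=
  ∑ i, X i ^ 8 + 14 * ∑ i, ∑ j ∈ Finset.Ioi i, X i ^ 4 * X j ^ 4
    + 168 * X 0 ^ 2 * X 1 ^ 2 * X 2 ^ 2 * X 3 ^ 2

/-- Maschke's octic surface. -/
def S : Set (PP 3) := {p | eval p.rep F = 0}

/-- Maschke's double octic `W ^ 2 = F(x)`, the double cover of `P^3` branched along `S`, as a
hypersurface in `P(1, 1, 1, 1, 4)`. -/
def DoubleOctic : Set (WP 4) := {P | ∃ x W, P.HasCoords x W ∧ W ^ 2 = eval x F}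

/-- The line in `P^3` that corresponds to the two-dimensional subspace `L` lies in `S`. -/
def LiesInS (L : Submodule ℂ (Fin 4 → ℂ)) : Prop :=
  ∀ p : PP 3, p.submodule ≤ L → p ∈ S

/-- The polynomial `F(a + T b)` in `T`; if `b` is not a multiple of `a ≠ 0`, its order at `T = 0` is
the intersection multiplicity of `S` with the line through `a` and `b` at the point `a`. -/
def restrictF (a b : Fin 4 → ℂ) : Polynomial ℂ :=
  aeval (fun i => Polynomial.C (a i) + Polynomial.X * Polynomial.C (b i)) F

/-- The subspace `L` defines a line in `P^3`, not in `S`, which meets `S` in exactly four points,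
each with multiplicity two. -/
def IsFourTangent (L : Submodule ℂ (Fin 4 → ℂ)) : Prop :=
  Module.finrank ℂ L = 2 ∧ ¬ LiesInS L ∧
    ∃ T : Finset (PP 3), T.card = 4 ∧ (∀ p, p ∈ T ↔ p ∈ S ∧ p.submodule ≤ L) ∧
      ∀ p ∈ T, ∀ b ∈ L, b ∉ p.submodule → (restrictF p.rep b).rootMultiplicity 0 = 2

/-- The inverse image in the double octic of the line given by `L`. -/
def preimage (L : Submodule ℂ (Fin 4 → ℂ)) : Set (WP 4) :=
  {P ∈ DoubleOctic | ∃ x ∈ L, ∃ W, P.HasCoords x W}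

/-- `Z` is the image of a non-constant morphism from `P^1` to `P(1, 1, 1, 1, 4)`, avoiding the
singular point, given by forms `φ` of degree `d > 0` without common zero and a form `ψ` of
degree `4 d`. -/
def IsRationalCurve (Z : Set (WP 4)) : Prop :=
  ∃ (d : ℕ) (φ : Fin 4 → MvPolynomial (Fin 2) ℂ) (ψ : MvPolynomial (Fin 2) ℂ),
    0 < d ∧ (∀ i, (φ i).IsHomogeneous d) ∧ ψ.IsHomogeneous (4 * d) ∧
    (∀ a : Fin 2 → ℂ, a ≠ 0 → ∃ i, eval a (φ i) ≠ 0) ∧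
    Z = {P | ∃ a : Fin 2 → ℂ, a ≠ 0 ∧ P.HasCoords (fun i => eval a (φ i)) (eval a ψ)}

/-- The projection `(x, W) ↦ x` maps `Z` isomorphically to the line given by `L`: the set `Z` is the
image of a section `x ↦ (x, Q(x))` over the line, with `Q` a form of degree four. -/
def MapsIsomorphicallyTo (Z : Set (WP 4)) (L : Submodule ℂ (Fin 4 → ℂ)) : Prop :=
  ∃ Q : MvPolynomial (Fin 4) ℂ, Q.IsHomogeneous 4 ∧
    Z = {P | ∃ x ∈ L, x ≠ 0 ∧ P.HasCoords x (eval x Q)}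

/-! ## The polynomials -/

section Polynomials

variable {R : Type} [CommRing R]

def coeffA (y : R) : R := y ^ 8 + 14 * y ^ 4 + 1

def coeffB (x y : R) : R := 14 * (x ^ 4 * y ^ 4 + x ^ 4 + y ^ 4 + 12 * x ^ 2 * y ^ 2 + 1)

def coeffC (x : R) : R := x ^ 8 + 14 * x ^ 4 + 1

def discr (x y : R) : R := coeffB x y ^ 2 - 4 * coeffA y * coeffC x

def gPlus (x y : R) : R :=
  (2 * y ^ 4 + y ^ 2 + 2) * x ^ 4 - (y ^ 4 - 24 * y ^ 2 + 1) * x ^ 2 + (2 * y ^ 4 + y ^ 2 + 2)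

def gMinus (x y : R) : R :=
  (2 * y ^ 4 - y ^ 2 + 2) * x ^ 4 + (y ^ 4 + 24 * y ^ 2 + 1) * x ^ 2 + (2 * y ^ 4 - y ^ 2 + 2)

/-- The homogenization of `coeffA`. -/
def formA (y v : R) : R := y ^ 8 + 14 * y ^ 4 * v ^ 4 + v ^ 8

/-- The bihomogenization of `coeffB`. -/
def formB (x u y v : R) : R :=
  14 * (x ^ 4 * y ^ 4 + x ^ 4 * v ^ 4 + u ^ 4 * y ^ 4 + 12 * x ^ 2 * u ^ 2 * y ^ 2 * v ^ 2
    + u ^ 4 * v ^ 4)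

/-- The bihomogenization of `gPlus`. -/
def formGPlus (x u y v : R) : R :=
  (2 * y ^ 4 + y ^ 2 * v ^ 2 + 2 * v ^ 4) * x ^ 4
    - (y ^ 4 - 24 * y ^ 2 * v ^ 2 + v ^ 4) * x ^ 2 * u ^ 2
    + (2 * y ^ 4 + y ^ 2 * v ^ 2 + 2 * v ^ 4) * u ^ 4

/-- The bihomogenization of `gMinus`. -/
def formGMinus (x u y v : R) : R :=
  (2 * y ^ 4 - y ^ 2 * v ^ 2 + 2 * v ^ 4) * x ^ 4
    + (y ^ 4 + 24 * y ^ 2 * v ^ 2 + v ^ 4) * x ^ 2 * u ^ 2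
    + (2 * y ^ 4 - y ^ 2 * v ^ 2 + 2 * v ^ 4) * u ^ 4

end Polynomials

/-! ## The lines `l_c` and the curves `C_±` -/

/-- The polynomial `f_c(t) = F(x, 1, t y, t)` for `c = (x, y)`. -/
def fc (x y : ℂ) : Polynomial ℂ :=
  aeval ![Polynomial.C x, 1, Polynomial.X * Polynomial.C y, Polynomial.X] F

/-- The point `(x : u : 0 : 0)` on `l_c`. -/
def basePoint₁ (c : PP 1 × PP 1) : Fin 4 → ℂ := ![c.1.rep 0, c.1.rep 1, 0, 0]

/-- The point `(0 : 0 : y : v)` on `l_c`. -/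
def basePoint₂ (c : PP 1 × PP 1) : Fin 4 → ℂ := ![0, 0, c.2.rep 0, c.2.rep 1]

/-- The line `l_c` of the points `(s x : s u : t y : t v)`, for `c = ((x : u), (y : v))`. -/
def line (c : PP 1 × PP 1) : Submodule ℂ (Fin 4 → ℂ) :=
  Submodule.span ℂ {basePoint₁ c, basePoint₂ c}

/-- The affine curve `g_+ = 0`. -/
def affineLocusPlus : Set (PP 1 × PP 1) := {c | ∃ x y : ℂ, gPlus x y = 0 ∧ c = affinePoint x y}

/-- The affine curve `g_- = 0`. -/
def affineLocusMinus : Set (PP 1 × PP 1) := {c | ∃ x y : ℂ, gMinus x y = 0 ∧ c = affinePoint x y}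

/-- The curve `C_+`. -/
def CPlus : Set (PP 1 × PP 1) := biClosure affineLocusPlus

/-- The curve `C_-`. -/
def CMinus : Set (PP 1 × PP 1) := biClosure affineLocusMinus

/-! ## The lines `l_c` in the Grassmannian, in its Plücker embedding -/

/-- The Plücker coordinates of the line through `a` and `b`. -/
def pluckerVector (a b : Fin 4 → ℂ) : Fin 6 → ℂ :=
  ![a 0 * b 1 - a 1 * b 0, a 0 * b 2 - a 2 * b 0, a 0 * b 3 - a 3 * b 0,
    a 1 * b 2 - a 2 * b 1, a 1 * b 3 - a 3 * b 1, a 2 * b 3 - a 3 * b 2]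

theorem exists_rep_ne_zero (p : PP 1) : p.rep 0 ≠ 0 ∨ p.rep 1 ≠ 0 := by
  by_contra h
  push Not at h
  apply p.rep_nonzero
  ext i
  fin_cases i
  · exact h.1
  · exact h.2

theorem pluckerVector_ne_zero (c : PP 1 × PP 1) :
    pluckerVector (basePoint₁ c) (basePoint₂ c) ≠ 0 := by
  intro h
  have h1 := congrFun h 1
  have h2 := congrFun h 2
  have h3 := congrFun h 3
  have h4 := congrFun h 4
  simp [pluckerVector, basePoint₁, basePoint₂] at h1 h2 h3 h4
  rcases exists_rep_ne_zero c.1 with h5 | h5 <;> rcases exists_rep_ne_zero c.2 with h6 | h6 <;>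
    simp_all

/-- The point of the Grassmannian of lines in `P^3`, in its Plücker embedding in `P^5`, that is given
by the line `l_c`. -/
def pluckerPoint (c : PP 1 × PP 1) : PP 5 :=
  Projectivization.mk ℂ (pluckerVector (basePoint₁ c) (basePoint₂ c)) (pluckerVector_ne_zero c)

/-- The Zariski closure of a subset of `P^n`. -/
def projClosure {n : ℕ} (s : Set (PP n)) : Set (PP n) :=
  {p | ∀ (H : MvPolynomial (Fin (n + 1)) ℂ) (d : ℕ), H.IsHomogeneous d →
    (∀ q ∈ s, eval q.rep H = 0) → eval p.rep H = 0}

/-- The map `f` restricts to an isomorphism of algebraic sets from `C ⊆ P^1 × P^1` to `D ⊆ P^n`: it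
is a bijection which, like its inverse, is given locally by (bi)homogeneous polynomials. -/
structure IsIsomorphism {n : ℕ} (f : PP 1 × PP 1 → PP n) (C : Set (PP 1 × PP 1))
    (D : Set (PP n)) : Prop where
  bijOn : Set.BijOn f C D
  regular : ∀ c ∈ C, ∃ (d : ℕ × ℕ) (Φ : Fin (n + 1) → MvPolynomial (Fin 4) ℂ),
    (∀ i, IsBihomogeneous (Φ i) d) ∧ (∃ i, eval (coords c) (Φ i) ≠ 0) ∧
    ∀ c' ∈ C, (∃ i, eval (coords c') (Φ i) ≠ 0) →
      HasCoords (f c') (fun i => eval (coords c') (Φ i))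
  inverse_regular_fst : ∀ c ∈ C, ∃ (d : ℕ) (Ψ : Fin 2 → MvPolynomial (Fin (n + 1)) ℂ),
    (∀ i, (Ψ i).IsHomogeneous d) ∧ (∃ i, eval (f c).rep (Ψ i) ≠ 0) ∧
    ∀ c' ∈ C, (∃ i, eval (f c').rep (Ψ i) ≠ 0) →
      HasCoords c'.1 (fun i => eval (f c').rep (Ψ i))
  inverse_regular_snd : ∀ c ∈ C, ∃ (d : ℕ) (Ψ : Fin 2 → MvPolynomial (Fin (n + 1)) ℂ),
    (∀ i, (Ψ i).IsHomogeneous d) ∧ (∃ i, eval (f c).rep (Ψ i) ≠ 0) ∧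
    ∀ c' ∈ C, (∃ i, eval (f c').rep (Ψ i) ≠ 0) →
      HasCoords c'.2 (fun i => eval (f c').rep (Ψ i))

/-! ## The double cover of `C_+` -/

/-- The points `((x : u), (y : v : w))` of `P^1 × P(1, 1, 4)` over `c = ((x : u), (y : v))` with
`w ^ 2 = A(y, v)`. -/
def coverFiber (c : PP 1 × PP 1) : Set (PP 1 × WP 2) :=
  {q | q.1 = c.1 ∧ ∃ y v w : ℂ, HasCoords c.2 ![y, v] ∧ q.2.HasCoords ![y, v] w ∧
    w ^ 2 = formA y v}

/-- The double cover of `C_+` defined by `√A`. As `A`, viewed as a rational function on `C_+`, has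
poles of even order, its projective model is the curve `w ^ 2 = A(y, v)` over `C_+`
in `P^1 × P(1, 1, 4)`. -/
def CTilde : Set (PP 1 × WP 2) := {q | ∃ c ∈ CPlus, q ∈ coverFiber c}

/-- The affine part `u = v = 1` of the double cover, with coordinates `(x, y, w)`. -/
def affinePartTilde : Set (Fin 3 → ℂ) :=
  {a | ∃ q ∈ CTilde, HasCoords q.1 ![a 0, 1] ∧ q.2.HasCoords ![a 1, 1] (a 2)}

/-- The gradient at `a` of a polynomial in `x, u, y, v, w`. -/
def gradient (H : MvPolynomial (Fin 5) ℂ) (a : Fin 5 → ℂ) : Fin 5 → ℂ :=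
  fun i => eval a (pderiv i H)

/-- The double cover is smooth: at each of its points the gradients of its two equations are linearly
independent. -/
def CTildeIsSmooth : Prop :=
  ∀ q ∈ CTilde, ∀ x u y v w : ℂ, HasCoords q.1 ![x, u] → q.2.HasCoords ![y, v] w →
    LinearIndependent ℂ ![gradient (formGPlus (X 0) (X 1) (X 2) (X 3)) ![x, u, y, v, w],
      gradient (X 4 ^ 2 - formA (X 2) (X 3)) ![x, u, y, v, w]]

/-- The curve in the double octic, over the line `l_c`, that is given by the point `q = (c, w)` of the
double cover: in the coordinates `(s x : s u : t y : t v : W)` over `l_c` it is given by the factor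
`2 w W = 2 A t ^ 4 + B s ^ 4` of `4 A W ^ 2 = (2 A t ^ 4 + B s ^ 4) ^ 2`, where `w = √A`. -/
def liftedLine (q : PP 1 × WP 2) : Set (WP 4) :=
  {P ∈ DoubleOctic | ∃ x u y v w s t W : ℂ,
    HasCoords q.1 ![x, u] ∧ q.2.HasCoords ![y, v] w ∧
    P.HasCoords ![s * x, s * u, t * y, t * v] W ∧
    2 * w * W = 2 * formA y v * t ^ 4 + formB x u y v * s ^ 4}

end Maschke

end

open MvPolynomial Maschke

/-! On `l_c` the octic restricts to the binary form `A t⁸ + B s⁴ t⁴ + C s⁸` (`octic_line`), a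
quadratic form in `s⁴, t⁴` with discriminant `48 g₊ g₋`. If the discriminant vanishes and `A, C ≠
0`, the form is `A (t⁴ + β s⁴)²` with `β ≠ 0`, which gives four tangency points; if `A` or `C`
vanishes as well, then `A = B = C = 0` and the line lies in `S`. Conversely, one of the four
tangency points avoids the two base points of `l_c`, and a double zero there forces the discriminant
to vanish. In Plücker coordinates `c ↦ l_c` is the Segre embedding, so isomorphy onto the image
amounts to equations for that image.

On any four-tangent line `F` is the square of a quartic form `Q`, and `W² = F` splits into `W = ±Q`.
Over `C₊` one has `4 A F = (2 A t⁴ + B s⁴)²` on `l_c`, so choosing a sign means choosing `w = √A`.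
The section `Q` takes the value `w` at `(0 : 0 : y : v)`; this recovers the point of the double
cover from the curve, and hence gives the bijection.

The genus is computed without Riemann–Roch. Let `D` be the derivation given on the affine chart by
the Hamiltonian vector field of the equations. By smoothness it has no zeros there, and on each of
the three other charts a monomial multiple `u i • D` has the same shape. Regular differentials thus
become functions `h` with `u i * h` regular on chart `i` (`genus_eq_finrank_sectionsOf`): this is
adjunction, and for `C₊` it allows poles of order two along `x = ∞` and along `y = ∞`. Such
functions are counted by hand. As `g₊ = b x⁴ - d x² + b` is irreducible and primitive over `ℂ[y]`, a
function with at most a double pole along `x = ∞` is a unique combination of `1, x, x², b x³ - d x`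
over `ℂ[y]` (`combination_injective`, `exists_combination`). Comparing the charts `y` and `1/y`
bounds the degrees of the coefficients, and poles of order `m` along `y = ∞` give dimension `3 (m +
1) + max (m - 3, 0)`. For `m = 2` this is `9`. On the double cover sections are `p + q w`, with `m =
6` for `p` and `m = 2` for `q`, which gives `24 + 9 = 33`.

Irreducibility comes from a generic point with `y` transcendental, whose relations all specialize to
every point of the curve. `C₋` is carried to `C₊` by `(x, y) ↦ (i x, i y)`. For the cover one also
needs that `A` is not a square in the function field of `C₊`: it has simple zeros, at points where
`g₊` has nonzero `x`-derivative. -/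

noncomputable section

namespace Maschke

open MvPolynomial

/-! ## Regular differentials and smooth affine charts -/

section Charts

variable {K : Type} [Field K] [Algebra ℂ K]

/-- The subalgebra `R` is an affine chart on which the derivation `D` is a nowhere vanishing
regular vector field: `D R` generates the unit ideal, and every function that is
not in `R` has a pole on some `D`-stable valuation ring containing `R`. -/
structure SmoothChart (D : Derivation ℂ K K) (R : Subalgebra ℂ K) : Prop where
  one_mem : (1 : K) ∈ Submodule.span ℂ {z | ∃ f ∈ R, ∃ g ∈ R, z = f * D g}
  separated : ∀ h, h ∉ R → ∃ V : ValuationSubring K, (∀ r ∈ R, r ∈ V) ∧ h ∉ V ∧ ∀ f ∈ V, D f ∈ V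

/-- The functions `h` with `u i * h ∈ R i` for all `i`. -/
def sectionsOf {ι : Type} (u : ι → K) (R : ι → Subalgebra ℂ K) : Submodule ℂ K :=
  ⨅ i, (R i).toSubmodule.comap (LinearMap.mulLeft ℂ (u i))

theorem mem_sectionsOf {ι : Type} {u : ι → K} {R : ι → Subalgebra ℂ K} {h : K} :
    h ∈ sectionsOf u R ↔ ∀ i, u i * h ∈ R i := by
  simp [sectionsOf]

/-- `D` identifies `f dg` with `f * D g`. If `u i * h` were not in `R i`, a valuation ring stable
under `u i • D` would omit it, although the differential is a sum of `f dg` over that ring.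
Conversely, each valuation ring contains some `R i`, where `1` is a combination of elements `f * u i
* D g`. -/
theorem genus_eq_finrank_sectionsOf {ι : Type} (D : Derivation ℂ K K)
    (hD : Function.Bijective D.liftKaehlerDifferential) (u : ι → K) (hu : ∀ i, u i ≠ 0)
    (R : ι → Subalgebra ℂ K) (hR : ∀ i, SmoothChart (u i • D) (R i))
    (hcover : ∀ V : ValuationSubring K, (∀ z : ℂ, algebraMap ℂ K z ∈ V) → ∃ i, ∀ r ∈ R i, r ∈ V) :
    genus K = Module.finrank ℂ (sectionsOf u R) := by
  let e : Ω[K⁄ℂ] ≃ₗ[K] K := LinearEquiv.ofBijective D.liftKaehlerDifferential hD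
  have he : ∀ f g : K, e (f • KaehlerDifferential.D ℂ K g) = f * D g := by
    intro f g
    simp [e]
  have hsymm : ∀ f g : K, e.symm (f * D g) = f • KaehlerDifferential.D ℂ K g := by
    intro f g
    rw [← he, e.symm_apply_apply]
  have key : (regularDifferentials K).map (e.restrictScalars ℂ).toLinearMap = sectionsOf u R := by
    ext h
    rw [mem_sectionsOf]
    constructor
    · rintro ⟨ω, hω, rfl⟩ i
      by_contra hi
      obtain ⟨V, hV, hhV, hDV⟩ := (hR i).separated _ hi
      apply hhV
      have hC : ∀ z : ℂ, algebraMap ℂ K z ∈ V := fun z => hV _ ((R i).algebraMap_mem z)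
      have hω' := hω
      simp only [regularDifferentials, SetLike.mem_coe, Submodule.mem_iInf] at hω'
      have hspan := hω' V hC
      change u i * e ω ∈ V
      clear hi hhV hω hω'
      induction hspan using Submodule.span_induction with
      | mem ω h =>
        obtain ⟨f, hf, g, hg, rfl⟩ := h
        rw [he, mul_left_comm]
        exact V.mul_mem _ _ hf (hDV g hg)
      | zero => simp
      | add a b _ _ ha hb =>
        rw [map_add, mul_add]
        exact V.add_mem _ _ ha hb
      | smul z a _ ha =>
        have : e (z • a) = algebraMap ℂ K z * e a := by
          rw [← algebraMap_smul K z a, map_smul, smul_eq_mul]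
        rw [this, mul_left_comm]
        exact V.mul_mem _ _ (hC z) ha
    · intro h1
      refine ⟨e.symm h, ?_, by simp⟩
      simp only [regularDifferentials, SetLike.mem_coe, Submodule.mem_iInf]
      intro V hC
      obtain ⟨i, hi⟩ := hcover V hC
      -- Multiplying `z = ∑ f * (u i * D g)` by `(u i)⁻¹ * r` leaves `∑ (r * f) * D g`, the image of
      -- `∑ (r * f) dg`. It is applied with `z = 1` and `r = u i * h`.
      have main : ∀ z ∈ Submodule.span ℂ {z | ∃ f ∈ R i, ∃ g ∈ R i, z = f * (u i • D) g},
          ∀ r ∈ R i, e.symm ((u i)⁻¹ * r * z) ∈ Submodule.span ℂ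
            {ω | ∃ f ∈ V, ∃ g ∈ V, ω = f • KaehlerDifferential.D ℂ K g} := by
        intro z hz r hr
        induction hz using Submodule.span_induction with
        | mem z h =>
          obtain ⟨f, hf, g, hg, rfl⟩ := h
          apply Submodule.subset_span
          refine ⟨r * f, V.mul_mem _ _ (hi _ hr) (hi _ hf), g, hi _ hg, ?_⟩
          rw [← hsymm]
          congr 1
          have := hu i
          simp only [Derivation.smul_apply, smul_eq_mul]
          field_simp
        | zero => simp
        | add a b _ _ ha hb =>
          rw [mul_add, map_add]
          exact Submodule.add_mem _ ha hb
        | smul c a _ ha =>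
          rw [mul_smul_comm, ← algebraMap_smul K c, map_smul, algebraMap_smul]
          exact Submodule.smul_mem _ _ ha
      have := main 1 (hR i).one_mem _ (h1 i)
      rwa [mul_one, inv_mul_cancel_left₀ (hu i)] at this
  rw [genus, ← key]
  exact (LinearEquiv.finrank_eq ((e.restrictScalars ℂ).submoduleMap (regularDifferentials K)))

/-! ### Charts given by generators and relations -/

/-- First-order Taylor expansion at `a`. It turns the gradient of a relation into a congruence
modulo the square of the maximal ideal. -/
theorem sub_linearization_mem_sq {n : ℕ} (a : Fin n → ℂ) (q : MvPolynomial (Fin n) ℂ) :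
    q - C (eval a q) - ∑ i, C (eval a (pderiv i q)) * (X i - C (a i)) ∈
      (vanishingIdeal ℂ {a} : Ideal (MvPolynomial (Fin n) ℂ)) ^ 2 := by
  have hX : ∀ i, X i - C (a i) ∈ (vanishingIdeal ℂ {a} : Ideal (MvPolynomial (Fin n) ℂ)) := by
    intro i
    simp
  induction q using MvPolynomial.induction_on with
  | C z => simp
  | add p q hp hq =>
    convert Ideal.add_mem _ hp hq using 1
    simp only [map_add, add_mul, Finset.sum_add_distrib]
    ring
  | mul_X p j hp =>
    have h2 : ∑ i, C (eval a (pderiv i p)) * ((X i - C (a i)) * (X j - C (a j))) ∈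
        (vanishingIdeal ℂ {a} : Ideal (MvPolynomial (Fin n) ℂ)) ^ 2 := by
      refine Ideal.sum_mem _ fun i _ => Ideal.mul_mem_left _ _ ?_
      rw [pow_two]
      exact Ideal.mul_mem_mul (hX i) (hX j)
    convert Ideal.add_mem _ (Ideal.mul_mem_right (X j) _ hp) h2 using 1
    have h3 : ∑ i, C (eval a (pderiv i (p * X j))) * (X i - C (a i)) =
        C (a j) * ∑ i, C (eval a (pderiv i p)) * (X i - C (a i))
          + C (eval a p) * (X j - C (a j)) := by
      rw [← Finset.add_sum_erase _ _ (Finset.mem_univ j),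
        ← Finset.add_sum_erase Finset.univ
          (fun i => C (eval a (pderiv i p)) * (X i - C (a i))) (Finset.mem_univ j),
        mul_add, Finset.mul_sum]
      have h4 : ∀ i ∈ Finset.univ.erase j, C (eval a (pderiv i (p * X j))) * (X i - C (a i)) =
          C (a j) * (C (eval a (pderiv i p)) * (X i - C (a i))) := by
        intro i hi
        have : i ≠ j := Finset.ne_of_mem_erase hi
        simp only [Derivation.leibniz, pderiv_X_of_ne this.symm, smul_eq_mul, mul_zero, zero_add,
          map_mul, eval_X]
        ring
      rw [Finset.sum_congr rfl h4]
      simp only [Derivation.leibniz, pderiv_X_self, smul_eq_mul, mul_one, map_add, map_mul, eval_X]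
      ring
    have h5 : ∑ i, C (eval a (pderiv i p)) * ((X i - C (a i)) * (X j - C (a j))) =
        (∑ i, C (eval a (pderiv i p)) * (X i - C (a i))) * (X j - C (a j)) := by
      rw [Finset.sum_mul]
      exact Finset.sum_congr rfl fun i _ => by ring
    rw [h3, h5]
    simp only [map_mul, eval_X]
    ring

/-- The Nullstellensatz, pulled back along the surjection from the polynomial ring. -/
theorem exists_point_of_isMaximal {n : ℕ} (c : Fin n → K) (m : Ideal (aeval c : _ →ₐ[ℂ] K).range)
    (hm : m.IsMaximal) : ∃ a : Fin n → ℂ,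
      ∀ p, (aeval c : _ →ₐ[ℂ] K).rangeRestrict p ∈ m ↔ eval a p = 0 := by
  have h1 : (m.comap (aeval c : _ →ₐ[ℂ] K).rangeRestrict).IsMaximal :=
    Ideal.comap_isMaximal_of_surjective _ (AlgHom.rangeRestrict_surjective _)
  obtain ⟨a, ha⟩ := isMaximal_iff_eq_vanishingIdeal_singleton.mp h1
  refine ⟨a, fun p => ?_⟩
  rw [← Ideal.mem_comap, ha, mem_vanishingIdeal_singleton_iff]
  rfl

/-- If the maximal ideal `m` of a domain of finite type is generated by one element modulo `m ^ 2`,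
then the local ring at `m` is a valuation ring. -/
theorem valuationRing_of_le_span_sup_sq {R : Type} [CommRing R] [IsDomain R] [IsNoetherianRing R]
    (m : Ideal R) [hm : m.IsMaximal] (t : R) (ht : t ∈ m) (h : m ≤ Ideal.span {t} ⊔ m ^ 2) :
    ValuationRing (Localization.AtPrime m) := by
  have : IsNoetherianRing (Localization.AtPrime m) :=
    IsLocalization.isNoetherianRing m.primeCompl _ inferInstance
  have h5 : (IsLocalRing.maximalIdeal (Localization.AtPrime m)).IsPrincipal := by
    refine ⟨⟨algebraMap R _ t, ?_⟩⟩
    rw [Ideal.submodule_span_eq]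
    apply le_antisymm
    -- Nakayama: the maximal ideal of the local ring is `(t)` plus its own square, hence equals
    -- `(t)`.
    · apply Submodule.le_of_le_smul_of_le_jacobson_bot (I := IsLocalRing.maximalIdeal _)
        (IsNoetherian.noetherian _) (IsLocalRing.maximalIdeal_le_jacobson _)
      have h1 := Ideal.map_mono (f := algebraMap R (Localization.AtPrime m)) h
      rwa [Ideal.map_sup, Ideal.map_pow, Localization.AtPrime.map_eq_maximalIdeal,
        Ideal.map_span, Set.image_singleton, pow_two] at h1
    · rw [Ideal.span_singleton_le_iff_mem, ← Localization.AtPrime.map_eq_maximalIdeal]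
      exact Ideal.mem_map_of_mem _ ht
  exact ((tfae_of_isNoetherianRing_of_isLocalRing_of_isDomain
    (Localization.AtPrime m)).out 4 1).mp h5

/-- A Jacobian criterion. In `hpt`, `X j - a j` is the local parameter at the point `a`: for each
`i` some relation has the linear part of `(X i - a i) - t (X j - a j)`. The local rings are
therefore valuation rings, and the nonvanishing of some `e i` at every point makes the `e i`
generate the unit ideal. -/
theorem SmoothChart.of_generators {n : ℕ} (c : Fin n → K) (D : Derivation ℂ K K)
    (hfrac : ∀ z : K, ∃ p q : MvPolynomial (Fin n) ℂ, z = aeval c p / aeval c q)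
    (e : Fin n → MvPolynomial (Fin n) ℂ) (he : ∀ i, D (c i) = aeval c (e i))
    (hpt : ∀ a : Fin n → ℂ, (∀ p, aeval c p = 0 → eval a p = 0) →
      (∃ i, eval a (e i) ≠ 0) ∧ ∃ j, ∀ i, ∃ q, aeval c q = 0 ∧ ∃ t : ℂ, ∀ k,
        eval a (pderiv k q) = (if k = i then 1 else 0) - t * (if k = j then 1 else 0)) :
    SmoothChart D (aeval c : _ →ₐ[ℂ] K).range := by
  set f : MvPolynomial (Fin n) ℂ →ₐ[ℂ] (aeval c : _ →ₐ[ℂ] K).range :=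
    (aeval c : _ →ₐ[ℂ] K).rangeRestrict with hf
  have hfsurj : Function.Surjective f := AlgHom.rangeRestrict_surjective _
  have hfval : ∀ p, ((f p : (aeval c : _ →ₐ[ℂ] K).range) : K) = aeval c p := fun p => rfl
  have hstable : ∀ r ∈ (aeval c : _ →ₐ[ℂ] K).range, D r ∈ (aeval c : _ →ₐ[ℂ] K).range := by
    rintro _ ⟨p, rfl⟩
    change D (aeval c p) ∈ _
    induction p using MvPolynomial.induction_on with
    | C z => simp [algHom_C]
    | add p q hp hq =>
      rw [map_add, map_add]
      exact add_mem hp hq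
    | mul_X p i hp =>
      rw [map_mul, aeval_X, Derivation.leibniz, he, smul_eq_mul, smul_eq_mul]
      refine add_mem (mul_mem ⟨p, rfl⟩ ⟨_, rfl⟩) (mul_mem ⟨X i, by simp⟩ hp)
  have hmax : ∀ m : Ideal (aeval c : _ →ₐ[ℂ] K).range, m.IsMaximal → ∃ a : Fin n → ℂ,
      (∀ p, f p ∈ m ↔ eval a p = 0) ∧ ∀ p, aeval c p = 0 → eval a p = 0 := by
    intro m hm
    obtain ⟨a, ha⟩ := exists_point_of_isMaximal c m hm
    refine ⟨a, ha, fun p hp => (ha p).mp ?_⟩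
    have : f p = 0 := Subtype.ext hp
    rw [← hf, this]
    exact m.zero_mem
  have : IsFractionRing (aeval c : _ →ₐ[ℂ] K).range K := by
    refine IsFractionRing.of_field _ K fun z => ?_
    obtain ⟨p, q, h⟩ := hfrac z
    exact ⟨f p, f q, h⟩
  have : IsNoetherianRing (aeval c : _ →ₐ[ℂ] K).range := isNoetherianRing_of_surjective _ _ f.toRingHom hfsurj
  refine ⟨?_, ?_⟩
  · have htop : Ideal.span (Set.range fun i => f (e i)) = ⊤ := by
      by_contra hne
      obtain ⟨m, hm, hle⟩ := Ideal.exists_le_maximal _ hne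
      obtain ⟨a, ha, ha0⟩ := hmax m hm
      obtain ⟨⟨i, hi⟩, -⟩ := hpt a ha0
      exact hi ((ha _).mp (hle (Ideal.subset_span ⟨i, rfl⟩)))
    have h1 : (1 : (aeval c : _ →ₐ[ℂ] K).range) ∈ Ideal.span (Set.range fun i => f (e i)) := by
      rw [htop]; trivial
    obtain ⟨r, hr⟩ := Ideal.mem_span_range_iff_exists_fun.mp h1
    have h2 := congrArg (Subtype.val) hr
    simp only [AddSubmonoidClass.coe_finsetSum, MulMemClass.coe_mul, OneMemClass.coe_one, hfval] at h2
    rw [← h2]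
    refine Submodule.sum_mem _ fun i _ => Submodule.subset_span ?_
    exact ⟨r i, (r i).2, c i, ⟨X i, by simp⟩, by rw [he]⟩
  · intro h hh
    -- A domain is the intersection of its localizations at maximal ideals, so one of these omits
    -- `h`. This localization will be the required valuation ring.
    have h1 := MaximalSpectrum.iInf_localization_eq_bot (aeval c : _ →ₐ[ℂ] K).range K
    have h2 : h ∉ (⊥ : Subalgebra (aeval c : _ →ₐ[ℂ] K).range K) := by
      intro hb
      obtain ⟨y, rfl⟩ := Algebra.mem_bot.mp hb
      exact hh y.2
    rw [← h1, Algebra.mem_iInf] at h2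
    push Not at h2
    obtain ⟨⟨m, hm⟩, h3⟩ := h2
    obtain ⟨a, ha, ha0⟩ := hmax m hm
    obtain ⟨-, j, hj⟩ := hpt a ha0
    have hVR : ValuationRing (Localization.AtPrime m) := by
      refine valuationRing_of_le_span_sup_sq m (f (X j - C (a j))) ((ha _).mpr (by simp)) ?_
      have hmap : ∀ p ∈ (vanishingIdeal ℂ {a} : Ideal (MvPolynomial (Fin n) ℂ)) ^ 2,
          f p ∈ m ^ 2 := by
        intro p hp
        have hle : Ideal.map f (vanishingIdeal ℂ {a} : Ideal (MvPolynomial (Fin n) ℂ)) ≤ m := by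
          rw [Ideal.map_le_iff_le_comap]
          intro p hp
          rw [mem_vanishingIdeal_singleton_iff] at hp
          exact (ha p).mpr hp
        have := Ideal.mem_map_of_mem f hp
        rw [Ideal.map_pow] at this
        exact Ideal.pow_right_mono hle 2 this
      have hX : ∀ i, f (X i - C (a i)) ∈ Ideal.span {f (X j - C (a j))} ⊔ m ^ 2 := by
        intro i
        obtain ⟨q, hq, t, hk⟩ := hj i
        have h4 := hmap _ (sub_linearization_mem_sq a q)
        have h5 : ∑ k, C (eval a (pderiv k q)) * (X k - C (a k)) =
            (X i - C (a i)) - C t * (X j - C (a j)) := by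
          simp_rw [hk]
          simp [sub_mul, Finset.sum_sub_distrib, apply_ite C, ite_mul]
        rw [ha0 q hq, h5, map_zero, sub_zero, map_sub] at h4
        have h6 : f q = 0 := Subtype.ext hq
        rw [h6, zero_sub, Ideal.neg_mem_iff, map_sub, map_mul] at h4
        have h7 := Ideal.mul_mem_left (Ideal.span {f (X j - C (a j))}) (f (C t))
          (Ideal.mem_span_singleton_self (f (X j - C (a j))))
        have h8 := Ideal.add_mem _ (Ideal.mem_sup_right h4) (Ideal.mem_sup_left h7)
        rwa [sub_add_cancel] at h8
      intro z hz
      obtain ⟨p, rfl⟩ := hfsurj z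
      have h4 := hmap _ (sub_linearization_mem_sq a p)
      rw [(ha p).mp hz, map_zero, sub_zero, map_sub, map_sum] at h4
      have h5 : ∑ i, f (C (eval a (pderiv i p)) * (X i - C (a i))) ∈
          Ideal.span {f (X j - C (a j))} ⊔ m ^ 2 := by
        refine Ideal.sum_mem _ fun i _ => ?_
        rw [map_mul]
        exact Ideal.mul_mem_left _ _ (hX i)
      have h8 := Ideal.add_mem _ (Ideal.mem_sup_right h4) h5
      rwa [sub_add_cancel] at h8
    set B := Localization.subalgebra.ofField K m.primeCompl m.primeCompl_le_nonZeroDivisors with hB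
    have hBmem : ∀ z, z ∈ B ↔ ∃ (r s : (aeval c : _ →ₐ[ℂ] K).range) (_ : s ∈ m.primeCompl),
        z = algebraMap _ K r * (algebraMap _ K s)⁻¹ := fun z => Iff.rfl
    have hBV : ValuationRing B :=
      (IsLocalization.algEquiv m.primeCompl (Localization.AtPrime m)
        B).toRingEquiv.toMulEquiv.surjective.valuationRing (IsLocalization.algEquiv m.primeCompl (Localization.AtPrime m)
        B).toRingEquiv.toRingHom
    let V : ValuationSubring K :=
      { B.toSubring with
        mem_or_inv_mem' := by
          intro z
          rcases ValuationRing.isInteger_or_isInteger B z with ⟨y, hy⟩ | ⟨y, hy⟩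
          · left
            rw [← hy]
            exact y.2
          · right
            rw [← hy]
            exact y.2 }
    have hV : ∀ z, z ∈ V ↔ z ∈ B := fun z => Iff.rfl
    have hRV : ∀ r ∈ (aeval c : _ →ₐ[ℂ] K).range, r ∈ V := by
      intro r hr
      exact B.algebraMap_mem ⟨r, hr⟩
    refine ⟨V, hRV, h3, ?_⟩
    intro z hz
    obtain ⟨r, s, hs, rfl⟩ := (hBmem z).mp hz
    change D ((r : K) * (s : K)⁻¹) ∈ V
    have hsinv : (s : K)⁻¹ ∈ V := (hBmem _).mpr ⟨1, s, hs, by simp⟩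
    -- The quotient rule: a localization of a `D`-stable ring is `D`-stable.
    rw [Derivation.leibniz, Derivation.leibniz_inv, smul_eq_mul, smul_eq_mul, smul_eq_mul]
    refine V.add_mem _ _ (V.mul_mem _ _ (hRV _ r.2) (V.mul_mem _ _ (V.neg_mem _ ?_) (hRV _ (hstable _ s.2)))) (V.mul_mem _ _ hsinv (hRV _ (hstable _ r.2)))
    exact pow_mem hsinv 2

end Charts

/-! ## Derivations of function fields -/

section Derivation

variable {K : Type} [Field K] [Algebra ℂ K]

/-- As `y` is transcendental, `ℂ[y]` is a polynomial ring, and the formal derivative can be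
transported to it. -/
theorem exists_derivation_adjoin (y : K) (hy : Transcendental ℂ y) :
    ∃ d : Derivation ℂ (Algebra.adjoin ℂ {y}) (Algebra.adjoin ℂ {y}),
      d ⟨y, Algebra.self_mem_adjoin_singleton ℂ y⟩ = 1 := by
  let e := Polynomial.algEquivOfTranscendental ℂ y hy
  refine ⟨Derivation.mk' (e.toLinearMap ∘ₗ Polynomial.derivative ∘ₗ e.symm.toLinearMap) ?_, ?_⟩
  · intro a b
    simp [Polynomial.derivative_mul]
    ring
  · have : (⟨y, Algebra.self_mem_adjoin_singleton ℂ y⟩ : Algebra.adjoin ℂ {y}) = e Polynomial.X := by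
      apply Subtype.ext
      simp [e]
    rw [this]
    simp

-- `ℂ(y)` is a localization of `ℂ[y]` and `K` is separable over `ℂ(y)`, so `K` is formally étale
-- over `ℂ[y]`. Hence `Ω[K⁄ℂ]` is the base change of `Ω[ℂ[y]⁄ℂ]` and is spanned by `dy`; a
-- derivation with `D y = v ≠ 0` then identifies it with `K`.
open scoped IntermediateField.algebraAdjoinAdjoin in
theorem exists_derivation_bijective_lift (y : K) (hy : Transcendental ℂ y)
    [Algebra.IsAlgebraic (IntermediateField.adjoin ℂ {y}) K] (v : K) (hv : v ≠ 0) :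
    ∃ D : Derivation ℂ K K, D y = v ∧ Function.Bijective D.liftKaehlerDifferential := by
  let A := Algebra.adjoin ℂ {y}
  let F := IntermediateField.adjoin ℂ {y}
  have : Algebra.FormallyEtale A F := .of_isLocalization (nonZeroDivisors A)
  have : Algebra.FormallyEtale F K := Algebra.FormallyEtale.of_isSeparable F K
  have : Algebra.FormallyEtale A K := .comp A F K
  let E := KaehlerDifferential.tensorKaehlerEquivOfFormallyEtale ℂ A K
  obtain ⟨d, hd⟩ := exists_derivation_adjoin y hy
  let yA : A := ⟨y, Algebra.self_mem_adjoin_singleton ℂ y⟩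
  let l : Ω[A⁄ℂ] →ₗ[A] K := (Algebra.linearMap A K) ∘ₗ d.liftKaehlerDifferential
  let ψ : Ω[K⁄ℂ] →ₗ[K] K := v • (l.liftBaseChange K ∘ₗ E.symm.toLinearMap)
  have hψy : ψ (KaehlerDifferential.D ℂ K y) = v := by
    have h1 : E.symm (KaehlerDifferential.D ℂ K y) = 1 ⊗ₜ KaehlerDifferential.D ℂ A yA :=
      KaehlerDifferential.tensorKaehlerEquivOfFormallyEtale_symm_D_algebraMap ℂ A K yA
    have h2 : d.liftKaehlerDifferential (KaehlerDifferential.D ℂ A yA) = 1 :=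
      (d.liftKaehlerDifferential_comp_D yA).trans hd
    simp [ψ, h1, l, h2]
  have hspan : ∀ ω : Ω[K⁄ℂ], ∃ z : K, ω = z • KaehlerDifferential.D ℂ K y := by
    have hA : ∀ a : A, ∃ b : A, KaehlerDifferential.D ℂ A a = b • KaehlerDifferential.D ℂ A yA := by
      rintro ⟨a, ha⟩
      induction ha using Algebra.adjoin_induction with
      | mem x hx =>
        obtain rfl : x = y := hx
        exact ⟨1, by rw [one_smul]⟩
      | algebraMap r =>
        refine ⟨0, ?_⟩
        rw [zero_smul]
        exact Derivation.map_algebraMap _ r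
      | add x z hx hz h1 h2 =>
        obtain ⟨b, hb⟩ := h1
        obtain ⟨c, hc⟩ := h2
        refine ⟨b + c, ?_⟩
        have := map_add (KaehlerDifferential.D ℂ A) ⟨x, hx⟩ ⟨z, hz⟩
        rw [add_smul, ← hb, ← hc, ← this]
        rfl
      | mul x z hx hz h1 h2 =>
        obtain ⟨b, hb⟩ := h1
        obtain ⟨c, hc⟩ := h2
        refine ⟨⟨x, hx⟩ * c + ⟨z, hz⟩ * b, ?_⟩
        have := Derivation.leibniz (KaehlerDifferential.D ℂ A) ⟨x, hx⟩ ⟨z, hz⟩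
        rw [add_smul, mul_smul, mul_smul, ← hb, ← hc, ← this]
        rfl
    have hT : ∀ t, ∃ z : K, E t = z • KaehlerDifferential.D ℂ K y := by
      intro t
      induction t using TensorProduct.induction_on with
      | zero => exact ⟨0, by simp⟩
      | add a b ha hb =>
        obtain ⟨z, hz⟩ := ha
        obtain ⟨w, hw⟩ := hb
        exact ⟨z + w, by rw [map_add, hz, hw, add_smul]⟩
      | tmul k η =>
        have hη : η ∈ Submodule.span A (Set.range (KaehlerDifferential.D ℂ A)) := by
          rw [KaehlerDifferential.span_range_derivation]; trivial
        have h3 : ∃ b : A, η = b • KaehlerDifferential.D ℂ A yA := by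
          induction hη using Submodule.span_induction with
          | mem x hx =>
            obtain ⟨a, rfl⟩ := hx
            exact hA a
          | zero => exact ⟨0, by simp⟩
          | add a b _ _ ha hb =>
            obtain ⟨z, hz⟩ := ha
            obtain ⟨w, hw⟩ := hb
            exact ⟨z + w, by rw [hz, hw, add_smul]⟩
          | smul a x _ hx =>
            obtain ⟨z, hz⟩ := hx
            exact ⟨a * z, by rw [hz, mul_smul]⟩
        obtain ⟨b, rfl⟩ := h3
        refine ⟨k * (b : K), ?_⟩
        have h1 : E (k ⊗ₜ (b • KaehlerDifferential.D ℂ A yA)) =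
            k • KaehlerDifferential.map ℂ ℂ A K (b • KaehlerDifferential.D ℂ A yA) := by
          simp only [E, KaehlerDifferential.tensorKaehlerEquivOfFormallyEtale_apply,
            KaehlerDifferential.mapBaseChange_tmul]
        rw [h1, map_smul, KaehlerDifferential.map_D, mul_smul]
        rfl
    intro ω
    obtain ⟨z, hz⟩ := hT (E.symm ω)
    exact ⟨z, by rw [← hz, E.apply_symm_apply]⟩
  have hlift : (ψ.compDer (KaehlerDifferential.D ℂ K)).liftKaehlerDifferential = ψ :=
    Derivation.liftKaehlerDifferential_unique _ _ (by
      rw [Derivation.liftKaehlerDifferential_comp])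
  refine ⟨ψ.compDer (KaehlerDifferential.D ℂ K), hψy, ?_⟩
  rw [hlift]
  constructor
  · rw [injective_iff_map_eq_zero]
    intro ω hω
    obtain ⟨z, rfl⟩ := hspan ω
    rw [map_smul, hψy, smul_eq_mul, mul_eq_zero, or_iff_left hv] at hω
    rw [hω, zero_smul]
  · intro z
    refine ⟨(z * v⁻¹) • KaehlerDifferential.D ℂ K y, ?_⟩
    rw [map_smul, hψy, smul_eq_mul, inv_mul_cancel_right₀ hv]

theorem isAlgebraic_of_generators (F : IntermediateField ℂ K) {n : ℕ} (c : Fin n → K)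
    (hfrac : ∀ z : K, ∃ p q : MvPolynomial (Fin n) ℂ, z = aeval c p / aeval c q)
    (hc : ∀ i, IsAlgebraic F (c i)) : Algebra.IsAlgebraic F K := by
  have hp : ∀ p : MvPolynomial (Fin n) ℂ, IsAlgebraic F (aeval c p) := by
    intro p
    induction p using MvPolynomial.induction_on with
    | C z =>
      rw [algHom_C]
      exact (isAlgebraic_algebraMap (R := F) (A := K) (algebraMap ℂ F z))
    | add p q hp hq => rw [map_add]; exact hp.add hq
    | mul_X p i h => rw [map_mul, aeval_X]; exact h.mul (hc i)
  refine ⟨fun z => ?_⟩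
  obtain ⟨p, q, rfl⟩ := hfrac z
  rw [div_eq_mul_inv]
  exact (hp p).mul (hp q).inv

end Derivation

/-! ## Irreducibility of `g_+` -/

/-- A root `t` gives `a² - 4 = (2 t² + a)²`. A factorization `(X² + p X + r)(X² - p X + t)` needs `r
t = 1` and `p (t - r) = 0`: either `p = 0` and `a² - 4 = (r - t)²`, or `r = t = ±1` and `p² = ±2 -
a`. -/
theorem irreducible_biquadratic {F : Type} [Field F] [CharZero F] (a : F)
    (h1 : ¬ IsSquare (a ^ 2 - 4)) (h2 : ¬ IsSquare (2 - a)) (h3 : ¬ IsSquare (-2 - a)) :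
    Irreducible (Polynomial.X ^ 4 + Polynomial.C a * Polynomial.X ^ 2 + 1 : Polynomial F) := by
  have hdeg : (Polynomial.X ^ 4 + Polynomial.C a * Polynomial.X ^ 2 + 1 :
      Polynomial F).natDegree = 4 := by compute_degree!
  have hmonic : (Polynomial.X ^ 4 + Polynomial.C a * Polynomial.X ^ 2 + 1 :
      Polynomial F).Monic := by monicity!
  have hne : (Polynomial.X ^ 4 + Polynomial.C a * Polynomial.X ^ 2 + 1 : Polynomial F) ≠ 1 := by
    intro h
    rw [h] at hdeg
    simp at hdeg
  rw [hmonic.irreducible_iff_natDegree', hdeg]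
  refine ⟨hne, fun f q hf hq hfq hmem => ?_⟩
  rw [Finset.mem_Ioc] at hmem
  have hfd : f.natDegree + q.natDegree = 4 := by
    rw [← hdeg, ← hfq, hf.natDegree_mul hq]
  obtain ⟨hq0, hq2⟩ := hmem
  obtain hq1 | hq1 : q.natDegree = 1 ∨ q.natDegree = 2 := by omega
  · have hroot : ∃ t, q.IsRoot t := by
      refine Polynomial.exists_root_of_degree_eq_one ?_
      rw [Polynomial.degree_eq_natDegree hq.ne_zero, hq1]
      rfl
    obtain ⟨t, ht⟩ := hroot
    have h := congrArg (Polynomial.eval t) hfq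
    rw [Polynomial.eval_mul, ht, mul_zero] at h
    simp only [Polynomial.eval_add, Polynomial.eval_mul, Polynomial.eval_pow, Polynomial.eval_X,
      Polynomial.eval_C, Polynomial.eval_one] at h
    exact h1 ⟨2 * t ^ 2 + a, by linear_combination 4 * h⟩
  · have hf2 : f.natDegree = 2 := by omega
    have hfe : f = Polynomial.X ^ 2 + Polynomial.C (f.coeff 1) * Polynomial.X
        + Polynomial.C (f.coeff 0) := by
      have := f.as_sum_range_C_mul_X_pow
      rw [hf2, Finset.sum_range_succ, Finset.sum_range_succ, Finset.sum_range_one] at this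
      have h2 : f.coeff 2 = 1 := by rw [← hf2]; exact hf
      rw [h2] at this
      conv_lhs => rw [this]
      simp only [Polynomial.C_1]
      ring
    have hqe : q = Polynomial.X ^ 2 + Polynomial.C (q.coeff 1) * Polynomial.X
        + Polynomial.C (q.coeff 0) := by
      have := q.as_sum_range_C_mul_X_pow
      rw [hq1, Finset.sum_range_succ, Finset.sum_range_succ, Finset.sum_range_one] at this
      have h2 : q.coeff 2 = 1 := by rw [← hq1]; exact hq
      rw [h2] at this
      conv_lhs => rw [this]
      simp only [Polynomial.C_1]
      ring
    set p := f.coeff 1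
    set r := f.coeff 0
    set s := q.coeff 1
    set t := q.coeff 0
    have hprod : (Polynomial.X ^ 4 + Polynomial.C (p + s) * Polynomial.X ^ 3
        + Polynomial.C (r + t + p * s) * Polynomial.X ^ 2 + Polynomial.C (p * t + r * s)
          * Polynomial.X + Polynomial.C (r * t) : Polynomial F) =
        Polynomial.X ^ 4 + Polynomial.C a * Polynomial.X ^ 2 + 1 := by
      rw [← hfq, hfe, hqe]
      simp only [Polynomial.C_add, Polynomial.C_mul]
      ring
    have c0 := congrArg (fun P => Polynomial.coeff P 0) hprod
    have c1 := congrArg (fun P => Polynomial.coeff P 1) hprod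
    have c2 := congrArg (fun P => Polynomial.coeff P 2) hprod
    have c3 := congrArg (fun P => Polynomial.coeff P 3) hprod
    simp only [Polynomial.coeff_add, Polynomial.coeff_C_mul, Polynomial.coeff_X_pow,
      Polynomial.coeff_X, Polynomial.coeff_C, Polynomial.coeff_one] at c0 c1 c2 c3
    norm_num at c0 c1 c2 c3
    have hs : s = -p := by linear_combination c3
    rw [hs] at c1 c2
    have h4 : p * (t - r) = 0 := by linear_combination c1
    rcases mul_eq_zero.mp h4 with h5 | h5
    · rw [h5] at c2
      exact h1 ⟨r - t, by linear_combination (-(r + t) - a) * c2 + 4 * c0⟩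
    · have ht : t = r := by linear_combination h5
      rw [ht] at c0 c2
      have h6 : (r - 1) * (r + 1) = 0 := by linear_combination c0
      rcases mul_eq_zero.mp h6 with h7 | h7
      · exact h2 ⟨p, by linear_combination c2 - 2 * h7⟩
      · exact h3 ⟨p, by linear_combination c2 - 2 * h7⟩

/-- `ℂ[X]` is integrally closed, so a square root in the fraction field is a polynomial, and every
zero of its square is multiple. -/
theorem not_isSquare_of_simple_root {F : Type} [Field F] [Algebra (Polynomial ℂ) F]
    [IsFractionRing (Polynomial ℂ) F] (p : Polynomial ℂ) (r : ℂ) (h0 : p.eval r = 0)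
    (h1 : p.derivative.eval r ≠ 0) : ¬ IsSquare (algebraMap (Polynomial ℂ) F p) := by
  rintro ⟨s, hs⟩
  have hint : IsIntegral (Polynomial ℂ) s := by
    refine ⟨Polynomial.X ^ 2 - Polynomial.C p, by monicity!, ?_⟩
    simp [hs, pow_two]
  obtain ⟨q, rfl⟩ := IsIntegrallyClosed.isIntegral_iff.mp hint
  rw [← map_mul] at hs
  have hq : p = q * q := IsFractionRing.injective (Polynomial ℂ) F hs
  rw [hq, Polynomial.eval_mul, mul_self_eq_zero] at h0
  apply h1
  rw [hq, Polynomial.derivative_mul, Polynomial.eval_add, Polynomial.eval_mul, Polynomial.eval_mul,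
    h0]
  ring

/-- The leading coefficient of `g_+` as a polynomial in `x`. -/
def leadB {R : Type} [CommRing R] (y : R) : R := 2 * y ^ 4 + y ^ 2 + 2

/-- The coefficient of `-x ^ 2` in `g_+`. -/
def midD {R : Type} [CommRing R] (y : R) : R := y ^ 4 - 24 * y ^ 2 + 1

/-- The polynomial `g_+` as a polynomial in `x` over the polynomials in `y`. -/
def gBiv : Polynomial (Polynomial ℂ) := gPlus Polynomial.X (Polynomial.C Polynomial.X)

/-- The value of a polynomial in `x` over the polynomials in `y`. -/
def biEval {K : Type} [CommRing K] [Algebra ℂ K] (x y : K) :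
    Polynomial (Polynomial ℂ) →ₐ[ℂ] K :=
  { Polynomial.eval₂RingHom (Polynomial.aeval y : Polynomial ℂ →ₐ[ℂ] K).toRingHom x with
    commutes' := by
      intro r
      simp [Polynomial.algebraMap_apply] }

@[simp]
theorem biEval_X {K : Type} [CommRing K] [Algebra ℂ K] (x y : K) :
    biEval x y Polynomial.X = x := by
  simp [biEval]

@[simp]
theorem biEval_C {K : Type} [CommRing K] [Algebra ℂ K] (x y : K) (p : Polynomial ℂ) :
    biEval x y (Polynomial.C p) = Polynomial.aeval y p := by
  simp [biEval]

theorem biEval_gBiv {K : Type} [CommRing K] [Algebra ℂ K] (x y : K) :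
    biEval x y gBiv = gPlus x y := by
  simp [gBiv, gPlus, map_ofNat]

theorem gBiv_eq : gBiv = Polynomial.C (leadB Polynomial.X) * Polynomial.X ^ 4
    - Polynomial.C (midD Polynomial.X) * Polynomial.X ^ 2
    + Polynomial.C (leadB Polynomial.X) := by
  simp [gBiv, gPlus, leadB, midD, map_ofNat]

theorem leadB_ne_zero : (leadB Polynomial.X : Polynomial ℂ) ≠ 0 := by
  intro h
  have := congrArg (Polynomial.eval 0) h
  simp [leadB] at this

theorem gBiv_natDegree : gBiv.natDegree = 4 := by
  rw [gBiv_eq]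
  compute_degree
  · exact leadB_ne_zero
  · norm_num

theorem gBiv_isPrimitive : gBiv.IsPrimitive := by
  rw [Polynomial.isPrimitive_iff_isUnit_of_C_dvd]
  intro r hr
  rw [Polynomial.C_dvd_iff_dvd_coeff] at hr
  have h0 : r ∣ leadB Polynomial.X := by
    have := hr 0
    rw [gBiv_eq] at this
    simpa [Polynomial.coeff_X, Polynomial.coeff_one, Polynomial.coeff_X_pow] using this
  have h2 : r ∣ midD Polynomial.X := by
    have := hr 2
    rw [gBiv_eq] at this
    simpa [Polynomial.coeff_X, Polynomial.coeff_one, Polynomial.coeff_X_pow,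
      Polynomial.coeff_C] using this
  have h3 : r ∣ 98 := by
    -- This comes from `b - 2 d = 49 y²` and `b = y² (2 y² + 1) + 2`: no root is shared by `b` and
    -- `d`.
    have : (98 : Polynomial ℂ) = leadB Polynomial.X * (49 - (2 * Polynomial.X ^ 2 + 1))
        + midD Polynomial.X * (2 * (2 * Polynomial.X ^ 2 + 1)) := by
      simp only [leadB, midD]
      ring
    rw [this]
    exact dvd_add (Dvd.dvd.mul_right h0 _) (Dvd.dvd.mul_right h2 _)
  have h4 : IsUnit (98 : Polynomial ℂ) := by
    have : (98 : Polynomial ℂ) = Polynomial.C 98 := (map_ofNat Polynomial.C 98).symm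
    rw [this, Polynomial.isUnit_C]
    exact (by norm_num : (98 : ℂ) ≠ 0).isUnit
  exact isUnit_of_dvd_unit h3 h4

/-- Division by `b` leaves `X⁴ - (d/b) X² + 1`. Up to squares, the three quantities that must not be
squares are `d² - 4 b²`, `(d + 2 b) b` and `(d - 2 b) b`; each has a simple zero. -/
theorem irreducible_map_gBiv {F : Type} [Field F] [CharZero F] [Algebra (Polynomial ℂ) F]
    [IsFractionRing (Polynomial ℂ) F] :
    Irreducible (gBiv.map (algebraMap (Polynomial ℂ) F)) := by
  set φ := algebraMap (Polynomial ℂ) F with hφ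
  set b := φ (leadB Polynomial.X) with hb
  set d := φ (midD Polynomial.X) with hd
  have hb0 : b ≠ 0 := (map_ne_zero_iff φ (IsFractionRing.injective _ F)).mpr leadB_ne_zero
  have hassoc : gBiv.map φ = Polynomial.C b *
      (Polynomial.X ^ 4 + Polynomial.C (-(d / b)) * Polynomial.X ^ 2 + 1) := by
    have h1 : d = b * (d / b) := by field_simp
    rw [gBiv_eq]
    simp only [Polynomial.map_add, Polynomial.map_sub, Polynomial.map_mul, Polynomial.map_pow,
      Polynomial.map_X, Polynomial.map_C, ← hb, ← hd]
    nth_rewrite 1 [h1]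
    simp only [Polynomial.C_neg, Polynomial.C_mul]
    ring
  have hirr : Irreducible (Polynomial.X ^ 4 + Polynomial.C (-(d / b)) * Polynomial.X ^ 2 + 1 :
      Polynomial F) := by
    -- Here `d - 2 b = -(3 y⁴ + 26 y² + 3)` and `d + 2 b = 5 y⁴ - 22 y² + 5`. Thus `r` is a zero of
    -- `d - 2 b`, `q` is a zero of `d + 2 b`, both simple, and `b` vanishes at neither.
    obtain ⟨r, hr⟩ : ∃ r : ℂ, 3 * r ^ 4 + 26 * r ^ 2 + 3 = 0 := by
      obtain ⟨r, hr⟩ := IsAlgClosed.exists_root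
        (3 * Polynomial.X ^ 4 + 26 * Polynomial.X ^ 2 + 3 : Polynomial ℂ) (by
          have : (3 * Polynomial.X ^ 4 + 26 * Polynomial.X ^ 2 + 3 : Polynomial ℂ).degree = 4 := by
            compute_degree!
          rw [this]; decide)
      exact ⟨r, by simpa [Polynomial.IsRoot] using hr⟩
    obtain ⟨q, hq⟩ : ∃ q : ℂ, 5 * q ^ 4 - 22 * q ^ 2 + 5 = 0 := by
      obtain ⟨r, hr⟩ := IsAlgClosed.exists_root
        (5 * Polynomial.X ^ 4 - 22 * Polynomial.X ^ 2 + 5 : Polynomial ℂ) (by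
          have : (5 * Polynomial.X ^ 4 - 22 * Polynomial.X ^ 2 + 5 : Polynomial ℂ).degree = 4 := by
            compute_degree!
          rw [this]; decide)
      exact ⟨r, by simpa [Polynomial.IsRoot] using hr⟩
    have hr0 : r ≠ 0 := by
      rintro rfl
      norm_num at hr
    have hq0 : q ≠ 0 := by
      rintro rfl
      norm_num at hq
    have hr1 : 3 * r ^ 2 + 13 ≠ 0 := by
      intro h
      have : (160 : ℂ) = 0 := by linear_combination (-3) * hr + (3 * r ^ 2 + 13) * h
      norm_num at this
    have hq1 : 5 * q ^ 2 - 11 ≠ 0 := by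
      intro h
      have : (96 : ℂ) = 0 := by linear_combination (-5) * hq + (5 * q ^ 2 - 11) * h
      norm_num at this
    have hbr : leadB r ≠ 0 := by
      intro h
      simp only [leadB] at h
      have : r ^ 2 * 49 = 0 := by linear_combination 2 * hr - 3 * h
      simp [hr0] at this
    have hbq : leadB q ≠ 0 := by
      intro h
      simp only [leadB] at h
      have : q ^ 2 * 49 = 0 := by linear_combination -2 * hq + 5 * h
      simp [hq0] at this
    apply irreducible_biquadratic
    · rintro ⟨s, hs⟩
      refine not_isSquare_of_simple_root (F := F)
        (midD Polynomial.X ^ 2 - 4 * leadB Polynomial.X ^ 2) r ?_ ?_ ⟨b * s, ?_⟩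
      · simp [midD, leadB]
        linear_combination (-5 * r ^ 4 + 22 * r ^ 2 - 5) * hr
      · have h2 : Polynomial.eval r (Polynomial.derivative
            (midD Polynomial.X ^ 2 - 4 * leadB Polynomial.X ^ 2 : Polynomial ℂ)) =
            -4 * r * (3 * r ^ 2 + 13) * (4 * leadB r) := by
          simp [midD, leadB, Polynomial.derivative_pow]
          linear_combination (-20 * r ^ 3 + 44 * r + 4 * r * (3 * r ^ 2 + 13)) * hr
        rw [h2]
        exact mul_ne_zero (mul_ne_zero (mul_ne_zero (by norm_num) hr0) hr1)
          (mul_ne_zero (by norm_num) hbr)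
      · have : φ (midD Polynomial.X ^ 2 - 4 * leadB Polynomial.X ^ 2) = d ^ 2 - 4 * b ^ 2 := by
          simp [hd, hb, map_ofNat]
        rw [← hφ, this]
        have h3 : b * s * (b * s) = b ^ 2 * (s * s) := by ring
        rw [h3, ← hs]
        field_simp
    · rintro ⟨s, hs⟩
      refine not_isSquare_of_simple_root (F := F)
        ((midD Polynomial.X + 2 * leadB Polynomial.X) * leadB Polynomial.X) q ?_ ?_ ⟨b * s, ?_⟩
      · simp only [midD, leadB, Polynomial.eval_mul, Polynomial.eval_add, Polynomial.eval_sub,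
          Polynomial.eval_pow, Polynomial.eval_X, Polynomial.eval_ofNat, Polynomial.eval_one]
        linear_combination (2 * q ^ 4 + q ^ 2 + 2) * hq
      · have h2 : Polynomial.eval q (Polynomial.derivative
            ((midD Polynomial.X + 2 * leadB Polynomial.X) * leadB Polynomial.X : Polynomial ℂ)) =
            4 * q * (5 * q ^ 2 - 11) * leadB q := by
          simp [midD, leadB, Polynomial.derivative_pow]
          linear_combination (8 * q ^ 3 + 2 * q) * hq
        rw [h2]
        exact mul_ne_zero (mul_ne_zero (mul_ne_zero (by norm_num) hq0) hq1) hbq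
      · have : φ ((midD Polynomial.X + 2 * leadB Polynomial.X) * leadB Polynomial.X) =
            (d + 2 * b) * b := by
          simp [hd, hb, map_ofNat]
        rw [← hφ, this]
        have h3 : b * s * (b * s) = b ^ 2 * (s * s) := by ring
        rw [h3, ← hs]
        field_simp
        ring
    · rintro ⟨s, hs⟩
      refine not_isSquare_of_simple_root (F := F)
        ((midD Polynomial.X - 2 * leadB Polynomial.X) * leadB Polynomial.X) r ?_ ?_ ⟨b * s, ?_⟩
      · simp only [midD, leadB, Polynomial.eval_mul, Polynomial.eval_add, Polynomial.eval_sub,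
          Polynomial.eval_pow, Polynomial.eval_X, Polynomial.eval_ofNat, Polynomial.eval_one]
        linear_combination (-2 * r ^ 4 - r ^ 2 - 2) * hr
      · have h2 : Polynomial.eval r (Polynomial.derivative
            ((midD Polynomial.X - 2 * leadB Polynomial.X) * leadB Polynomial.X : Polynomial ℂ)) =
            -4 * r * (3 * r ^ 2 + 13) * leadB r := by
          simp [midD, leadB, Polynomial.derivative_pow]
          linear_combination (-8 * r ^ 3 - 2 * r) * hr
        rw [h2]
        exact mul_ne_zero (mul_ne_zero (mul_ne_zero (by norm_num) hr0) hr1) hbr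
      · have : φ ((midD Polynomial.X - 2 * leadB Polynomial.X) * leadB Polynomial.X) =
            (d - 2 * b) * b := by
          simp [hd, hb, map_ofNat]
        rw [← hφ, this]
        have h3 : b * s * (b * s) = b ^ 2 * (s * s) := by ring
        rw [h3, ← hs]
        field_simp
        ring
  rw [hassoc]
  exact (irreducible_isUnit_mul (Polynomial.isUnit_C.mpr hb0.isUnit)).mpr hirr

theorem transcendental_aeval_eq_zero {K : Type} [CommRing K] [Algebra ℂ K] {y : K}
    (hy : Transcendental ℂ y) {p : Polynomial ℂ} (h : Polynomial.aeval y p = 0) : p = 0 := by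
  by_contra hp
  exact hy ⟨p, hp, h⟩

/-- As `y` is transcendental, `ℂ(y)` embeds in `K`. Over `ℂ(y)` a polynomial that vanishes at `x`
cannot be coprime to the irreducible `gBiv`, so it is divisible by it; as `gBiv` is primitive,
Gauss's lemma brings the divisibility down to `ℂ[y]`. -/
theorem gBiv_dvd_of_biEval_eq_zero_aux (F : Type) [Field F] [CharZero F] [Algebra (Polynomial ℂ) F]
    [IsFractionRing (Polynomial ℂ) F] {K : Type} [Field K] [Algebra ℂ K] {x y : K}
    (hg : gPlus x y = 0) (hy : Transcendental ℂ y) {p : Polynomial (Polynomial ℂ)}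
    (hp : biEval x y p = 0) : gBiv ∣ p := by
  have hinj : Function.Injective (Polynomial.aeval y : Polynomial ℂ →ₐ[ℂ] K).toRingHom := by
    rw [injective_iff_map_eq_zero]
    exact fun q hq => transcendental_aeval_eq_zero hy hq
  let σ : F →+* K := IsFractionRing.lift hinj
  have hσ : ∀ q : Polynomial (Polynomial ℂ),
      Polynomial.eval₂ σ x (q.map (algebraMap (Polynomial ℂ) F)) = biEval x y q := by
    intro q
    rw [Polynomial.eval₂_map]
    have : σ.comp (algebraMap (Polynomial ℂ) F) =
        (Polynomial.aeval y : Polynomial ℂ →ₐ[ℂ] K).toRingHom := by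
      refine RingHom.ext fun q => ?_
      simp [σ]
    rw [this]
    rfl
  have h1 : gBiv.map (algebraMap (Polynomial ℂ) F) ∣ p.map (algebraMap (Polynomial ℂ) F) := by
    rcases dvd_or_isCoprime _ (p.map (algebraMap (Polynomial ℂ) F)) irreducible_map_gBiv with
      h | ⟨u, v, huv⟩
    · exact h
    · exfalso
      have := congrArg (Polynomial.eval₂ σ x) huv
      rw [Polynomial.eval₂_add, Polynomial.eval₂_mul, Polynomial.eval₂_mul, hσ, hσ, hp,
        biEval_gBiv, hg] at this
      simp at this
  exact gBiv_isPrimitive.dvd_of_fraction_map_dvd_fraction_map h1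

/-- The ideal of relations of a generic point of the curve `g_+ = 0` is generated by `g_+`. -/
theorem gBiv_dvd_of_biEval_eq_zero {K : Type} [Field K] [Algebra ℂ K] {x y : K}
    (hg : gPlus x y = 0) (hy : Transcendental ℂ y) {p : Polynomial (Polynomial ℂ)}
    (hp : biEval x y p = 0) : gBiv ∣ p := by
  exact gBiv_dvd_of_biEval_eq_zero_aux (FractionRing (Polynomial ℂ)) hg hy hp

/-! ## Functions with bounded poles on the curve `g_+ = 0` -/

theorem map_biEval {K L : Type} [CommRing K] [Algebra ℂ K] [CommRing L] [Algebra ℂ L]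
    (φ : K →ₐ[ℂ] L) (x y : K) (p : Polynomial (Polynomial ℂ)) :
    φ (biEval x y p) = biEval (φ x) (φ y) p := by
  have h : (φ : K →+* L).comp (Polynomial.aeval y : Polynomial ℂ →ₐ[ℂ] K).toRingHom =
      (Polynomial.aeval (φ y) : Polynomial ℂ →ₐ[ℂ] L).toRingHom := by
    refine RingHom.ext fun q => ?_
    simp [Polynomial.aeval_algHom_apply]
  have h2 := Polynomial.hom_eval₂ p (Polynomial.aeval y : Polynomial ℂ →ₐ[ℂ] K).toRingHom
    (φ : K →+* L) x
  rw [h] at h2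
  exact h2

/-- The polynomial in two variables as a polynomial in the first one. -/
def toBiv : MvPolynomial (Fin 2) ℂ →ₐ[ℂ] Polynomial (Polynomial ℂ) :=
  aeval ![Polynomial.X, Polynomial.C Polynomial.X]

theorem biEval_toBiv {K : Type} [CommRing K] [Algebra ℂ K] (x y : K)
    (p : MvPolynomial (Fin 2) ℂ) : biEval x y (toBiv p) = aeval ![x, y] p := by
  have h : (biEval x y).comp toBiv = aeval ![x, y] := by
    refine MvPolynomial.algHom_ext fun i => ?_
    fin_cases i <;> simp [toBiv]
  exact congrArg (fun f => f p) h

set_option linter.unusedSectionVars false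

section Field

variable {K : Type} [Field K] [Algebra ℂ K]

/-- The algebra of polynomials in `x` and `y`. -/
def curveRing (x y : K) : Subalgebra ℂ K := (aeval ![x, y] : MvPolynomial (Fin 2) ℂ →ₐ[ℂ] K).range

theorem mem_curveRing {x y z : K} : z ∈ curveRing x y ↔ ∃ p, biEval x y p = z := by
  constructor
  · rintro ⟨p, rfl⟩
    exact ⟨toBiv p, biEval_toBiv x y p⟩
  · rintro ⟨p, rfl⟩
    refine ⟨biEval (X 0) (X 1) p, ?_⟩
    change aeval ![x, y] (biEval (X 0) (X 1) p) = _
    rw [map_biEval]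
    simp

theorem left_mem_curveRing (x y : K) : x ∈ curveRing x y := ⟨X 0, by simp⟩

theorem right_mem_curveRing (x y : K) : y ∈ curveRing x y := ⟨X 1, by simp⟩

theorem aeval_mem_curveRing (x y : K) (p : Polynomial ℂ) : Polynomial.aeval y p ∈ curveRing x y :=
  mem_curveRing.mpr ⟨Polynomial.C p, by simp⟩

theorem eval₂_inv_mul_pow {R : Type} [CommRing R] (i : R →+* K) {z : K} (hz : z ≠ 0) {N : ℕ}
    {p : Polynomial R} (hp : p.natDegree ≤ N) :
    Polynomial.eval₂ i z⁻¹ p * z ^ N = Polynomial.eval₂ i z (p.reflect N) := by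
  have hz' : z⁻¹ ≠ 0 := inv_ne_zero hz
  let _ := invertibleOfNonzero hz'
  have := Polynomial.eval₂_reflect_mul_pow i z⁻¹ N p hp
  rw [invOf_eq_inv, inv_inv] at this
  rw [← this, mul_assoc, ← mul_pow, inv_mul_cancel₀ hz, one_pow, mul_one]

theorem natDegree_reflect_le_of_le {R : Type} [CommRing R] {N : ℕ} {p : Polynomial R}
    (hp : p.natDegree ≤ N) : (p.reflect N).natDegree ≤ N :=
  Polynomial.natDegree_reflect_le.trans (max_le le_rfl hp)

/-- The function with values `b x³ - d x = -b / x` on the curve, where `b x⁴ - d x² + b = g_+`. -/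
def cubicSection (x y : K) : K := leadB y * x ^ 3 - midD y * x

/-- The function `α(y) + β(y) x + γ(y) x² + ρ(y) (b x³ - d x)`. -/
def combination (x y : K) : (Polynomial ℂ × Polynomial ℂ × Polynomial ℂ × Polynomial ℂ) →ₗ[ℂ] K where
  toFun c := Polynomial.aeval y c.1 + Polynomial.aeval y c.2.1 * x
    + Polynomial.aeval y c.2.2.1 * x ^ 2 + Polynomial.aeval y c.2.2.2 * cubicSection x y
  map_add' c c' := by
    simp only [Prod.fst_add, Prod.snd_add, map_add]
    ring
  map_smul' r c := by
    simp only [Prod.smul_fst, Prod.smul_snd, map_smul, RingHom.id_apply, smul_add, smul_mul_assoc]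

variable {x y : K}

theorem aeval_leadB (y : K) : Polynomial.aeval y (leadB Polynomial.X : Polynomial ℂ) = leadB y := by
  simp [leadB, map_ofNat]

theorem aeval_midD (y : K) : Polynomial.aeval y (midD Polynomial.X : Polynomial ℂ) = midD y := by
  simp [midD, map_ofNat]

theorem gPlus_eq (x y : K) : gPlus x y = x * cubicSection x y + leadB y := by
  simp only [gPlus, cubicSection, leadB, midD]
  ring

theorem leadB_ne_zero_of_transcendental (hy : Transcendental ℂ y) : leadB y ≠ 0 := by
  rw [← aeval_leadB]
  exact fun h => leadB_ne_zero (transcendental_aeval_eq_zero hy h)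

theorem ne_zero_of_transcendental (hy : Transcendental ℂ y) : y ≠ 0 := by
  rintro rfl
  exact hy isAlgebraic_zero

theorem x_ne_zero (hg : gPlus x y = 0) (hy : Transcendental ℂ y) : x ≠ 0 := by
  rintro rfl
  rw [gPlus_eq, zero_mul, zero_add] at hg
  exact leadB_ne_zero_of_transcendental hy hg

theorem gPlus_inv_left (hg : gPlus x y = 0) : gPlus x⁻¹ y = 0 := by
  by_cases hx : x = 0
  · simpa [hx] using hg
  · have : gPlus x⁻¹ y * x ^ 4 = gPlus x y := by
      simp only [gPlus]
      field_simp
      ring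
    rw [hg] at this
    simpa [hx] using this

theorem gPlus_inv_right (hg : gPlus x y = 0) : gPlus x y⁻¹ = 0 := by
  by_cases hy : y = 0
  · simpa [hy] using hg
  · have : gPlus x y⁻¹ * y ^ 4 = gPlus x y := by
      simp only [gPlus]
      field_simp
      ring
    rw [hg] at this
    simpa [hy] using this

theorem transcendental_inv (hy : Transcendental ℂ y) : Transcendental ℂ y⁻¹ := by
  intro h
  apply hy
  simpa using h.inv

/-- A combination is a polynomial of degree at most `3` in `x`, and a relation would be divisible by
`gBiv`, of degree `4`. The coefficient of `x³` is `r b`, so `r` vanishes first. -/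
theorem combination_injective (hg : gPlus x y = 0) (hy : Transcendental ℂ y) :
    Function.Injective (combination x y) := by
  rw [injective_iff_map_eq_zero]
  rintro ⟨a, b, c, r⟩ h
  set P : Polynomial (Polynomial ℂ) := Polynomial.C a +
    Polynomial.C (b - r * midD Polynomial.X) * Polynomial.X + Polynomial.C c * Polynomial.X ^ 2
    + Polynomial.C (r * leadB Polynomial.X) * Polynomial.X ^ 3 with hP
  have hP0 : biEval x y P = 0 := by
    rw [← h]
    simp only [hP, combination, cubicSection, LinearMap.coe_mk, AddHom.coe_mk, map_add, map_mul,
      map_pow, map_sub, biEval_C, biEval_X, aeval_leadB, aeval_midD]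
    ring
  have hdeg : P.natDegree < gBiv.natDegree := by
    rw [gBiv_natDegree, Nat.lt_succ_iff, hP]
    compute_degree
  have hz : P = 0 := by
    by_contra hne
    exact absurd (Polynomial.natDegree_le_of_dvd (gBiv_dvd_of_biEval_eq_zero hg hy hP0) hne)
      (not_le.mpr hdeg)
  have c0 := congrArg (fun Q => Polynomial.coeff Q 0) hz
  have c1 := congrArg (fun Q => Polynomial.coeff Q 1) hz
  have c2 := congrArg (fun Q => Polynomial.coeff Q 2) hz
  have c3 := congrArg (fun Q => Polynomial.coeff Q 3) hz
  simp only [hP, Polynomial.coeff_add, Polynomial.coeff_C_mul, Polynomial.coeff_X_pow,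
    Polynomial.coeff_X, Polynomial.coeff_C, Polynomial.coeff_zero] at c0 c1 c2 c3
  norm_num at c0 c1 c2 c3
  have hr : r = 0 := c3.resolve_right leadB_ne_zero
  rw [hr, zero_mul, sub_zero] at c1
  simp [c0, c1, c2, hr]

/-- Three of the four functions are the sections `1, x, x²` of `O(2)` on the `x`-line. The fourth,
equal to `-b / x` on the curve, is not one of these: it comes from the one-dimensional `H¹(O(2 -
4))` in the restriction sequence of a curve of degree `4` in `x`. -/
theorem exists_combination (hg : gPlus x y = 0) (hy : Transcendental ℂ y) {h : K}
    (h1 : h ∈ curveRing x y) (h2 : (x ^ 2)⁻¹ * h ∈ curveRing x⁻¹ y) :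
    ∃ c, h = combination x y c := by
  have hx := x_ne_zero hg hy
  obtain ⟨p, hp⟩ := mem_curveRing.mp h1
  obtain ⟨q, hq⟩ := mem_curveRing.mp h2
  obtain ⟨M, hM⟩ : ∃ M, q.natDegree ≤ M + 1 := ⟨q.natDegree, Nat.le_succ _⟩
  set Q := Polynomial.X ^ 2 * q.reflect (M + 1) with hQ
  have hQh : biEval x y Q = x ^ (M + 1) * h := by
    have h3 : biEval x⁻¹ y q * x ^ (M + 1) = biEval x y (q.reflect (M + 1)) :=
      eval₂_inv_mul_pow _ hx hM
    rw [hQ, map_mul, map_pow, biEval_X, ← h3, hq]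
    field_simp
  have hQdeg : Q.degree < (M + 4 : ℕ) := by
    refine (Polynomial.degree_le_natDegree).trans_lt ?_
    rw [Nat.cast_lt]
    refine (Polynomial.natDegree_mul_le).trans_lt ?_
    have := natDegree_reflect_le_of_le hM
    rw [Polynomial.natDegree_X_pow]
    omega
  -- Both polynomials represent `x ^ (M + 1) * h`: one comes from the chart in `x`, the other, of
  -- degree below `M + 4`, from the chart in `1/x`.
  obtain ⟨r, hr⟩ : gBiv ∣ p * Polynomial.X ^ (M + 1) - Q := by
    refine gBiv_dvd_of_biEval_eq_zero hg hy ?_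
    rw [map_sub, map_mul, map_pow, biEval_X, hQh, hp]
    ring
  -- The quotient `r` is cut into the part below `X ^ M`, the single coefficient `ρ` of `X ^ M`, and
  -- the multiples of `X ^ (M + 1)`. The last can be removed from `p`, the first has harmless
  -- degree, and `ρ` becomes the coefficient of `cubicSection`.
  set r2 := r %ₘ Polynomial.X ^ M with hr2
  set s := r /ₘ Polynomial.X ^ M with hs
  have hrs : r = r2 + Polynomial.X ^ M * s := (Polynomial.modByMonic_add_div r _).symm
  have hr2deg : r2.degree < M := by
    have := Polynomial.degree_modByMonic_lt r (Polynomial.monic_X_pow (R := Polynomial ℂ) M)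
    rwa [Polynomial.degree_X_pow] at this
  have hss : s = Polynomial.X * s.divX + Polynomial.C (s.coeff 0) := (Polynomial.X_mul_divX_add s).symm
  set ρ := s.coeff 0
  set E : Polynomial (Polynomial ℂ) := Polynomial.C (leadB Polynomial.X) * Polynomial.X ^ 3
    - Polynomial.C (midD Polynomial.X) * Polynomial.X with hE
  have hgE : gBiv = Polynomial.X * E + Polynomial.C (leadB Polynomial.X) := by
    rw [gBiv_eq, hE]
    ring
  set P := p - gBiv * s.divX - Polynomial.C ρ * E with hP
  -- Since `gBiv = X E + b`, subtracting `ρ E` from `p` leaves only the error `ρ b X ^ M`. All terms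
  -- on the right have degree below `M + 4`, whence `deg P < 3`.
  have hXP : Polynomial.X ^ (M + 1) * P =
      Q + Polynomial.C (ρ * leadB Polynomial.X) * Polynomial.X ^ M + gBiv * r2 := by
    have h4 : p * Polynomial.X ^ (M + 1) = Q + gBiv * r := by rw [← hr]; ring
    have h5 : gBiv * r = gBiv * r2 + gBiv * Polynomial.X ^ (M + 1) * s.divX +
        gBiv * (Polynomial.X ^ M * Polynomial.C ρ) := by
      rw [hrs]
      nth_rewrite 1 [hss]
      ring
    have h6 : gBiv * (Polynomial.X ^ M * Polynomial.C ρ) =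
        Polynomial.X ^ (M + 1) * (Polynomial.C ρ * E) +
          Polynomial.C (ρ * leadB Polynomial.X) * Polynomial.X ^ M := by
      rw [hgE, Polynomial.C_mul]
      ring
    rw [hP, mul_sub, mul_sub, mul_comm _ p, h4, h5, h6]
    ring
  have hdeg : Polynomial.degree (Polynomial.X ^ (M + 1) * P) < ((M + 4 : ℕ) : WithBot ℕ) := by
    rw [hXP]
    refine (Polynomial.degree_add_le _ _).trans_lt (max_lt ?_ ?_)
    · refine (Polynomial.degree_add_le _ _).trans_lt (max_lt hQdeg ?_)
      refine (Polynomial.degree_C_mul_X_pow_le _ _).trans_lt ?_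
      exact_mod_cast (by omega : M < M + 4)
    · by_cases h0 : r2 = 0
      · rw [h0, mul_zero, Polynomial.degree_zero]
        exact WithBot.bot_lt_coe _
      · have hg0 : gBiv ≠ 0 := by
          intro h
          have := gBiv_natDegree
          rw [h] at this
          simp at this
        rw [Polynomial.degree_mul, Polynomial.degree_eq_natDegree hg0, gBiv_natDegree,
          Polynomial.degree_eq_natDegree h0]
        rw [Polynomial.degree_eq_natDegree h0] at hr2deg
        have : r2.natDegree < M := by exact_mod_cast hr2deg
        exact_mod_cast (by omega : 4 + r2.natDegree < M + 4)
  have hPdeg : P.natDegree < 3 := by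
    by_cases h0 : P = 0
    · simp [h0]
    · rw [Polynomial.degree_mul, Polynomial.degree_X_pow, Polynomial.degree_eq_natDegree h0] at hdeg
      have : M + 1 + P.natDegree < M + 4 := by exact_mod_cast hdeg
      omega
  refine ⟨(P.coeff 0, P.coeff 1, P.coeff 2, ρ), ?_⟩
  have hPsum := P.as_sum_range' 3 hPdeg
  rw [Finset.sum_range_succ, Finset.sum_range_succ, Finset.sum_range_one] at hPsum
  have hpe : p = P + gBiv * s.divX + Polynomial.C ρ * E := by rw [hP]; ring
  have hPe := congrArg (biEval x y) hPsum
  simp only [map_add, map_mul, map_pow, ← Polynomial.C_mul_X_pow_eq_monomial, biEval_C,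
    biEval_X] at hPe
  rw [← hp, hpe]
  simp only [combination, cubicSection, map_add, map_mul, biEval_gBiv, hg, hE, map_sub, map_pow,
    biEval_C, biEval_X, aeval_leadB, aeval_midD, LinearMap.coe_mk, AddHom.coe_mk]
  linear_combination hPe

/-- The functions that are regular on the affine curve, with poles of order at most `2` along
`x = ∞` and at most `m` along `y = ∞`. -/
def boundedPoles (x y : K) (m : ℕ) : Submodule ℂ K :=
  (curveRing x y).toSubmodule
    ⊓ (curveRing x⁻¹ y).toSubmodule.comap (LinearMap.mulLeft ℂ (x ^ 2)⁻¹)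
    ⊓ ((curveRing x y⁻¹).toSubmodule.comap (LinearMap.mulLeft ℂ (y ^ m)⁻¹)
    ⊓ (curveRing x⁻¹ y⁻¹).toSubmodule.comap (LinearMap.mulLeft ℂ ((x ^ 2)⁻¹ * (y ^ m)⁻¹)))

theorem mem_boundedPoles {m : ℕ} {h : K} : h ∈ boundedPoles x y m ↔
    (h ∈ curveRing x y ∧ (x ^ 2)⁻¹ * h ∈ curveRing x⁻¹ y) ∧
      (y ^ m)⁻¹ * h ∈ curveRing x y⁻¹ ∧ (x ^ 2)⁻¹ * (y ^ m)⁻¹ * h ∈ curveRing x⁻¹ y⁻¹ := Iff.rfl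

/-! ### Passage between the charts `y` and `1/y`. -/

theorem exists_aeval_inv_mul_pow (hy : y ≠ 0) (p : Polynomial ℂ) {N : ℕ} (hp : p.natDegree ≤ N) :
    ∃ q : Polynomial ℂ, q.natDegree ≤ N ∧
      Polynomial.aeval y⁻¹ p * y ^ N = Polynomial.aeval y q :=
  ⟨p.reflect N, natDegree_reflect_le_of_le hp, eval₂_inv_mul_pow _ hy hp⟩

theorem inv_pow_mul_aeval_mem (hy : y ≠ 0) (z : K) {p : Polynomial ℂ} {N : ℕ}
    (hp : p.natDegree ≤ N) : (y ^ N)⁻¹ * Polynomial.aeval y p ∈ curveRing z y⁻¹ := by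
  obtain ⟨q, -, hq⟩ := exists_aeval_inv_mul_pow (inv_ne_zero hy) p hp
  rw [inv_inv, inv_pow] at hq
  rw [mul_comm, hq]
  exact aeval_mem_curveRing z y⁻¹ q

/-- `b` and `d` are palindromic of degree `4`. This is why the fourth coefficient loses four degrees
in `CoeffSpace`. -/
theorem cubicSection_inv_right (hy : y ≠ 0) : cubicSection x y⁻¹ = (y ^ 4)⁻¹ * cubicSection x y := by
  simp only [cubicSection, leadB, midD]
  field_simp
  ring

theorem cubicSection_mem (x y : K) : cubicSection x y ∈ curveRing x y := by
  rw [cubicSection, ← aeval_leadB, ← aeval_midD]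
  exact sub_mem (mul_mem (aeval_mem_curveRing x y _) (pow_mem (left_mem_curveRing x y) _))
    (mul_mem (aeval_mem_curveRing x y _) (left_mem_curveRing x y))

theorem inv_sq_mul_cubicSection_mem (hx : x ≠ 0) (hg : gPlus x y = 0) :
    (x ^ 2)⁻¹ * cubicSection x y ∈ curveRing x⁻¹ y := by
  have : (x ^ 2)⁻¹ * cubicSection x y = - (x⁻¹ ^ 3 * leadB y) := by
    rw [gPlus_eq] at hg
    field_simp
    linear_combination hg
  rw [this, ← aeval_leadB]
  exact neg_mem (mul_mem (pow_mem (left_mem_curveRing _ _) _) (aeval_mem_curveRing _ _ _))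

/-- The coefficients of the functions in `boundedPoles`. -/
abbrev CoeffSpace (m : ℕ) : Type :=
  Polynomial.degreeLT ℂ (m + 1) × Polynomial.degreeLT ℂ (m + 1) × Polynomial.degreeLT ℂ (m + 1)
    × Polynomial.degreeLT ℂ (m - 3)

/-- The inclusion of the coefficients with bounded degrees. -/
def coeffIncl (m : ℕ) :
    CoeffSpace m →ₗ[ℂ] (Polynomial ℂ × Polynomial ℂ × Polynomial ℂ × Polynomial ℂ) :=
  (Submodule.subtype _).prodMap ((Submodule.subtype _).prodMap
    ((Submodule.subtype _).prodMap (Submodule.subtype _)))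

theorem coeffIncl_injective (m : ℕ) : Function.Injective (coeffIncl m) := by
  rintro ⟨a, b, c, d⟩ ⟨a', b', c', d'⟩ h
  simpa [coeffIncl] using h

/-- The subtraction `m - 3` in `CoeffSpace` is truncated: for `m ≤ 3` the fourth coefficient is
zero, otherwise its degree is at most `m - 4`. -/
theorem mem_range_coeffIncl {m : ℕ} {a b c r : Polynomial ℂ} :
    (a, b, c, r) ∈ LinearMap.range (coeffIncl m) ↔
      a.natDegree ≤ m ∧ b.natDegree ≤ m ∧ c.natDegree ≤ m ∧ (r = 0 ∨ r.natDegree + 4 ≤ m) := by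
  have h1 : ∀ p : Polynomial ℂ, p ∈ Polynomial.degreeLT ℂ (m + 1) ↔ p.natDegree ≤ m := by
    intro p
    rw [Polynomial.degreeLT_succ_eq_degreeLE, Polynomial.mem_degreeLE,
      Polynomial.natDegree_le_iff_degree_le]
  have h2 : ∀ p : Polynomial ℂ, p ∈ Polynomial.degreeLT ℂ (m - 3) ↔
      (p = 0 ∨ p.natDegree + 4 ≤ m) := by
    intro p
    rw [Polynomial.mem_degreeLT]
    by_cases hp : p = 0
    · simp [hp]
    · rw [Polynomial.degree_eq_natDegree hp, Nat.cast_lt]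
      simp only [hp, false_or]
      omega
  rw [← h1, ← h1, ← h1, ← h2]
  constructor
  · rintro ⟨⟨a', b', c', r'⟩, h⟩
    simp only [coeffIncl, LinearMap.prodMap_apply, Submodule.subtype_apply, Prod.mk.injEq] at h
    obtain ⟨rfl, rfl, rfl, rfl⟩ := h
    exact ⟨a'.2, b'.2, c'.2, r'.2⟩
  · rintro ⟨ha, hb, hc, hr⟩
    exact ⟨(⟨a, ha⟩, ⟨b, hb⟩, ⟨c, hc⟩, ⟨r, hr⟩), rfl⟩

theorem combination_mem_boundedPoles (hg : gPlus x y = 0) (hy : Transcendental ℂ y) {m : ℕ}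
    {c : Polynomial ℂ × Polynomial ℂ × Polynomial ℂ × Polynomial ℂ}
    (hc : c ∈ LinearMap.range (coeffIncl m)) : combination x y c ∈ boundedPoles x y m := by
  obtain ⟨a, b, c, r⟩ := c
  obtain ⟨ha, hb, hc, hr⟩ := mem_range_coeffIncl.mp hc
  have hx := x_ne_zero hg hy
  have hy0 := ne_zero_of_transcendental hy
  have hmono : ∀ (p : Polynomial ℂ) (i : ℕ), i ≤ 2 → p.natDegree ≤ m →
      Polynomial.aeval y p * x ^ i ∈ boundedPoles x y m := by
    intro p i hi hp
    have h1 : (x ^ 2)⁻¹ * x ^ i = x⁻¹ ^ (2 - i) := by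
      obtain ⟨j, hj⟩ := Nat.exists_eq_add_of_le hi
      rw [hj, Nat.add_sub_cancel_left, pow_add, inv_pow]
      field_simp
    refine mem_boundedPoles.mpr ⟨⟨?_, ?_⟩, ?_, ?_⟩
    · exact mul_mem (aeval_mem_curveRing _ _ _) (pow_mem (left_mem_curveRing _ _) _)
    · rw [mul_left_comm, h1]
      exact mul_mem (aeval_mem_curveRing _ _ _) (pow_mem (left_mem_curveRing _ _) _)
    · rw [← mul_assoc]
      exact mul_mem (inv_pow_mul_aeval_mem hy0 _ hp) (pow_mem (left_mem_curveRing _ _) _)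
    · have h2 : (x ^ 2)⁻¹ * (y ^ m)⁻¹ * (Polynomial.aeval y p * x ^ i) =
          (y ^ m)⁻¹ * Polynomial.aeval y p * ((x ^ 2)⁻¹ * x ^ i) := by ring
      rw [h2, h1]
      exact mul_mem (inv_pow_mul_aeval_mem hy0 _ hp) (pow_mem (left_mem_curveRing _ _) _)
  have hcub : Polynomial.aeval y r * cubicSection x y ∈ boundedPoles x y m := by
    rcases hr with rfl | hr
    · rw [map_zero, zero_mul]
      exact zero_mem _
    · obtain ⟨n, rfl⟩ := Nat.exists_eq_add_of_le hr
      have h1 : ∀ z : K, (y ^ (r.natDegree + 4 + n))⁻¹ * (Polynomial.aeval y r * z) =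
          ((y ^ (r.natDegree + n))⁻¹ * Polynomial.aeval y r) * ((y ^ 4)⁻¹ * z) := by
        intro z
        field_simp
        ring
      have hr' : r.natDegree ≤ r.natDegree + n := Nat.le_add_right _ _
      refine mem_boundedPoles.mpr ⟨⟨?_, ?_⟩, ?_, ?_⟩
      · exact mul_mem (aeval_mem_curveRing _ _ _) (cubicSection_mem x y)
      · rw [mul_left_comm]
        exact mul_mem (aeval_mem_curveRing _ _ _) (inv_sq_mul_cubicSection_mem hx hg)
      · rw [h1, ← cubicSection_inv_right hy0]
        exact mul_mem (inv_pow_mul_aeval_mem hy0 _ hr') (cubicSection_mem _ _)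
      · rw [mul_assoc, h1, mul_left_comm, ← cubicSection_inv_right hy0]
        exact mul_mem (inv_pow_mul_aeval_mem hy0 _ hr')
          (inv_sq_mul_cubicSection_mem hx (gPlus_inv_right hg))
  have h0 := hmono a 0 (by norm_num) ha
  have h1 := hmono b 1 (by norm_num) hb
  rw [pow_zero, mul_one] at h0
  rw [pow_one] at h1
  exact add_mem (add_mem (add_mem h0 h1) (hmono c 2 le_rfl hc)) hcub

/-- The function is expanded over `ℂ[y]` and, after multiplication by `y⁻ᵐ`, over `ℂ[1/y]`.
Uniqueness of the coefficients makes the two expansions agree, which bounds the degrees. -/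
theorem exists_combination_of_mem_boundedPoles (hg : gPlus x y = 0) (hy : Transcendental ℂ y)
    {m : ℕ} {h : K} (hh : h ∈ boundedPoles x y m) :
    ∃ c ∈ LinearMap.range (coeffIncl m), combination x y c = h := by
  have hy0 := ne_zero_of_transcendental hy
  obtain ⟨⟨h1, h2⟩, h3, h4⟩ := mem_boundedPoles.mp hh
  obtain ⟨⟨a, b, c, r⟩, rfl⟩ := exists_combination hg hy h1 h2
  rw [mul_assoc] at h4
  obtain ⟨⟨a', b', c', r'⟩, h5⟩ :=
    exists_combination (gPlus_inv_right hg) (transcendental_inv hy) h3 h4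
  refine ⟨_, ?_, rfl⟩
  obtain ⟨N, ha, hb, hc, hr⟩ : ∃ N, a'.natDegree ≤ N ∧ b'.natDegree ≤ N ∧ c'.natDegree ≤ N ∧
      r'.natDegree ≤ N :=
    ⟨a'.natDegree + b'.natDegree + c'.natDegree + r'.natDegree, by omega, by omega, by omega,
      by omega⟩
  obtain ⟨a1, ha1, ha2⟩ := exists_aeval_inv_mul_pow hy0 a' ha
  obtain ⟨b1, hb1, hb2⟩ := exists_aeval_inv_mul_pow hy0 b' hb
  obtain ⟨c1, hc1, hc2⟩ := exists_aeval_inv_mul_pow hy0 c' hc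
  obtain ⟨r1, hr1, hr2⟩ := exists_aeval_inv_mul_pow hy0 r' hr
  -- Both expansions are multiplied by `y ^ (N + 4 + m)`, which clears all powers of `1/y`. The last
  -- exponent is `m` instead of `m + 4` because `cubicSection x y⁻¹` absorbs a factor `y⁻⁴`.
  have key : combination x y (Polynomial.X ^ (N + 4) * a, Polynomial.X ^ (N + 4) * b,
      Polynomial.X ^ (N + 4) * c, Polynomial.X ^ (N + 4) * r) =
      combination x y (Polynomial.X ^ (m + 4) * a1, Polynomial.X ^ (m + 4) * b1,
      Polynomial.X ^ (m + 4) * c1, Polynomial.X ^ m * r1) := by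
    simp only [combination, LinearMap.coe_mk, AddHom.coe_mk, map_mul, map_pow,
      Polynomial.aeval_X, ← ha2, ← hb2, ← hc2, ← hr2] at h5 ⊢
    rw [cubicSection_inv_right hy0] at h5
    rw [inv_mul_eq_iff_eq_mul₀ (pow_ne_zero _ hy0)] at h5
    have h6 := congrArg (fun z => y ^ (N + 4) * z) h5
    have h7 : y ^ 4 * (y ^ 4)⁻¹ = 1 := mul_inv_cancel₀ (pow_ne_zero _ hy0)
    linear_combination h6 + (y ^ N * y ^ m * Polynomial.aeval y⁻¹ r' * cubicSection x y) * h7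
  have h8 := combination_injective hg hy key
  simp only [Prod.mk.injEq] at h8
  obtain ⟨e1, e2, e3, e4⟩ := h8
  have hdeg : ∀ (p q : Polynomial ℂ) (k : ℕ), Polynomial.X ^ (N + 4) * p = Polynomial.X ^ k * q →
      q.natDegree ≤ N → p = 0 ∨ p.natDegree + 4 ≤ k := by
    intro p q k h hq
    by_cases hp : p = 0
    · exact Or.inl hp
    · right
      have h9 := congrArg Polynomial.natDegree h
      rw [Polynomial.natDegree_mul (pow_ne_zero _ Polynomial.X_ne_zero) hp,
        Polynomial.natDegree_X_pow] at h9
      have h10 := Polynomial.natDegree_mul_le (p := (Polynomial.X ^ k : Polynomial ℂ)) (q := q)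
      rw [Polynomial.natDegree_X_pow, ← h9] at h10
      omega
  have hdeg' : ∀ (p q : Polynomial ℂ), Polynomial.X ^ (N + 4) * p = Polynomial.X ^ (m + 4) * q →
      q.natDegree ≤ N → p.natDegree ≤ m := by
    intro p q h hq
    rcases hdeg p q _ h hq with rfl | h
    · simp
    · omega
  exact mem_range_coeffIncl.mpr
    ⟨hdeg' _ _ e1 ha1, hdeg' _ _ e2 hb1, hdeg' _ _ e3 hc1, hdeg _ _ _ e4 hr1⟩

/-- The functions in `boundedPoles` are given by their coefficients. -/
def boundedPolesEquiv (hg : gPlus x y = 0) (hy : Transcendental ℂ y) (m : ℕ) :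
    CoeffSpace m ≃ₗ[ℂ] boundedPoles x y m :=
  LinearEquiv.ofBijective ((combination x y ∘ₗ coeffIncl m).codRestrict (boundedPoles x y m)
    fun c => combination_mem_boundedPoles hg hy ⟨c, rfl⟩) (by
      constructor
      · intro c c' h
        exact coeffIncl_injective m (combination_injective hg hy (congrArg Subtype.val h))
      · rintro ⟨h, hh⟩
        obtain ⟨_, ⟨c, rfl⟩, hc⟩ := exists_combination_of_mem_boundedPoles hg hy hh
        exact ⟨c, Subtype.ext hc⟩)

theorem finrank_degreeLT (n : ℕ) : Module.finrank ℂ (Polynomial.degreeLT ℂ n) = n := by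
  rw [(Polynomial.degreeLTEquiv ℂ n).finrank_eq, Module.finrank_fin_fun]

instance finite_degreeLT (n : ℕ) : Module.Finite ℂ (Polynomial.degreeLT ℂ n) :=
  Module.Finite.equiv (Polynomial.degreeLTEquiv ℂ n).symm

theorem finite_boundedPoles (hg : gPlus x y = 0) (hy : Transcendental ℂ y) (m : ℕ) :
    Module.Finite ℂ (boundedPoles x y m) :=
  Module.Finite.equiv (boundedPolesEquiv hg hy m)

theorem finrank_boundedPoles (hg : gPlus x y = 0) (hy : Transcendental ℂ y) (m : ℕ) :
    Module.finrank ℂ (boundedPoles x y m) = 3 * (m + 1) + (m - 3) := by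
  rw [← (boundedPolesEquiv hg hy m).finrank_eq]
  simp only [CoeffSpace, Module.finrank_prod, finrank_degreeLT]
  ring

end Field

/-! ## Smoothness of the affine curves -/

section Partials

variable {R : Type} [CommRing R]

/-- The partial derivative of `g_+` with respect to `x`. -/
def gPlusX (x y : R) : R := 4 * leadB y * x ^ 3 - 2 * midD y * x

/-- The partial derivative of `g_+` with respect to `y`. -/
def gPlusY (x y : R) : R := (8 * y ^ 3 + 2 * y) * (x ^ 4 + 1) - (4 * y ^ 3 - 48 * y) * x ^ 2

/-- The derivative of `A`. -/
def coeffA' (y : R) : R := 8 * y ^ 7 + 56 * y ^ 3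

theorem gPlus_eq_leadB_midD (x y : R) :
    gPlus x y = leadB y * x ^ 4 - midD y * x ^ 2 + leadB y := rfl

end Partials

/-- `4 A - (2 y⁴ + 2 - y²) b = 49 y⁴`, and `b` does not vanish at `0`. -/
theorem leadB_ne_zero_of_coeffA {y : ℂ} (hA : coeffA y = 0) : leadB y ≠ 0 := by
  intro h
  simp only [coeffA, leadB] at hA h
  have h1 : y ^ 4 * 49 = 0 := by linear_combination 4 * hA - (2 * y ^ 4 + 2 - y ^ 2) * h
  have h2 : y = 0 := by simpa using h1
  rw [h2] at h
  norm_num at h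

theorem leadB_deriv_ne_zero {y : ℂ} (h : leadB y = 0) : 8 * y ^ 3 + 2 * y ≠ 0 := by
  intro h1
  simp only [leadB] at h
  have h2 : y * (4 * y ^ 2 + 1) = 0 := by linear_combination h1 / 2
  rcases mul_eq_zero.mp h2 with h3 | h3
  · rw [h3] at h
    norm_num at h
  · have : (15 : ℂ) = 0 := by linear_combination 8 * h - (4 * y ^ 2 + 1) * h3
    norm_num at this

/-- The derivative is `2 x (2 b x² - d)`. Substituting `d = 2 b x²` into the equation gives `b (x⁴ -
1) = 0`, and `b = d = 0` is impossible. -/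
theorem eq_of_gPlus_of_gPlusX {x y : ℂ} (hg : gPlus x y = 0) (hx : gPlusX x y = 0) :
    leadB y = 0 ∧ x = 0 ∨ x ^ 2 = 1 ∧ midD y = 2 * leadB y ∨ x ^ 2 = -1 ∧ midD y = -(2 * leadB y) := by
  rw [gPlus_eq_leadB_midD] at hg
  simp only [gPlusX] at hx
  have h1 : x * (2 * leadB y * x ^ 2 - midD y) = 0 := by linear_combination hx / 2
  rcases mul_eq_zero.mp h1 with h | h
  · left
    refine ⟨?_, h⟩
    rw [h] at hg
    simpa using hg
  · have h2 : leadB y * ((x ^ 2 - 1) * (x ^ 2 + 1)) = 0 := by linear_combination -hg + x ^ 2 * h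
    rcases mul_eq_zero.mp h2 with h3 | h3
    · exfalso
      rw [h3] at h
      simp only [leadB, midD] at h3 h
      have h4 : y ^ 2 * 49 = 0 := by linear_combination h3 + 2 * h
      have h5 : y = 0 := by simpa using h4
      rw [h5] at h3
      norm_num at h3
    · right
      rcases mul_eq_zero.mp h3 with h4 | h4
      · left
        exact ⟨by linear_combination h4, by linear_combination -h + 2 * leadB y * h4⟩
      · right
        exact ⟨by linear_combination h4, by linear_combination -h + 2 * leadB y * h4⟩

/-- The projection to `y` is unramified over the zeros of `A`. This gives four points over each of
them, and makes the double cover smooth and irreducible. -/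
theorem gPlusX_ne_zero_of_coeffA {x y : ℂ} (hA : coeffA y = 0) (hg : gPlus x y = 0) :
    gPlusX x y ≠ 0 := by
  intro hx
  have hy : y ≠ 0 := by
    rintro rfl
    norm_num [coeffA] at hA
  rcases eq_of_gPlus_of_gPlusX hg hx with ⟨h, -⟩ | ⟨-, h⟩ | ⟨-, h⟩
  · exact leadB_ne_zero_of_coeffA hA h
  · simp only [leadB, midD, coeffA] at h hA
    -- With `A = (y⁴ + 1)² + 12 y⁴` and `d - 2 b = -(3 (y⁴ + 1) + 26 y²)`, the difference of squares
    -- eliminates `y⁴ + 1` and leaves `(9 · 12 + 26²) y⁴`. In the other case it leaves `(25 · 12 +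
    -- 22²) y⁴`, again `784 y⁴`.
    have : y ^ 4 * 784 = 0 := by
      linear_combination 9 * hA + (3 * (y ^ 4 + 1) - 26 * y ^ 2) * h
    simp [hy] at this
  · simp only [leadB, midD, coeffA] at h hA
    have : y ^ 4 * 784 = 0 := by
      linear_combination 25 * hA - (5 * (y ^ 4 + 1) + 22 * y ^ 2) * h
    simp [hy] at this

/-- Smoothness of the affine curve: at the ramification points of `y`, the `y`-derivative reduces to
that of `b`, or to `± 4 y (3 y² + 13)` or `± 4 y (5 y² - 11)`, none of which vanishes there. -/
theorem gPlusY_ne_zero_of_gPlusX {x y : ℂ} (hg : gPlus x y = 0) (hx : gPlusX x y = 0) :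
    gPlusY x y ≠ 0 := by
  intro h
  simp only [gPlusY] at h
  rcases eq_of_gPlus_of_gPlusX hg hx with ⟨h1, h2⟩ | ⟨h1, h2⟩ | ⟨h1, h2⟩
  · rw [h2] at h
    exact leadB_deriv_ne_zero h1 (by linear_combination h)
  · simp only [leadB, midD] at h2
    have h3 : x ^ 4 = 1 := by linear_combination (x ^ 2 + 1) * h1
    rw [h1, h3] at h
    have h4 : y * (3 * y ^ 2 + 13) = 0 := by linear_combination h / 4
    rcases mul_eq_zero.mp h4 with h5 | h5
    · rw [h5] at h2
      norm_num at h2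
    · have : (160 : ℂ) = 0 := by linear_combination 3 * h2 + (3 * y ^ 2 + 13) * h5
      norm_num at this
  · simp only [leadB, midD] at h2
    have h3 : x ^ 4 = 1 := by linear_combination (x ^ 2 - 1) * h1
    rw [h1, h3] at h
    have h4 : y * (5 * y ^ 2 - 11) = 0 := by linear_combination h / 4
    rcases mul_eq_zero.mp h4 with h5 | h5
    · rw [h5] at h2
      norm_num at h2
    · have : (96 : ℂ) = 0 := by linear_combination -5 * h2 + (5 * y ^ 2 - 11) * h5
      norm_num at this

theorem coeffA'_ne_zero {y : ℂ} (hA : coeffA y = 0) : coeffA' y ≠ 0 := by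
  intro h
  simp only [coeffA, coeffA'] at hA h
  have h1 : y ^ 3 * (y ^ 4 + 7) = 0 := by linear_combination h / 8
  rcases mul_eq_zero.mp h1 with h2 | h2
  · have h3 : y = 0 := by simpa using h2
    rw [h3] at hA
    norm_num at hA
  · have : (48 : ℂ) = 0 := by linear_combination -hA + (y ^ 4 + 7) * h2
    norm_num at this

theorem exists_coeffA_eq_zero : ∃ y : ℂ, coeffA y = 0 := by
  obtain ⟨r, hr⟩ := IsAlgClosed.exists_root
    (Polynomial.X ^ 8 + 14 * Polynomial.X ^ 4 + 1 : Polynomial ℂ) (by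
      have : (Polynomial.X ^ 8 + 14 * Polynomial.X ^ 4 + 1 : Polynomial ℂ).degree = 8 := by
        compute_degree!
      rw [this]; decide)
  exact ⟨r, by simpa [Polynomial.IsRoot, coeffA] using hr⟩

theorem exists_gPlus_eq_zero {L : Type} [Field L] [IsAlgClosed L] {y : L} (hy : leadB y ≠ 0) :
    ∃ x : L, gPlus x y = 0 := by
  obtain ⟨r, hr⟩ := IsAlgClosed.exists_root
    (Polynomial.C (leadB y) * Polynomial.X ^ 4 - Polynomial.C (midD y) * Polynomial.X ^ 2
      + Polynomial.C (leadB y) : Polynomial L) (by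
      have : (Polynomial.C (leadB y) * Polynomial.X ^ 4 - Polynomial.C (midD y) * Polynomial.X ^ 2
          + Polynomial.C (leadB y) : Polynomial L).degree = 4 := by
        compute_degree!
      rw [this]; decide)
  exact ⟨r, by simpa [Polynomial.IsRoot, gPlus_eq_leadB_midD] using hr⟩

/-! ### Partial derivatives of the equations -/

theorem derivation_map_ofNat {A : Type} [CommRing A] [Algebra ℂ A] (D : Derivation ℂ A A) (n : ℕ)
    [n.AtLeastTwo] : D (no_index (OfNat.ofNat n)) = 0 :=
  D.map_natCast n

theorem pderiv_zero_gPlus {n : ℕ} {i j : Fin n} (hij : i ≠ j) :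
    pderiv i (gPlus (X i) (X j) : MvPolynomial (Fin n) ℂ) = gPlusX (X i) (X j) := by
  simp only [gPlus, gPlusX, leadB, midD, map_add, map_sub, Derivation.leibniz,
    Derivation.leibniz_pow, pderiv_X_self, pderiv_X_of_ne hij.symm, derivation_map_ofNat,
    Derivation.map_one_eq_zero, smul_eq_mul, nsmul_eq_mul, smul_zero, mul_zero, add_zero]
  push_cast
  ring

theorem pderiv_one_gPlus {n : ℕ} {i j : Fin n} (hij : i ≠ j) :
    pderiv j (gPlus (X i) (X j) : MvPolynomial (Fin n) ℂ) = gPlusY (X i) (X j) := by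
  simp only [gPlus, gPlusY, map_add, map_sub, Derivation.leibniz,
    Derivation.leibniz_pow, pderiv_X_self, pderiv_X_of_ne hij, derivation_map_ofNat,
    Derivation.map_one_eq_zero, smul_eq_mul, nsmul_eq_mul, smul_zero, mul_zero, add_zero]
  push_cast
  ring

theorem pderiv_other_gPlus {n : ℕ} {i j k : Fin n} (hik : k ≠ i) (hjk : k ≠ j) :
    pderiv k (gPlus (X i) (X j) : MvPolynomial (Fin n) ℂ) = 0 := by
  simp [gPlus, Derivation.leibniz, Derivation.leibniz_pow, pderiv_X_of_ne hik.symm,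
    pderiv_X_of_ne hjk.symm, derivation_map_ofNat]

theorem map_gPlus {R R' : Type} [CommRing R] [CommRing R'] (φ : R →+* R') (x y : R) :
    φ (gPlus x y) = gPlus (φ x) (φ y) := by
  simp [gPlus, map_ofNat]

theorem map_gPlusX {R R' : Type} [CommRing R] [CommRing R'] (φ : R →+* R') (x y : R) :
    φ (gPlusX x y) = gPlusX (φ x) (φ y) := by
  simp [gPlusX, leadB, midD, map_ofNat]

theorem map_gPlusY {R R' : Type} [CommRing R] [CommRing R'] (φ : R →+* R') (x y : R) :
    φ (gPlusY x y) = gPlusY (φ x) (φ y) := by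
  simp [gPlusY, map_ofNat]

theorem map_coeffA {R R' : Type} [CommRing R] [CommRing R'] (φ : R →+* R') (y : R) :
    φ (coeffA y) = coeffA (φ y) := by
  simp [coeffA, map_ofNat]

theorem map_coeffA' {R R' : Type} [CommRing R] [CommRing R'] (φ : R →+* R') (y : R) :
    φ (coeffA' y) = coeffA' (φ y) := by
  simp [coeffA', map_ofNat]

section Chart

variable {K : Type} [Field K] [Algebra ℂ K] {x y : K}

theorem derivation_gPlus (D : Derivation ℂ K K) (x y : K) :
    D (gPlus x y) = gPlusX x y * D x + gPlusY x y * D y := by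
  simp only [gPlus, gPlusX, gPlusY, leadB, midD, map_add, map_sub, Derivation.leibniz,
    Derivation.leibniz_pow, derivation_map_ofNat,
    Derivation.map_one_eq_zero, smul_eq_mul, nsmul_eq_mul, smul_zero, mul_zero, add_zero]
  push_cast
  ring

theorem derivation_coeffA (D : Derivation ℂ K K) (y : K) :
    D (coeffA y) = coeffA' y * D y := by
  simp only [coeffA, coeffA', map_add, Derivation.leibniz,
    Derivation.leibniz_pow, derivation_map_ofNat,
    Derivation.map_one_eq_zero, smul_eq_mul, nsmul_eq_mul, smul_zero, mul_zero, add_zero]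
  push_cast
  ring

/-- On the curve `∂g₊/∂x = 4 (b x³ - d x) + 2 d x`, a nontrivial combination of the independent
functions. -/
theorem gPlusX_ne_zero (hg : gPlus x y = 0) (hy : Transcendental ℂ y) : gPlusX x y ≠ 0 := by
  intro h
  have h1 : combination x y (0, 2 * midD Polynomial.X, 0, 4) = combination x y 0 := by
    rw [map_zero, ← h]
    simp only [combination, cubicSection, gPlusX, LinearMap.coe_mk, AddHom.coe_mk, map_mul,
      aeval_midD, map_ofNat, map_zero]
    ring
  have h2 := congrArg (fun c => c.2.2.2) (combination_injective hg hy h1)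
  simp at h2

/-- `D` is the Hamiltonian vector field of `g₊`: it annihilates `g₊`, and its components are the
partial derivatives, which do not vanish simultaneously. The local parameter is `y` where `∂g₊/∂x ≠
0`, and `x` elsewhere. -/
theorem smoothChart_curveRing (hfrac : ∀ z : K, ∃ p q : MvPolynomial (Fin 2) ℂ,
    z = aeval ![x, y] p / aeval ![x, y] q) (hg : gPlus x y = 0) (D : Derivation ℂ K K)
    (hx : D x = gPlusY x y) (hy : D y = -gPlusX x y) : SmoothChart D (curveRing x y) := by
  have haev : ∀ i, aeval ![x, y] (X i : MvPolynomial (Fin 2) ℂ) = ![x, y] i := fun i => aeval_X _ i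
  refine SmoothChart.of_generators ![x, y] D hfrac ![gPlusY (X 0) (X 1), -gPlusX (X 0) (X 1)]
    ?_ ?_
  · intro i
    fin_cases i
    · have := map_gPlusY (aeval ![x, y] : MvPolynomial (Fin 2) ℂ →ₐ[ℂ] K).toRingHom (X 0) (X 1)
      simp only [AlgHom.toRingHom_eq_coe, RingHom.coe_coe, haev] at this
      simpa [hx] using this.symm
    · have := map_gPlusX (aeval ![x, y] : MvPolynomial (Fin 2) ℂ →ₐ[ℂ] K).toRingHom (X 0) (X 1)
      simp only [AlgHom.toRingHom_eq_coe, RingHom.coe_coe, haev] at this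
      simpa [hy] using this.symm
  · intro a ha
    have hG : aeval ![x, y] (gPlus (X 0) (X 1) : MvPolynomial (Fin 2) ℂ) = 0 := by
      have := map_gPlus (aeval ![x, y] : MvPolynomial (Fin 2) ℂ →ₐ[ℂ] K).toRingHom (X 0) (X 1)
      simp only [AlgHom.toRingHom_eq_coe, RingHom.coe_coe, haev] at this
      rw [this]
      simpa using hg
    have hga : gPlus (a 0) (a 1) = 0 := by
      have := ha _ hG
      rwa [map_gPlus, eval_X, eval_X] at this
    have hX : eval a (gPlusX (X 0) (X 1)) = gPlusX (a 0) (a 1) := by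
      rw [map_gPlusX, eval_X, eval_X]
    have hY : eval a (gPlusY (X 0) (X 1)) = gPlusY (a 0) (a 1) := by
      rw [map_gPlusY, eval_X, eval_X]
    have h01 : (0 : Fin 2) ≠ 1 := by decide
    by_cases h : gPlusX (a 0) (a 1) = 0
    · have h' := gPlusY_ne_zero_of_gPlusX hga h
      refine ⟨⟨0, by simpa [hY] using h'⟩, 0, fun i => ?_⟩
      fin_cases i
      · exact ⟨0, map_zero _, 1, fun k => by simp⟩
      · refine ⟨C (gPlusY (a 0) (a 1))⁻¹ * gPlus (X 0) (X 1), by rw [map_mul, hG, mul_zero], 0,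
          fun k => ?_⟩
        fin_cases k
        · simp [pderiv_zero_gPlus h01, hX, h]
        · simp [pderiv_one_gPlus h01, hY, h']
    · refine ⟨⟨1, by simpa [hX] using h⟩, 1, fun i => ?_⟩
      fin_cases i
      · refine ⟨C (gPlusX (a 0) (a 1))⁻¹ * gPlus (X 0) (X 1), by rw [map_mul, hG, mul_zero],
          -((gPlusX (a 0) (a 1))⁻¹ * gPlusY (a 0) (a 1)), fun k => ?_⟩
        fin_cases k
        · simp [pderiv_zero_gPlus h01, hX, h]
        · simp [pderiv_one_gPlus h01, hY]
      · exact ⟨0, map_zero _, 1, fun k => by simp⟩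

/-- The algebra of polynomials in `x`, `y` and `w`. -/
def coverRing (x y w : K) : Subalgebra ℂ K :=
  (aeval ![x, y, w] : MvPolynomial (Fin 3) ℂ →ₐ[ℂ] K).range

/-- `D` is the cross product of the gradients of `g₊` and `w² - A`. It is tangent to the curve, and
smoothness says that it vanishes nowhere. -/
theorem smoothChart_coverRing {w : K} (hfrac : ∀ z : K, ∃ p q : MvPolynomial (Fin 3) ℂ,
    z = aeval ![x, y, w] p / aeval ![x, y, w] q) (hg : gPlus x y = 0) (hw : w ^ 2 = coeffA y)
    (D : Derivation ℂ K K) (hDx : D x = 2 * w * gPlusY x y) (hDy : D y = -(2 * w * gPlusX x y))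
    (hDw : D w = -(coeffA' y * gPlusX x y)) : SmoothChart D (coverRing x y w) := by
  have haev : ∀ i, aeval ![x, y, w] (X i : MvPolynomial (Fin 3) ℂ) = ![x, y, w] i :=
    fun i => aeval_X _ i
  have e1 := map_gPlusY (aeval ![x, y, w] : MvPolynomial (Fin 3) ℂ →ₐ[ℂ] K).toRingHom (X 0) (X 1)
  have e2 := map_gPlusX (aeval ![x, y, w] : MvPolynomial (Fin 3) ℂ →ₐ[ℂ] K).toRingHom (X 0) (X 1)
  have e3 := map_gPlus (aeval ![x, y, w] : MvPolynomial (Fin 3) ℂ →ₐ[ℂ] K).toRingHom (X 0) (X 1)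
  have e4 := map_coeffA (aeval ![x, y, w] : MvPolynomial (Fin 3) ℂ →ₐ[ℂ] K).toRingHom (X 1)
  have e5 := map_coeffA' (aeval ![x, y, w] : MvPolynomial (Fin 3) ℂ →ₐ[ℂ] K).toRingHom (X 1)
  simp only [AlgHom.toRingHom_eq_coe, RingHom.coe_coe, haev] at e1 e2 e3 e4 e5
  refine SmoothChart.of_generators ![x, y, w] D hfrac
    ![2 * X 2 * gPlusY (X 0) (X 1), -(2 * X 2 * gPlusX (X 0) (X 1)),
      -(coeffA' (X 1) * gPlusX (X 0) (X 1))] ?_ ?_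
  · intro i
    fin_cases i
    · simp [hDx, e1, map_ofNat]
    · simp [hDy, e2, map_ofNat]
    · simp [hDw, e2, e5]
  · intro a ha
    have hG : aeval ![x, y, w] (gPlus (X 0) (X 1) : MvPolynomial (Fin 3) ℂ) = 0 := by
      rw [e3]
      simpa using hg
    have hW : aeval ![x, y, w] (X 2 ^ 2 - coeffA (X 1) : MvPolynomial (Fin 3) ℂ) = 0 := by
      rw [map_sub, map_pow, e4, haev]
      simpa using sub_eq_zero.mpr hw
    have hga : gPlus (a 0) (a 1) = 0 := by
      have := ha _ hG
      rwa [map_gPlus, eval_X, eval_X] at this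
    have hwa : a 2 ^ 2 = coeffA (a 1) := by
      have := ha _ hW
      rw [map_sub, map_pow, map_coeffA, eval_X, eval_X] at this
      exact sub_eq_zero.mp this
    have hX : eval a (gPlusX (X 0) (X 1)) = gPlusX (a 0) (a 1) := by
      rw [map_gPlusX, eval_X, eval_X]
    have hY : eval a (gPlusY (X 0) (X 1)) = gPlusY (a 0) (a 1) := by
      rw [map_gPlusY, eval_X, eval_X]
    have hA : eval a (coeffA' (X 1)) = coeffA' (a 1) := by
      rw [map_coeffA', eval_X]
    have h01 : (0 : Fin 3) ≠ 1 := by decide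
    have h20 : (2 : Fin 3) ≠ 0 := by decide
    have h21 : (2 : Fin 3) ≠ 1 := by decide
    have dG0 := pderiv_zero_gPlus h01
    have dG1 := pderiv_one_gPlus h01
    have dG2 := pderiv_other_gPlus h20 h21
    have dA0 : pderiv 0 (coeffA (X 1) : MvPolynomial (Fin 3) ℂ) = 0 := by
      simp [coeffA, Derivation.leibniz, Derivation.leibniz_pow, pderiv_X_of_ne h01.symm,
        derivation_map_ofNat]
    have dA2 : pderiv 2 (coeffA (X 1) : MvPolynomial (Fin 3) ℂ) = 0 := by
      simp [coeffA, Derivation.leibniz, Derivation.leibniz_pow, pderiv_X_of_ne h21.symm,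
        derivation_map_ofNat]
    have dA1 : pderiv 1 (coeffA (X 1) : MvPolynomial (Fin 3) ℂ) = coeffA' (X 1) := by
      simp only [coeffA, coeffA', map_add, Derivation.leibniz, Derivation.leibniz_pow,
        pderiv_X_self, derivation_map_ofNat, Derivation.map_one_eq_zero, smul_eq_mul, nsmul_eq_mul,
        mul_zero, add_zero, smul_zero]
      push_cast
      ring
    -- The local parameter is `w` at the branch points, `x` where `w ≠ 0` and `∂g₊/∂x = 0`, and `y`
    -- otherwise.
    by_cases hc : a 2 = 0
    · have hA0 : coeffA (a 1) = 0 := by rw [← hwa, hc]; norm_num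
      have h1 := coeffA'_ne_zero hA0
      have h2 := gPlusX_ne_zero_of_coeffA hA0 hga
      refine ⟨⟨2, by simp [hA, hX, h1, h2]⟩, 2, fun i => ?_⟩
      -- Since `w = 0` here, the gradient of `w² - A` is `(0, -A', 0)`; after scaling, this relation
      -- shows that `y` is constant to first order. It is then used to remove the `y`-part of the
      -- gradient of `g₊`.
      have hq1 : ∀ k, eval a (pderiv k (C (-(coeffA' (a 1))⁻¹) * (X 2 ^ 2 - coeffA (X 1)))) =
          if k = 1 then 1 else 0 := by
        intro k
        fin_cases k
        · simp [dA0, pderiv_X_of_ne h20, Derivation.leibniz_pow]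
        · simp [dA1, pderiv_X_of_ne h21, Derivation.leibniz_pow, hA, h1]
        · simp [dA2, hc, Derivation.leibniz_pow]
      fin_cases i
      · refine ⟨C (gPlusX (a 0) (a 1))⁻¹ * (gPlus (X 0) (X 1) - C (gPlusY (a 0) (a 1)) *
            (C (-(coeffA' (a 1))⁻¹) * (X 2 ^ 2 - coeffA (X 1)))), ?_, 0, fun k => ?_⟩
        · rw [map_mul, map_sub, map_mul, map_mul, hG, hW]
          simp
        · rw [pderiv_C_mul, map_sub, pderiv_C_mul, map_mul, eval_C, map_sub, map_mul, eval_C,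
            hq1]
          fin_cases k
          · simp [dG0, hX, h2]
          · simp [dG1, hY]
          · simp [dG2]
      · refine ⟨_, ?_, 0, fun k => by rw [hq1]; simp⟩
        rw [map_mul, hW, mul_zero]
      · exact ⟨0, map_zero _, 1, fun k => by simp⟩
    · by_cases h : gPlusX (a 0) (a 1) = 0
      · have h' := gPlusY_ne_zero_of_gPlusX hga h
        refine ⟨⟨0, by simp [hY, h', hc]⟩, 0, fun i => ?_⟩
        have hq1 : ∀ k, eval a (pderiv k (C (gPlusY (a 0) (a 1))⁻¹ * gPlus (X 0) (X 1))) =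
            if k = 1 then 1 else 0 := by
          intro k
          fin_cases k
          · simp [dG0, hX, h]
          · simp [dG1, hY, h']
          · simp [dG2]
        fin_cases i
        · exact ⟨0, map_zero _, 1, fun k => by simp⟩
        · refine ⟨_, ?_, 0, fun k => by rw [hq1]; simp⟩
          rw [map_mul, hG, mul_zero]
        · refine ⟨C (2 * a 2)⁻¹ * ((X 2 ^ 2 - coeffA (X 1)) + C (coeffA' (a 1)) *
            (C (gPlusY (a 0) (a 1))⁻¹ * gPlus (X 0) (X 1))), ?_, 0, fun k => ?_⟩
          · rw [map_mul, map_add, map_mul, map_mul, hG, hW]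
            simp
          · rw [pderiv_C_mul, map_add, pderiv_C_mul, map_mul, eval_C, map_add, map_mul, eval_C,
              hq1]
            fin_cases k
            · simp [dA0, pderiv_X_of_ne h20, Derivation.leibniz_pow]
            · simp [dA1, pderiv_X_of_ne h21, Derivation.leibniz_pow, hA]
            · simp [dA2, Derivation.leibniz_pow]
              field_simp
      · refine ⟨⟨1, by simp [hX, h, hc]⟩, 1, fun i => ?_⟩
        fin_cases i
        · refine ⟨C (gPlusX (a 0) (a 1))⁻¹ * gPlus (X 0) (X 1), by rw [map_mul, hG, mul_zero],
            -((gPlusX (a 0) (a 1))⁻¹ * gPlusY (a 0) (a 1)), fun k => ?_⟩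
          fin_cases k
          · simp [dG0, hX, h]
          · simp [dG1, hY]
          · simp [dG2]
        · exact ⟨0, map_zero _, 1, fun k => by simp⟩
        · refine ⟨C (2 * a 2)⁻¹ * (X 2 ^ 2 - coeffA (X 1)), by rw [map_mul, hW, mul_zero],
            (2 * a 2)⁻¹ * coeffA' (a 1), fun k => ?_⟩
          fin_cases k
          · simp [dA0, pderiv_X_of_ne h20, Derivation.leibniz_pow]
          · simp [dA1, pderiv_X_of_ne h21, Derivation.leibniz_pow, hA]
          · simp [dA2, Derivation.leibniz_pow]
            field_simp

end Chart

/-! ## The genus of the curves -/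

section Genus

variable {K : Type} [Field K] [Algebra ℂ K]

theorem range_aeval_le_valuationSubring {n : ℕ} (c : Fin n → K) (V : ValuationSubring K)
    (hV : ∀ z : ℂ, algebraMap ℂ K z ∈ V) (hc : ∀ i, c i ∈ V) :
    ∀ r ∈ (aeval c : MvPolynomial (Fin n) ℂ →ₐ[ℂ] K).range, r ∈ V := by
  rintro _ ⟨p, rfl⟩
  change aeval c p ∈ V
  induction p using MvPolynomial.induction_on with
  | C z => rw [algHom_C]; exact hV z
  | add p q hp hq => rw [map_add]; exact V.add_mem _ _ hp hq
  | mul_X p i hp => rw [map_mul, aeval_X]; exact V.mul_mem _ _ hp (hc i)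

theorem exists_fraction_of_adjoin_eq_top {n : ℕ} {c : Fin n → K}
    (htop : IntermediateField.adjoin ℂ (Set.range c) = ⊤) (z : K) :
    ∃ p q : MvPolynomial (Fin n) ℂ, z = aeval c p / aeval c q := by
  rw [← IntermediateField.mem_adjoin_range_iff, htop]
  trivial

theorem adjoin_eq_top_of_mem {n m : ℕ} {c : Fin n → K} {c' : Fin m → K}
    (htop : IntermediateField.adjoin ℂ (Set.range c) = ⊤)
    (h : ∀ i, c i ∈ IntermediateField.adjoin ℂ (Set.range c')) :
    IntermediateField.adjoin ℂ (Set.range c') = ⊤ := by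
  rw [eq_top_iff, ← htop, IntermediateField.adjoin_le_iff]
  rintro _ ⟨i, rfl⟩
  exact h i

theorem mem_adjoin_range {n : ℕ} (c : Fin n → K) (i : Fin n) :
    c i ∈ IntermediateField.adjoin ℂ (Set.range c) :=
  IntermediateField.subset_adjoin ℂ _ ⟨i, rfl⟩

variable {x y w : K}

theorem map_leadB {R R' : Type} [CommRing R] [CommRing R'] (φ : R →+* R') (y : R) :
    φ (leadB y) = leadB (φ y) := by
  simp [leadB, map_ofNat]

theorem map_midD {R R' : Type} [CommRing R] [CommRing R'] (φ : R →+* R') (y : R) :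
    φ (midD y) = midD (φ y) := by
  simp [midD, map_ofNat]

theorem isAlgebraic_left (hg : gPlus x y = 0) (hy : Transcendental ℂ y) :
    IsAlgebraic (IntermediateField.adjoin ℂ {y}) x := by
  let yF : IntermediateField.adjoin ℂ {y} := ⟨y, IntermediateField.mem_adjoin_simple_self ℂ y⟩
  have hb : leadB yF ≠ 0 := by
    intro h
    apply leadB_ne_zero_of_transcendental hy
    rw [← map_zero (algebraMap (IntermediateField.adjoin ℂ {y}) K), ← h, map_leadB]
    rfl
  refine ⟨Polynomial.C (leadB yF) * Polynomial.X ^ 4 - Polynomial.C (midD yF) * Polynomial.X ^ 2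
    + Polynomial.C (leadB yF), ?_, ?_⟩
  · intro h
    have := congrArg (fun P => Polynomial.coeff P 4) h
    simp [Polynomial.coeff_C, Polynomial.coeff_X_pow, hb] at this
  · rw [gPlus_eq_leadB_midD] at hg
    simp only [map_add, map_sub, map_mul, map_pow, Polynomial.aeval_X, Polynomial.aeval_C]
    rw [map_leadB, map_midD]
    exact hg

theorem isAlgebraic_right (y : K) : IsAlgebraic (IntermediateField.adjoin ℂ {y}) y :=
  isAlgebraic_algebraMap (R := IntermediateField.adjoin ℂ {y}) (A := K)
    (⟨y, IntermediateField.mem_adjoin_simple_self ℂ y⟩ : IntermediateField.adjoin ℂ {y})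

/-- Differentiating `g₊ = 0` determines `D x` from `D y`, so on each chart only the value of `D` at
`y` has to be checked. -/
theorem derivation_left_eq (hg : gPlus x y = 0) (hy : Transcendental ℂ y) {D : Derivation ℂ K K}
    {v : K} (hD : D y = -(v * gPlusX x y)) : D x = v * gPlusY x y := by
  have h := derivation_gPlus D x y
  rw [hg, map_zero, hD] at h
  have h1 : gPlusX x y * (D x - v * gPlusY x y) = 0 := by linear_combination -h
  exact sub_eq_zero.mp ((mul_eq_zero.mp h1).resolve_left (gPlusX_ne_zero hg hy))

/-- Differentiate `g₊(1/x, y) = x⁻⁴ g₊(x, y)` and use that `g₊` vanishes on the curve. The factor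
`-x⁻²` is the transition function of the vector field. -/
theorem gPlusX_inv_left (hx : x ≠ 0) (hg : gPlus x y = 0) :
    gPlusX x⁻¹ y = -((x ^ 2)⁻¹ * gPlusX x y) := by
  rw [gPlus_eq_leadB_midD] at hg
  simp only [gPlusX]
  field_simp
  linear_combination 4 * hg

theorem gPlusX_inv_right (hy : y ≠ 0) (x : K) : gPlusX x y⁻¹ = (y ^ 4)⁻¹ * gPlusX x y := by
  simp only [gPlusX, leadB, midD]
  field_simp
  ring

theorem mem_or_inv_mem_pair (V : ValuationSubring K) (x y : K) :
    (x ∈ V ∧ y ∈ V) ∨ (x⁻¹ ∈ V ∧ y ∈ V) ∨ (x ∈ V ∧ y⁻¹ ∈ V) ∨ (x⁻¹ ∈ V ∧ y⁻¹ ∈ V) := by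
  rcases V.mem_or_inv_mem x with h | h <;> rcases V.mem_or_inv_mem y with h' | h' <;> simp [h, h']

theorem smoothChart_of_derivation_right
    (htop : IntermediateField.adjoin ℂ (Set.range ![x, y]) = ⊤) (hg : gPlus x y = 0)
    (hy : Transcendental ℂ y) (D : Derivation ℂ K K) (hD : D y = -gPlusX x y) :
    SmoothChart D (curveRing x y) := by
  refine smoothChart_curveRing (exists_fraction_of_adjoin_eq_top htop) hg D ?_ hD
  have := derivation_left_eq hg hy (D := D) (v := 1) (by rw [hD, one_mul])
  rwa [one_mul] at this

theorem exists_derivation_right (htop : IntermediateField.adjoin ℂ (Set.range ![x, y]) = ⊤)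
    (hg : gPlus x y = 0) (hy : Transcendental ℂ y) :
    ∃ D : Derivation ℂ K K, D y = -gPlusX x y ∧ Function.Bijective D.liftKaehlerDifferential := by
  have : Algebra.IsAlgebraic (IntermediateField.adjoin ℂ {y}) K := by
    refine isAlgebraic_of_generators _ ![x, y] (exists_fraction_of_adjoin_eq_top htop) fun i => ?_
    fin_cases i
    · exact isAlgebraic_left hg hy
    · exact isAlgebraic_right y
  exact exists_derivation_bijective_lift y hy _ (neg_ne_zero.mpr (gPlusX_ne_zero hg hy))

/-- The genus of the function field of the curve `g_+ = 0` is nine. -/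
theorem genus_eq_nine (htop : IntermediateField.adjoin ℂ (Set.range ![x, y]) = ⊤)
    (hg : gPlus x y = 0) (hy : Transcendental ℂ y) : genus K = 9 := by
  have hx0 := x_ne_zero hg hy
  have hy0 := ne_zero_of_transcendental hy
  obtain ⟨D, hDy, hD⟩ := exists_derivation_right htop hg hy
  have hDy' : D y⁻¹ = (y ^ 2)⁻¹ * gPlusX x y := by
    rw [Derivation.leibniz_inv, hDy]
    simp
  have htop' : ∀ x' y' : K, (x' = x ∨ x' = x⁻¹) → (y' = y ∨ y' = y⁻¹) →
      IntermediateField.adjoin ℂ (Set.range ![x', y']) = ⊤ := by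
    intro x' y' hx' hy'
    refine adjoin_eq_top_of_mem htop fun i => ?_
    have h0 := mem_adjoin_range ![x', y'] 0
    have h1 := mem_adjoin_range ![x', y'] 1
    simp only [Matrix.cons_val_zero, Matrix.cons_val_one] at h0 h1
    fin_cases i
    · rcases hx' with rfl | rfl
      · exact h0
      · simpa using inv_mem h0
    · rcases hy' with rfl | rfl
      · exact h1
      · simpa using inv_mem h1
  -- The factors for which `u i • D` is the Hamiltonian field in the coordinates of chart `i`. For
  -- instance `D (1/y) = y⁻² ∂g₊/∂x`, while the field in `(x, 1/y)` requires `-y⁻⁴ ∂g₊/∂x`.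
  let u : Fin 4 → K := ![1, -(x ^ 2)⁻¹, -(y ^ 2)⁻¹, (x ^ 2)⁻¹ * (y ^ 2)⁻¹]
  let R : Fin 4 → Subalgebra ℂ K :=
    ![curveRing x y, curveRing x⁻¹ y, curveRing x y⁻¹, curveRing x⁻¹ y⁻¹]
  have hu : ∀ i, u i ≠ 0 := by
    intro i
    fin_cases i <;> simp [u, hx0, hy0]
  have hR : ∀ i, SmoothChart (u i • D) (R i) := by
    intro i
    fin_cases i
    · refine smoothChart_of_derivation_right htop hg hy _ ?_
      simp [u, hDy]
    · refine smoothChart_of_derivation_right (htop' _ _ (Or.inr rfl) (Or.inl rfl))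
        (gPlus_inv_left hg) hy _ ?_
      rw [gPlusX_inv_left hx0 hg]
      simp [u, hDy]
    · refine smoothChart_of_derivation_right (htop' _ _ (Or.inl rfl) (Or.inr rfl))
        (gPlus_inv_right hg) (transcendental_inv hy) _ ?_
      rw [gPlusX_inv_right hy0]
      simp only [u, Derivation.smul_apply, smul_eq_mul, hDy', Fin.reduceFinMk, Matrix.cons_val]
      field_simp
    · refine smoothChart_of_derivation_right (htop' _ _ (Or.inr rfl) (Or.inr rfl))
        (gPlus_inv_left (gPlus_inv_right hg)) (transcendental_inv hy) _ ?_
      rw [gPlusX_inv_left hx0 (gPlus_inv_right hg), gPlusX_inv_right hy0]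
      simp only [u, Derivation.smul_apply, smul_eq_mul, hDy', Fin.reduceFinMk, Matrix.cons_val]
      field_simp
  have hcover : ∀ V : ValuationSubring K, (∀ z : ℂ, algebraMap ℂ K z ∈ V) →
      ∃ i, ∀ r ∈ R i, r ∈ V := by
    intro V hV
    have hle : ∀ x' y' : K, x' ∈ V → y' ∈ V → ∀ r ∈ curveRing x' y', r ∈ V := by
      intro x' y' h1 h2
      refine range_aeval_le_valuationSubring _ V hV fun i => ?_
      fin_cases i
      · exact h1
      · exact h2
    rcases mem_or_inv_mem_pair V x y with ⟨h1, h2⟩ | ⟨h1, h2⟩ | ⟨h1, h2⟩ | ⟨h1, h2⟩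
    exacts [⟨0, hle _ _ h1 h2⟩, ⟨1, hle _ _ h1 h2⟩, ⟨2, hle _ _ h1 h2⟩, ⟨3, hle _ _ h1 h2⟩]
  -- Signs do not affect membership, so the conditions are those of bidegree `(2, 2)`: the canonical
  -- class of a curve of bidegree `(4, 4)`.
  have hsec : sectionsOf u R = boundedPoles x y 2 := by
    ext h
    rw [mem_sectionsOf, mem_boundedPoles, Fin.forall_fin_succ, Fin.forall_fin_succ,
      Fin.forall_fin_succ, Fin.forall_fin_one]
    simp [u, R, and_assoc]
  rw [genus_eq_finrank_sectionsOf D hD u hu R hR hcover, hsec, finrank_boundedPoles hg hy]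

/-! ### The double cover -/

/-- A chart is cut out by valuation rings, and these contain the square roots of their elements. -/
theorem SmoothChart.mem_of_sq_mem {D : Derivation ℂ K K} {R : Subalgebra ℂ K}
    (h : SmoothChart D R) {z : K} (hz : z ^ 2 ∈ R) : z ∈ R := by
  by_contra hn
  obtain ⟨V, hRV, hzV, -⟩ := h.separated z hn
  apply hzV
  rcases V.mem_or_inv_mem z with h1 | h1
  · exact h1
  · by_cases h0 : z = 0
    · rw [h0]
      exact V.zero_mem
    · have h2 := V.mul_mem _ _ (hRV _ hz) h1
      rwa [pow_two, mul_assoc, mul_inv_cancel₀ h0, mul_one] at h2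

/-- A square root of `A` would be regular on the affine curve, so `P² - A = g₊ Q` for polynomials.
At a point of the curve with `A = 0` one gets `P = 0`; the `x`-derivative gives `Q = 0` because
`∂g₊/∂x ≠ 0`, and the `y`-derivative then gives `A' = 0`, contradicting the simplicity of the zeros
of `A`. -/
theorem not_sq_eq_coeffA_of_adjoin_eq_top
    (htop : IntermediateField.adjoin ℂ (Set.range ![x, y]) = ⊤) (hg : gPlus x y = 0)
    (hy : Transcendental ℂ y) (z : K) : z ^ 2 ≠ coeffA y := by
  intro hz
  obtain ⟨D, hDy, -⟩ := exists_derivation_right htop hg hy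
  have hA : coeffA y = biEval x y (Polynomial.C (coeffA Polynomial.X)) := by
    rw [biEval_C]
    simp [coeffA, map_ofNat]
  have hmem : z ∈ curveRing x y := by
    refine (smoothChart_of_derivation_right htop hg hy D hDy).mem_of_sq_mem ?_
    rw [hz]
    exact mem_curveRing.mpr ⟨_, hA.symm⟩
  obtain ⟨p, rfl⟩ := mem_curveRing.mp hmem
  obtain ⟨r, hr⟩ : gBiv ∣ p ^ 2 - Polynomial.C (coeffA Polynomial.X) := by
    refine gBiv_dvd_of_biEval_eq_zero hg hy ?_
    rw [map_sub, map_pow, hz, ← hA, sub_self]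
  have h1 := congrArg (biEval (X 0 : MvPolynomial (Fin 2) ℂ) (X 1)) hr
  rw [map_sub, map_pow, map_mul, biEval_gBiv, biEval_C] at h1
  have hA' : Polynomial.aeval (X 1 : MvPolynomial (Fin 2) ℂ) (coeffA Polynomial.X : Polynomial ℂ) =
      coeffA (X 1) := by
    simp [coeffA, map_ofNat]
  rw [hA'] at h1
  set P := biEval (X 0 : MvPolynomial (Fin 2) ℂ) (X 1) p
  set Q := biEval (X 0 : MvPolynomial (Fin 2) ℂ) (X 1) r
  obtain ⟨b, hb⟩ := exists_coeffA_eq_zero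
  obtain ⟨a, ha⟩ := exists_gPlus_eq_zero (leadB_ne_zero_of_coeffA hb)
  have h01 : (0 : Fin 2) ≠ 1 := by decide
  have e0 := congrArg (eval ![a, b]) h1
  have e1 := congrArg (fun q => eval ![a, b] (pderiv 0 q)) h1
  have e2 := congrArg (fun q => eval ![a, b] (pderiv 1 q)) h1
  have dA0 : pderiv 0 (coeffA (X 1) : MvPolynomial (Fin 2) ℂ) = 0 := by
    simp [coeffA, Derivation.leibniz, Derivation.leibniz_pow, pderiv_X_of_ne h01.symm,
      derivation_map_ofNat]
  have dA1 : pderiv 1 (coeffA (X 1) : MvPolynomial (Fin 2) ℂ) = coeffA' (X 1) := by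
    simp only [coeffA, coeffA', map_add, Derivation.leibniz, Derivation.leibniz_pow,
      pderiv_X_self, derivation_map_ofNat, Derivation.map_one_eq_zero, smul_eq_mul, nsmul_eq_mul,
      mul_zero, add_zero]
    push_cast
    ring
  simp only [map_sub, map_mul, map_add, map_pow, Derivation.leibniz, Derivation.leibniz_pow,
    pderiv_zero_gPlus h01, pderiv_one_gPlus h01, dA0, dA1, map_gPlus, map_gPlusX, map_gPlusY,
    map_coeffA, map_coeffA', eval_X, Matrix.cons_val_zero, Matrix.cons_val_one, ha, hb, smul_eq_mul,
    sub_zero, zero_mul, map_zero, zero_add, nsmul_eq_mul] at e0 e1 e2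
  have hP : eval ![a, b] P = 0 := by simpa using e0
  have hQ : eval ![a, b] Q = 0 := by
    rw [hP] at e1
    have := gPlusX_ne_zero_of_coeffA hb ha
    simpa [this] using e1
  rw [hP, hQ] at e2
  have := coeffA'_ne_zero hb
  simp [this] at e2

/-- The previous argument applied to the subfield `ℂ(x, y)` of `K`. It makes `1, w` linearly
independent over `ℂ(x, y)`. -/
theorem sqrt_notMem_adjoin (hg : gPlus x y = 0) (hy : Transcendental ℂ y)
    (hw : w ^ 2 = coeffA y) : w ∉ IntermediateField.adjoin ℂ (Set.range ![x, y]) := by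
  intro hmem
  set F := IntermediateField.adjoin ℂ (Set.range ![x, y]) with hF
  let x' : F := ⟨x, mem_adjoin_range ![x, y] 0⟩
  let y' : F := ⟨y, mem_adjoin_range ![x, y] 1⟩
  let w' : F := ⟨w, hmem⟩
  have hmap := map_gPlus (algebraMap F K) x' y'
  have hinj : Function.Injective (algebraMap F K) := (algebraMap F K).injective
  have htop : IntermediateField.adjoin ℂ (Set.range ![x', y']) = ⊤ := by
    have h1 : Set.range ![x', y'] = (Subtype.val : F → K) ⁻¹' Set.range ![x, y] := by
      ext z
      simp only [Matrix.range_cons, Matrix.range_empty, Set.union_empty, Set.mem_preimage,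
        Set.mem_union, Set.mem_singleton_iff, Subtype.ext_iff, x', y']
    rw [h1]
    apply IntermediateField.map_injective F.val
    rw [IntermediateField.adjoin_map, ← AlgHom.fieldRange_eq_map, IntermediateField.fieldRange_val]
    have h2 : F.val '' ((Subtype.val : F → K) ⁻¹' Set.range ![x, y]) = Set.range ![x, y] := by
      refine Set.image_preimage_eq_of_subset ?_
      rintro _ ⟨i, rfl⟩
      exact ⟨⟨_, mem_adjoin_range ![x, y] i⟩, rfl⟩
    rw [h2]
  have hg' : gPlus x' y' = 0 := hinj (by rw [hmap, map_zero]; exact hg)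
  have hy' : Transcendental ℂ y' := by
    intro h
    exact hy (h.algebraMap (A := K))
  refine not_sq_eq_coeffA_of_adjoin_eq_top htop hg' hy' w' (hinj ?_)
  rw [map_pow, map_coeffA]
  exact hw

theorem eq_zero_of_add_mul_sqrt_eq_zero (hg : gPlus x y = 0) (hy : Transcendental ℂ y)
    (hw : w ^ 2 = coeffA y) {p q : K} (hp : p ∈ IntermediateField.adjoin ℂ (Set.range ![x, y]))
    (hq : q ∈ IntermediateField.adjoin ℂ (Set.range ![x, y])) (h : p + q * w = 0) :
    p = 0 ∧ q = 0 := by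
  have hq0 : q = 0 := by
    by_contra hne
    apply sqrt_notMem_adjoin hg hy hw
    have : w = -p / q := by
      field_simp
      linear_combination h
    rw [this]
    exact div_mem (neg_mem hp) hq
  exact ⟨by simpa [hq0] using h, hq0⟩

theorem curveRing_le_adjoin {F : IntermediateField ℂ K} (hx : x ∈ F) (hy : y ∈ F) :
    ∀ r ∈ curveRing x y, r ∈ F := by
  rintro _ ⟨p, rfl⟩
  change aeval ![x, y] p ∈ F
  induction p using MvPolynomial.induction_on with
  | C z => rw [algHom_C]; exact F.algebraMap_mem z
  | add p q hp hq => rw [map_add]; exact add_mem hp hq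
  | mul_X p i hp =>
    rw [map_mul, aeval_X]
    refine mul_mem hp ?_
    fin_cases i
    · exact hx
    · exact hy

theorem mem_coverRing (hw : w ^ 2 = coeffA y) {z : K} : z ∈ coverRing x y w ↔
    ∃ p ∈ curveRing x y, ∃ q ∈ curveRing x y, z = p + q * w := by
  have hle : ∀ p ∈ curveRing x y, p ∈ coverRing x y w := by
    rintro _ ⟨p, rfl⟩
    refine ⟨rename ![0, 1] p, ?_⟩
    change aeval ![x, y, w] (rename ![0, 1] p) = aeval ![x, y] p
    rw [aeval_rename]
    congr 2
    funext i
    fin_cases i <;> rfl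
  constructor
  · rintro ⟨p, rfl⟩
    change ∃ p' ∈ curveRing x y, ∃ q ∈ curveRing x y, aeval ![x, y, w] p = p' + q * w
    induction p using MvPolynomial.induction_on with
    | C z => exact ⟨_, (curveRing x y).algebraMap_mem z, 0, zero_mem _, by simp [algHom_C]⟩
    | add p q hp hq =>
      obtain ⟨a, ha, b, hb, h1⟩ := hp
      obtain ⟨c, hc, d, hd, h2⟩ := hq
      exact ⟨a + c, add_mem ha hc, b + d, add_mem hb hd, by rw [map_add, h1, h2]; ring⟩
    | mul_X p i hp =>
      obtain ⟨a, ha, b, hb, h1⟩ := hp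
      rw [map_mul, aeval_X, h1]
      fin_cases i
      · exact ⟨a * x, mul_mem ha (left_mem_curveRing x y), b * x,
          mul_mem hb (left_mem_curveRing x y), by simp; ring⟩
      · exact ⟨a * y, mul_mem ha (right_mem_curveRing x y), b * y,
          mul_mem hb (right_mem_curveRing x y), by simp; ring⟩
      · refine ⟨b * coeffA y, mul_mem hb ?_, a, ha, ?_⟩
        · refine mem_curveRing.mpr ⟨Polynomial.C (coeffA Polynomial.X), ?_⟩
          simp [coeffA, map_ofNat]
        · rw [← hw]
          simp
          ring
  · rintro ⟨p, hp, q, hq, rfl⟩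
    exact add_mem (hle _ hp) (mul_mem (hle _ hq) ⟨X 2, by simp⟩)

theorem coeffA_ne_zero_of_transcendental (hy : Transcendental ℂ y) : coeffA y ≠ 0 := by
  intro h
  have h1 : Polynomial.aeval y (coeffA Polynomial.X : Polynomial ℂ) = 0 := by
    rw [← h]
    simp [coeffA, map_ofNat]
  have h2 := congrArg (Polynomial.eval 0) (transcendental_aeval_eq_zero hy h1)
  simp [coeffA] at h2

theorem smoothChart_cover_of_derivation_right
    (htop : IntermediateField.adjoin ℂ (Set.range ![x, y, w]) = ⊤) (hg : gPlus x y = 0)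
    (hy : Transcendental ℂ y) (hw : w ^ 2 = coeffA y) (D : Derivation ℂ K K)
    (hD : D y = -(2 * w * gPlusX x y)) : SmoothChart D (coverRing x y w) := by
  have hw0 : w ≠ 0 := by
    rintro rfl
    exact coeffA_ne_zero_of_transcendental hy (by rw [← hw]; ring)
  refine smoothChart_coverRing (exists_fraction_of_adjoin_eq_top htop) hg hw D
    (derivation_left_eq hg hy hD) hD ?_
  have h1 := derivation_coeffA D y
  rw [← hw, Derivation.leibniz_pow, hD] at h1
  have : CharZero K := charZero_of_injective_algebraMap (algebraMap ℂ K).injective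
  have h2 : 2 * w * (D w + coeffA' y * gPlusX x y) = 0 := by
    simp only [smul_eq_mul, nsmul_eq_mul, Nat.reduceSub, pow_one, Nat.cast_ofNat] at h1
    linear_combination h1
  exact eq_neg_of_add_eq_zero_left ((mul_eq_zero.mp h2).resolve_left (by simp [hw0]))

theorem exists_derivation_cover (htop : IntermediateField.adjoin ℂ (Set.range ![x, y, w]) = ⊤)
    (hg : gPlus x y = 0) (hy : Transcendental ℂ y) (hw : w ^ 2 = coeffA y) :
    ∃ D : Derivation ℂ K K, D y = -(2 * w * gPlusX x y) ∧
      Function.Bijective D.liftKaehlerDifferential := by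
  have : CharZero K := charZero_of_injective_algebraMap (algebraMap ℂ K).injective
  have : Algebra.IsAlgebraic (IntermediateField.adjoin ℂ {y}) K := by
    refine isAlgebraic_of_generators _ ![x, y, w] (exists_fraction_of_adjoin_eq_top htop)
      fun i => ?_
    fin_cases i
    · exact isAlgebraic_left hg hy
    · exact isAlgebraic_right y
    · refine IsAlgebraic.of_pow (n := 2) (by norm_num) ?_
      have : coeffA y ∈ IntermediateField.adjoin ℂ {y} := by
        have h := IntermediateField.mem_adjoin_simple_self ℂ y
        exact add_mem (add_mem (pow_mem h _) (mul_mem (ofNat_mem _ 14) (pow_mem h _))) (one_mem _)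
      have h2 := isAlgebraic_algebraMap (R := IntermediateField.adjoin ℂ {y}) (A := K)
        (⟨_, this⟩ : IntermediateField.adjoin ℂ {y})
      change IsAlgebraic _ (w ^ 2)
      rw [hw]
      exact h2
  have hw0 : w ≠ 0 := by
    rintro rfl
    exact coeffA_ne_zero_of_transcendental hy (by rw [← hw]; ring)
  refine exists_derivation_bijective_lift y hy _ (neg_ne_zero.mpr ?_)
  exact mul_ne_zero (mul_ne_zero two_ne_zero hw0) (gPlusX_ne_zero hg hy)

theorem coeffA_inv (hy : y ≠ 0) (hw : w ^ 2 = coeffA y) : (w * (y ^ 4)⁻¹) ^ 2 = coeffA y⁻¹ := by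
  rw [mul_pow, hw]
  simp only [coeffA]
  field_simp
  ring

/-- The genus of the function field of the double cover `w ^ 2 = A` is `33`. -/
theorem genus_eq_thirtyThree (htop : IntermediateField.adjoin ℂ (Set.range ![x, y, w]) = ⊤)
    (hg : gPlus x y = 0) (hy : Transcendental ℂ y) (hw : w ^ 2 = coeffA y) : genus K = 33 := by
  have hx0 := x_ne_zero hg hy
  have hy0 := ne_zero_of_transcendental hy
  have hw' := coeffA_inv hy0 hw
  set w' := w * (y ^ 4)⁻¹ with hw'def
  obtain ⟨D, hDy, hD⟩ := exists_derivation_cover htop hg hy hw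
  have hDy' : D y⁻¹ = (y ^ 2)⁻¹ * (2 * w * gPlusX x y) := by
    rw [Derivation.leibniz_inv, hDy]
    simp
  have htop1 : ∀ x' : K, (x' = x ∨ x' = x⁻¹) →
      IntermediateField.adjoin ℂ (Set.range ![x', y, w]) = ⊤ := by
    intro x' hx'
    refine adjoin_eq_top_of_mem htop fun i => ?_
    have h0 := mem_adjoin_range ![x', y, w] 0
    simp only [Matrix.cons_val_zero] at h0
    fin_cases i
    · rcases hx' with rfl | rfl
      · exact h0
      · simpa using inv_mem h0
    · exact mem_adjoin_range ![x', y, w] 1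
    · exact mem_adjoin_range ![x', y, w] 2
  have htop2 : ∀ x' : K, (x' = x ∨ x' = x⁻¹) →
      IntermediateField.adjoin ℂ (Set.range ![x', y⁻¹, w']) = ⊤ := by
    intro x' hx'
    refine adjoin_eq_top_of_mem (htop1 x' hx') fun i => ?_
    have h0 := mem_adjoin_range ![x', y⁻¹, w'] 0
    have h1 := mem_adjoin_range ![x', y⁻¹, w'] 1
    have h2 := mem_adjoin_range ![x', y⁻¹, w'] 2
    simp only [Matrix.cons_val] at h0 h1 h2
    have h3 := inv_mem h1
    rw [inv_inv] at h3
    fin_cases i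
    · exact h0
    · exact h3
    · have h4 := mul_mem h2 (pow_mem h3 4)
      have h5 : w' * y ^ 4 = w := by rw [hw'def]; field_simp
      rw [h5] at h4
      exact h4
  -- The exponent is `6` instead of `2` because `w = y⁴ w'`: `D (1/y) = 2 y⁻² w ∂g₊/∂x`, whereas the
  -- field in the coordinates `(x, 1/y, w')` needs `-2 y⁻⁸ w ∂g₊/∂x`.
  let u : Fin 4 → K := ![1, -(x ^ 2)⁻¹, -(y ^ 6)⁻¹, (x ^ 2)⁻¹ * (y ^ 6)⁻¹]
  let R : Fin 4 → Subalgebra ℂ K :=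
    ![coverRing x y w, coverRing x⁻¹ y w, coverRing x y⁻¹ w', coverRing x⁻¹ y⁻¹ w']
  have hu : ∀ i, u i ≠ 0 := by
    intro i
    fin_cases i <;> simp [u, hx0, hy0]
  have hR : ∀ i, SmoothChart (u i • D) (R i) := by
    intro i
    fin_cases i
    · refine smoothChart_cover_of_derivation_right htop hg hy hw _ ?_
      simp [u, hDy]
    · refine smoothChart_cover_of_derivation_right (htop1 _ (Or.inr rfl))
        (gPlus_inv_left hg) hy hw _ ?_
      rw [gPlusX_inv_left hx0 hg]
      simp only [u, Derivation.smul_apply, smul_eq_mul, hDy, Fin.reduceFinMk, Matrix.cons_val]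
      ring
    · refine smoothChart_cover_of_derivation_right (htop2 _ (Or.inl rfl))
        (gPlus_inv_right hg) (transcendental_inv hy) hw' _ ?_
      rw [gPlusX_inv_right hy0, hw'def]
      simp only [u, Derivation.smul_apply, smul_eq_mul, hDy', Fin.reduceFinMk, Matrix.cons_val]
      field_simp
    · refine smoothChart_cover_of_derivation_right (htop2 _ (Or.inr rfl))
        (gPlus_inv_left (gPlus_inv_right hg)) (transcendental_inv hy) hw' _ ?_
      rw [gPlusX_inv_left hx0 (gPlus_inv_right hg), gPlusX_inv_right hy0, hw'def]
      simp only [u, Derivation.smul_apply, smul_eq_mul, hDy', Fin.reduceFinMk, Matrix.cons_val]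
      field_simp
  have hcover : ∀ V : ValuationSubring K, (∀ z : ℂ, algebraMap ℂ K z ∈ V) →
      ∃ i, ∀ r ∈ R i, r ∈ V := by
    intro V hV
    have hsqrt : ∀ y' w' : K, y' ∈ V → w' ^ 2 = coeffA y' → w' ∈ V := by
      intro y' w' h1 h2
      have hA : coeffA y' ∈ V := V.add_mem _ _ (V.add_mem _ _ (pow_mem h1 _)
        (V.mul_mem _ _ (ofNat_mem V 14) (pow_mem h1 _))) V.one_mem
      rcases V.mem_or_inv_mem w' with h3 | h3
      · exact h3
      · by_cases h0 : w' = 0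
        · rw [h0]
          exact V.zero_mem
        · have h4 := V.mul_mem _ _ hA h3
          rwa [← h2, pow_two, mul_assoc, mul_inv_cancel₀ h0, mul_one] at h4
    have hle : ∀ x' y' w' : K, x' ∈ V → y' ∈ V → w' ^ 2 = coeffA y' →
        ∀ r ∈ coverRing x' y' w', r ∈ V := by
      intro x' y' w' h1 h2 h3
      refine range_aeval_le_valuationSubring _ V hV fun i => ?_
      fin_cases i
      · exact h1
      · exact h2
      · exact hsqrt _ _ h2 h3
    rcases mem_or_inv_mem_pair V x y with ⟨h1, h2⟩ | ⟨h1, h2⟩ | ⟨h1, h2⟩ | ⟨h1, h2⟩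
    exacts [⟨0, hle _ _ _ h1 h2 hw⟩, ⟨1, hle _ _ _ h1 h2 hw⟩, ⟨2, hle _ _ _ h1 h2 hw'⟩,
      ⟨3, hle _ _ _ h1 h2 hw'⟩]
  have hmem : ∀ h : K, h ∈ sectionsOf u R ↔ (h ∈ coverRing x y w ∧
      (x ^ 2)⁻¹ * h ∈ coverRing x⁻¹ y w) ∧ (y ^ 6)⁻¹ * h ∈ coverRing x y⁻¹ w' ∧
      (x ^ 2)⁻¹ * (y ^ 6)⁻¹ * h ∈ coverRing x⁻¹ y⁻¹ w' := by
    intro h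
    rw [mem_sectionsOf, Fin.forall_fin_succ, Fin.forall_fin_succ,
      Fin.forall_fin_succ, Fin.forall_fin_one]
    simp [u, R, and_assoc]
  -- The section `w` itself has a pole of order `4` along `y = ∞`, so only `2` of the allowed `6`
  -- remain for its coefficient.
  have hw6 : ∀ q : K, (y ^ 6)⁻¹ * (q * w) = (y ^ 2)⁻¹ * q * w' := by
    intro q
    rw [hw'def]
    field_simp
  let F := IntermediateField.adjoin ℂ (Set.range ![x, y])
  have hxF : x ∈ F := mem_adjoin_range ![x, y] 0
  have hyF : y ∈ F := mem_adjoin_range ![x, y] 1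
  have hy4 : (y ^ 4)⁻¹ ∈ F := inv_mem (pow_mem hyF 4)
  have huniq : ∀ p q p' q' : K, p ∈ F → q ∈ F → p' ∈ F → q' ∈ F → p + q * w = p' + q' * w →
      p = p' ∧ q = q' := by
    intro p q p' q' hp hq hp' hq' h
    obtain ⟨h1, h2⟩ := eq_zero_of_add_mul_sqrt_eq_zero hg hy hw (sub_mem hp hp') (sub_mem hq hq')
      (by linear_combination h)
    exact ⟨sub_eq_zero.mp h1, sub_eq_zero.mp h2⟩
  let φ : boundedPoles x y 6 × boundedPoles x y 2 →ₗ[ℂ] K :=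
    (Submodule.subtype _).coprod ((LinearMap.mulRight ℂ w) ∘ₗ Submodule.subtype _)
  have hφ : ∀ c, φ c = c.1 + c.2 * w := fun c => rfl
  have hinj : Function.Injective φ := by
    rintro ⟨⟨p, hp⟩, ⟨q, hq⟩⟩ ⟨⟨p', hp'⟩, ⟨q', hq'⟩⟩ h
    have hF : ∀ {m : ℕ} {z : K}, z ∈ boundedPoles x y m → z ∈ F := fun hz =>
      curveRing_le_adjoin hxF hyF _ (mem_boundedPoles.mp hz).1.1
    obtain ⟨h1, h2⟩ := huniq _ _ _ _ (hF hp) (hF hq) (hF hp') (hF hq') h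
    exact Prod.ext (Subtype.ext h1) (Subtype.ext h2)
  -- As `1, w` are independent over `ℂ(x, y)`, the chart conditions can be read off separately on
  -- `p` and `q`.
  have hrange : LinearMap.range φ = sectionsOf u R := by
    ext h
    rw [hmem]
    constructor
    · rintro ⟨⟨⟨p, hp⟩, ⟨q, hq⟩⟩, rfl⟩
      obtain ⟨⟨p1, p2⟩, p3, p4⟩ := mem_boundedPoles.mp hp
      obtain ⟨⟨q1, q2⟩, q3, q4⟩ := mem_boundedPoles.mp hq
      rw [hφ]
      refine ⟨⟨?_, ?_⟩, ?_, ?_⟩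
      · exact (mem_coverRing hw).mpr ⟨_, p1, _, q1, rfl⟩
      · exact (mem_coverRing hw).mpr ⟨_, p2, _, q2, by ring⟩
      · exact (mem_coverRing hw').mpr ⟨_, p3, _, q3, by rw [mul_add, hw6]⟩
      · exact (mem_coverRing hw').mpr ⟨_, p4, _, q4, by rw [mul_add, mul_assoc _ _ (q * w), hw6]; ring⟩
    · rintro ⟨⟨h1, h2⟩, h3, h4⟩
      obtain ⟨p1, hp1, q1, hq1, rfl⟩ := (mem_coverRing hw).mp h1
      obtain ⟨p2, hp2, q2, hq2, e2⟩ := (mem_coverRing hw).mp h2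
      obtain ⟨p3, hp3, q3, hq3, e3⟩ := (mem_coverRing hw').mp h3
      obtain ⟨p4, hp4, q4, hq4, e4⟩ := (mem_coverRing hw').mp h4
      have f1 : ∀ r ∈ curveRing x y, r ∈ F := curveRing_le_adjoin hxF hyF
      have f2 : ∀ r ∈ curveRing x⁻¹ y, r ∈ F := curveRing_le_adjoin (inv_mem hxF) hyF
      have f3 : ∀ r ∈ curveRing x y⁻¹, r ∈ F := curveRing_le_adjoin hxF (inv_mem hyF)
      have f4 : ∀ r ∈ curveRing x⁻¹ y⁻¹, r ∈ F := curveRing_le_adjoin (inv_mem hxF) (inv_mem hyF)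
      have hx2 : (x ^ 2)⁻¹ ∈ F := inv_mem (pow_mem hxF 2)
      have hy6 : (y ^ 6)⁻¹ ∈ F := inv_mem (pow_mem hyF 6)
      obtain ⟨a2, b2⟩ := huniq _ _ _ _ (mul_mem hx2 (f1 _ hp1)) (mul_mem hx2 (f1 _ hq1))
        (f2 _ hp2) (f2 _ hq2) (by rw [← e2]; ring)
      obtain ⟨a3, b3⟩ := huniq _ _ _ _ (mul_mem hy6 (f1 _ hp1)) (mul_mem hy6 (f1 _ hq1))
        (f3 _ hp3) (mul_mem (f3 _ hq3) hy4) (by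
          have : p3 + q3 * (y ^ 4)⁻¹ * w = p3 + q3 * w' := by rw [hw'def]; ring
          rw [this, ← e3]; ring)
      obtain ⟨a4, b4⟩ := huniq _ _ _ _ (mul_mem (mul_mem hx2 hy6) (f1 _ hp1))
        (mul_mem (mul_mem hx2 hy6) (f1 _ hq1)) (f4 _ hp4) (mul_mem (f4 _ hq4) hy4) (by
          have : p4 + q4 * (y ^ 4)⁻¹ * w = p4 + q4 * w' := by rw [hw'def]; ring
          rw [this, ← e4]; ring)
      have b3' : (y ^ 2)⁻¹ * q1 = q3 := by
        field_simp at b3 ⊢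
        linear_combination b3
      have b4' : (x ^ 2)⁻¹ * (y ^ 2)⁻¹ * q1 = q4 := by
        field_simp at b4 ⊢
        linear_combination b4
      refine ⟨(⟨p1, ?_⟩, ⟨q1, ?_⟩), rfl⟩
      · exact mem_boundedPoles.mpr ⟨⟨hp1, a2 ▸ hp2⟩, a3 ▸ hp3, a4 ▸ hp4⟩
      · exact mem_boundedPoles.mpr ⟨⟨hq1, b2 ▸ hq2⟩, b3' ▸ hq3, b4' ▸ hq4⟩
  have := finite_boundedPoles hg hy 6
  have := finite_boundedPoles hg hy 2
  rw [genus_eq_finrank_sectionsOf D hD u hu R hR hcover, ← hrange,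
    LinearMap.finrank_range_of_inj hinj, Module.finrank_prod, finrank_boundedPoles hg hy,
    finrank_boundedPoles hg hy]

end Genus

/-! ## The curves are irreducible -/

section GenericPoint

variable {L : Type} [Field L] [Algebra ℂ L]

/-- The relations of `c` form a prime ideal with zero set `Z`. The field `L` serves only to prove
irreducibility and may be larger than the function field; the genus is computed in the fraction
field, whose generators satisfy exactly the relations that vanish on `Z`. -/
theorem hasGenus_of_genericPoint {n g : ℕ} {Z : Set (Fin n → ℂ)} (c : Fin n → L)
    (hker : ∀ p : MvPolynomial (Fin n) ℂ, aeval c p = 0 → ∀ a ∈ Z, eval a p = 0)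
    (hZ : ∀ a, (∀ p : MvPolynomial (Fin n) ℂ, aeval c p = 0 → eval a p = 0) → a ∈ Z)
    (h : ∀ (K : Type) [Field K] [Algebra ℂ K] (c' : Fin n → K),
      IntermediateField.adjoin ℂ (Set.range c') = ⊤ →
      (∀ p, (∀ a ∈ Z, eval a p = 0) ↔ aeval c' p = 0) → genus K = g) : HasGenus Z g := by
  set I : Ideal (MvPolynomial (Fin n) ℂ) := RingHom.ker (aeval c : _ →ₐ[ℂ] L) with hI
  have hprime : I.IsPrime := RingHom.ker_isPrime _
  have hzero : zeroLocus ℂ I = Z := by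
    ext a
    refine ⟨fun ha => hZ a fun p hp => ha p hp, fun ha p hp => ?_⟩
    exact hker p hp a ha
  -- The strong Nullstellensatz: a prime ideal is the vanishing ideal of its zero set.
  have hvan : (vanishingIdeal ℂ Z).IsPrime := by
    rw [← hzero, MvPolynomial.IsPrime.vanishingIdeal_zeroLocus]
    exact hprime
  have hdom : IsDomain (CoordRing Z) := Ideal.Quotient.isDomain _
  refine ⟨hdom, ?_⟩
  let c' : Fin n → FractionRing (CoordRing Z) := fun i =>
    algebraMap (CoordRing Z) _ (Ideal.Quotient.mk _ (X i))
  have hc' : ∀ p, aeval c' p = algebraMap (CoordRing Z) (FractionRing (CoordRing Z))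
      (Ideal.Quotient.mk _ p) := by
    intro p
    induction p using MvPolynomial.induction_on with
    | C z => rw [algHom_C]; rfl
    | add p q hp hq => rw [map_add, hp, hq, map_add, map_add]
    | mul_X p i hp => rw [map_mul, aeval_X, hp, map_mul, map_mul]
  refine h _ c' ?_ fun p => ?_
  · rw [eq_top_iff]
    rintro z -
    rw [IntermediateField.mem_adjoin_range_iff]
    obtain ⟨a, b, -, rfl⟩ := IsFractionRing.div_surjective (A := CoordRing Z) z
    obtain ⟨p, rfl⟩ := Ideal.Quotient.mk_surjective a
    obtain ⟨q, rfl⟩ := Ideal.Quotient.mk_surjective b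
    exact ⟨p, q, by rw [hc', hc']⟩
  · rw [hc', FaithfulSMul.algebraMap_eq_zero_iff, Ideal.Quotient.eq_zero_iff_mem]
    rfl

end GenericPoint

theorem exists_generic_point : ∃ (L : Type) (_ : Field L) (_ : Algebra ℂ L) (x y w : L),
    gPlus x y = 0 ∧ Transcendental ℂ y ∧ w ^ 2 = coeffA y := by
  let L := AlgebraicClosure (RatFunc ℂ)
  let y : L := algebraMap (RatFunc ℂ) L RatFunc.X
  have hy : Transcendental ℂ y := by
    rw [transcendental_algebraMap_iff (algebraMap (RatFunc ℂ) L).injective]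
    exact RatFunc.transcendental_X
  obtain ⟨x, hx⟩ := exists_gPlus_eq_zero (leadB_ne_zero_of_transcendental hy)
  obtain ⟨w, hw⟩ := IsAlgClosed.exists_pow_nat_eq (coeffA y) (n := 2) (by norm_num)
  exact ⟨L, inferInstance, inferInstance, x, y, w, hx, hy, hw⟩

/-! ### Specialization of generic points to points of the curves. -/

section

variable {L : Type} [Field L] [Algebra ℂ L] {x y w : L}

/-- A relation of the generic point is a multiple of `gBiv`, and so vanishes wherever `g₊` does. -/
theorem eval_eq_zero_of_aeval_eq_zero (hg : gPlus x y = 0) (hy : Transcendental ℂ y)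
    {p : MvPolynomial (Fin 2) ℂ} (hp : aeval ![x, y] p = 0) {a b : ℂ} (hab : gPlus a b = 0) :
    aeval ![a, b] p = 0 := by
  rw [← biEval_toBiv] at hp ⊢
  obtain ⟨q, hq⟩ := gBiv_dvd_of_biEval_eq_zero hg hy hp
  rw [hq, map_mul, biEval_gBiv, hab, zero_mul]

theorem finite_leadB_eq_zero : {b : ℂ | leadB b = 0}.Finite := by
  have h : (leadB Polynomial.X : Polynomial ℂ) ≠ 0 := by
    intro h
    have := congrArg (Polynomial.eval 0) h
    simp [leadB] at this
  refine (Polynomial.finite_setOf_isRoot h).subset fun b hb => ?_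
  simpa [leadB, Polynomial.IsRoot] using hb

/-- An equation for `c i` over `ℂ` would hold for the `i`-th coordinates of all points of `Z`, of
which there are infinitely many. -/
theorem transcendental_of_ker {n : ℕ} {Z : Set (Fin n → ℂ)} {c : Fin n → L} (i : Fin n)
    (h : ∀ p, (∀ a ∈ Z, eval a p = 0) ↔ aeval c p = 0)
    (hZ : ((fun a => a i) '' Z).Infinite) : Transcendental ℂ (c i) := by
  rintro ⟨p, hp, hp0⟩
  have h1 : aeval c (Polynomial.aeval (X i) p : MvPolynomial (Fin n) ℂ) = 0 := by
    rw [← Polynomial.aeval_algHom_apply, aeval_X]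
    exact hp0
  have h2 := (h _).mpr h1
  refine hZ ((Polynomial.finite_setOf_isRoot hp).subset ?_)
  rintro _ ⟨a, ha, rfl⟩
  have h3 := h2 a ha
  rw [← coe_aeval_eq_eval] at h3
  change aeval a _ = 0 at h3
  rw [← Polynomial.aeval_algHom_apply, aeval_X] at h3
  rwa [Polynomial.coe_aeval_eq_eval] at h3

theorem infinite_image_gPlus {n : ℕ} {Z : Set (Fin n → ℂ)} (i : Fin n)
    (h : ∀ x y : ℂ, gPlus x y = 0 → ∃ a ∈ Z, a i = y) :
    ((fun a => a i) '' Z).Infinite := by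
  refine (finite_leadB_eq_zero.infinite_compl).mono fun b hb => ?_
  obtain ⟨x, hx⟩ := exists_gPlus_eq_zero (L := ℂ) hb
  exact h x b hx

theorem infinite_image_gMinus {n : ℕ} {Z : Set (Fin n → ℂ)} (i : Fin n)
    (h : ∀ x y : ℂ, gPlus x y = 0 → ∃ a ∈ Z, a i = -Complex.I * y) :
    ((fun a => a i) '' Z).Infinite := by
  refine (finite_leadB_eq_zero.infinite_compl.image (f := fun y => -Complex.I * y)
    (mul_right_injective₀ (neg_ne_zero.mpr Complex.I_ne_zero)).injOn).mono ?_
  rintro _ ⟨b, hb, rfl⟩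
  obtain ⟨x, hx⟩ := exists_gPlus_eq_zero (L := ℂ) hb
  exact h x b hx

end

theorem aeval_gPlus {R R' : Type} [CommRing R] [CommRing R'] [Algebra ℂ R] [Algebra ℂ R']
    (φ : R →ₐ[ℂ] R') (x y : R) : φ (gPlus x y) = gPlus (φ x) (φ y) := by
  simp [gPlus, map_ofNat]

theorem hasGenus_gPlus : HasGenus {a : Fin 2 → ℂ | gPlus (a 0) (a 1) = 0} 9 := by
  obtain ⟨L, _, _, x, y, -, hg, hy, -⟩ := exists_generic_point
  have h2 : ∀ (a : Fin 2 → ℂ), ![a 0, a 1] = a := fun a => by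
    funext i
    fin_cases i <;> rfl
  refine hasGenus_of_genericPoint ![x, y] (fun p hp a ha => ?_) (fun a ha => ?_) ?_
  · have := eval_eq_zero_of_aeval_eq_zero hg hy hp ha
    rwa [h2] at this
  · have := ha (gPlus (X 0) (X 1)) (by rw [aeval_gPlus]; simpa using hg)
    rw [← coe_aeval_eq_eval] at this
    change aeval a _ = 0 at this
    rw [aeval_gPlus] at this
    simpa using this
  · intro K _ _ c htop hc
    have hc2 : ![c 0, c 1] = c := by
      funext i
      fin_cases i <;> rfl
    rw [← hc2] at htop
    refine genus_eq_nine htop ?_ (transcendental_of_ker 1 hc (infinite_image_gPlus 1 ?_))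
    · have := (hc (gPlus (X 0) (X 1))).mp fun a ha => by
        rw [← coe_aeval_eq_eval]
        change aeval a _ = 0
        rw [aeval_gPlus]
        simpa using ha
      rw [aeval_gPlus] at this
      simpa using this
    · intro x y h
      exact ⟨![x, y], h, rfl⟩

theorem gMinus_eq_gPlus {R : Type} [CommRing R] [Algebra ℂ R] (x y : R) :
    gMinus x y = gPlus (algebraMap ℂ R Complex.I * x) (algebraMap ℂ R Complex.I * y) := by
  have h : algebraMap ℂ R Complex.I ^ 2 = -1 := by
    rw [← map_pow, Complex.I_sq, map_neg, map_one]
  have h4 : algebraMap ℂ R Complex.I ^ 4 = 1 := by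
    rw [← map_pow, Complex.I_pow_four, map_one]
  simp only [gMinus, gPlus, mul_pow, h, h4]
  ring

theorem gPlus_eq_gMinus {R : Type} [CommRing R] [Algebra ℂ R] (x y : R) :
    gPlus x y = gMinus (algebraMap ℂ R Complex.I * x) (algebraMap ℂ R Complex.I * y) := by
  have h : algebraMap ℂ R Complex.I ^ 2 = -1 := by
    rw [← map_pow, Complex.I_sq, map_neg, map_one]
  have h4 : algebraMap ℂ R Complex.I ^ 4 = 1 := by
    rw [← map_pow, Complex.I_pow_four, map_one]
  simp only [gMinus, gPlus, mul_pow, h, h4]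
  ring

theorem aeval_gMinus {R R' : Type} [CommRing R] [CommRing R'] [Algebra ℂ R] [Algebra ℂ R']
    (φ : R →ₐ[ℂ] R') (x y : R) : φ (gMinus x y) = gMinus (φ x) (φ y) := by
  simp [gMinus, map_ofNat]

theorem transcendental_I_mul {L : Type} [Field L] [Algebra ℂ L] {y : L} (hy : Transcendental ℂ y) :
    Transcendental ℂ (algebraMap ℂ L Complex.I * y) := by
  intro h
  apply hy
  have h1 := (isAlgebraic_algebraMap (R := ℂ) (A := L) Complex.I).mul h
  rw [← mul_assoc, ← map_mul, Complex.I_mul_I, map_neg, map_one, neg_one_mul] at h1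
  simpa using h1.neg

/-- If `(x, y)` is a generic point of `g₊ = 0`, then `(i x, i y)` is one of `g₋ = 0`. In the
function field, multiplying the generators by `i` leads back to `g₊`, so no second genus computation
is needed. -/
theorem hasGenus_gMinus : HasGenus {a : Fin 2 → ℂ | gMinus (a 0) (a 1) = 0} 9 := by
  obtain ⟨L, _, _, x, y, -, hg, hy, -⟩ := exists_generic_point
  let i (R : Type) [CommRing R] [Algebra ℂ R] : R := algebraMap ℂ R Complex.I
  have hg' : gMinus (i L * x) (i L * y) = 0 := by rw [← gPlus_eq_gMinus]; exact hg
  have h2 : ∀ (a : Fin 2 → ℂ), ![a 0, a 1] = a := fun a => by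
    funext i
    fin_cases i <;> rfl
  refine hasGenus_of_genericPoint ![i L * x, i L * y] (fun p hp a ha => ?_) (fun a ha => ?_) ?_
  · have h3 : ∀ (R : Type) [CommRing R] [Algebra ℂ R] (x y : R),
        aeval ![i R * x, i R * y] p = aeval ![x, y] (aeval ![C Complex.I * X 0, C Complex.I * X 1] p
          : MvPolynomial (Fin 2) ℂ) := by
      intro R _ _ x y
      rw [← AlgHom.comp_apply, comp_aeval]
      congr 2
      funext j
      fin_cases j <;> simp [i, algHom_C]
    rw [h3] at hp
    have h4 : gPlus (-Complex.I * a 0) (-Complex.I * a 1) = 0 := by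
      have : gMinus (a 0) (a 1) = 0 := ha
      rw [gMinus_eq_gPlus] at this
      rw [← this]
      simp only [gPlus, Algebra.algebraMap_self, RingHom.id_apply]
      ring
    have h5 := eval_eq_zero_of_aeval_eq_zero hg hy hp h4
    rw [← h3] at h5
    simp only [i, Algebra.algebraMap_self, RingHom.id_apply, ← mul_assoc, mul_neg,
      Complex.I_mul_I, neg_neg, one_mul] at h5
    rwa [h2] at h5
  · have := ha (gMinus (X 0) (X 1)) (by rw [aeval_gMinus]; simpa using hg')
    rw [← coe_aeval_eq_eval] at this
    change aeval a _ = 0 at this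
    rw [aeval_gMinus] at this
    simpa using this
  · intro K _ _ c htop hc
    have htop' : IntermediateField.adjoin ℂ (Set.range ![i K * c 0, i K * c 1]) = ⊤ := by
      have h3 : ∀ j, c j = -(i K * ![i K * c 0, i K * c 1] j) := by
        intro j
        have : ![i K * c 0, i K * c 1] j = i K * c j := by fin_cases j <;> rfl
        rw [this, ← mul_assoc, ← map_mul, Complex.I_mul_I]
        simp
      refine adjoin_eq_top_of_mem htop fun j => ?_
      rw [h3 j]
      exact neg_mem (mul_mem (IntermediateField.algebraMap_mem _ _) (mem_adjoin_range _ j))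
    refine genus_eq_nine htop' ?_ (transcendental_I_mul
      (transcendental_of_ker 1 hc (infinite_image_gMinus 1 ?_)))
    · have := (hc (gMinus (X 0) (X 1))).mp fun a ha => by
        rw [← coe_aeval_eq_eval]
        change aeval a _ = 0
        rw [aeval_gMinus]
        simpa using ha
      rw [aeval_gMinus] at this
      rw [← gMinus_eq_gPlus]
      simpa using this
    · intro x y h
      refine ⟨![-Complex.I * x, -Complex.I * y], ?_, rfl⟩
      change gMinus (-Complex.I * x) (-Complex.I * y) = 0
      rw [gMinus_eq_gPlus, ← h]
      simp [← mul_assoc]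

/-- Reduction modulo `w² = A`. The statement ranges over all rings so that the same `p₀, p₁` serve
at the generic point and at the complex points. -/
theorem exists_aeval_eq_add_mul (p : MvPolynomial (Fin 3) ℂ) :
    ∃ p₀ p₁ : MvPolynomial (Fin 2) ℂ, ∀ (R : Type) [CommRing R] [Algebra ℂ R] (x y w : R),
      w ^ 2 = coeffA y → aeval ![x, y, w] p = aeval ![x, y] p₀ + aeval ![x, y] p₁ * w := by
  induction p using MvPolynomial.induction_on with
  | C z => exact ⟨C z, 0, fun R _ _ x y w h => by simp [algHom_C]⟩
  | add p q hp hq =>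
    obtain ⟨a, b, h1⟩ := hp
    obtain ⟨c, d, h2⟩ := hq
    refine ⟨a + c, b + d, fun R _ _ x y w h => ?_⟩
    rw [map_add, h1 R x y w h, h2 R x y w h, map_add, map_add]
    ring
  | mul_X p i hp =>
    obtain ⟨a, b, h1⟩ := hp
    fin_cases i
    · refine ⟨a * X 0, b * X 0, fun R _ _ x y w h => ?_⟩
      rw [map_mul, h1 R x y w h]
      simp
      ring
    · refine ⟨a * X 1, b * X 1, fun R _ _ x y w h => ?_⟩
      rw [map_mul, h1 R x y w h]
      simp
      ring
    · refine ⟨b * coeffA (X 1), a, fun R _ _ x y w h => ?_⟩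
      rw [map_mul, h1 R x y w h]
      have : aeval ![x, y] (coeffA (X 1) : MvPolynomial (Fin 2) ℂ) = coeffA y := by
        simp [coeffA, map_ofNat]
      rw [map_mul, this, ← h]
      simp
      ring

/-- A relation `p₀ + p₁ w = 0` at the generic point splits into `p₀ = p₁ = 0`, as `w` is not in
`ℂ(x, y)`; both parts then specialize to every point of `C₊`. -/
theorem hasGenus_cover :
    HasGenus {a : Fin 3 → ℂ | gPlus (a 0) (a 1) = 0 ∧ a 2 ^ 2 = coeffA (a 1)} 33 := by
  obtain ⟨L, _, _, x, y, w, hg, hy, hw⟩ := exists_generic_point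
  have h3 : ∀ {R : Type} (a : Fin 3 → R), ![a 0, a 1, a 2] = a := fun a => by
    funext i
    fin_cases i <;> rfl
  have hA : ∀ {R : Type} [CommRing R] [Algebra ℂ R] (c : Fin 3 → R),
      aeval c (X 2 ^ 2 - coeffA (X 1) : MvPolynomial (Fin 3) ℂ) = c 2 ^ 2 - coeffA (c 1) := by
    intro R _ _ c
    simp [coeffA, map_ofNat]
  refine hasGenus_of_genericPoint ![x, y, w] (fun p hp a ha => ?_) (fun a ha => ⟨?_, ?_⟩) ?_
  · obtain ⟨p₀, p₁, h⟩ := exists_aeval_eq_add_mul p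
    rw [h L x y w hw] at hp
    have hF : ∀ q : MvPolynomial (Fin 2) ℂ,
        aeval ![x, y] q ∈ IntermediateField.adjoin ℂ (Set.range ![x, y]) := fun q =>
      curveRing_le_adjoin (mem_adjoin_range ![x, y] 0) (mem_adjoin_range ![x, y] 1) _ ⟨q, rfl⟩
    obtain ⟨e0, e1⟩ := eq_zero_of_add_mul_sqrt_eq_zero hg hy hw (hF p₀) (hF p₁) hp
    have := h ℂ (a 0) (a 1) (a 2) ha.2
    rw [eval_eq_zero_of_aeval_eq_zero hg hy e0 ha.1, eval_eq_zero_of_aeval_eq_zero hg hy e1 ha.1,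
      zero_mul, add_zero, h3] at this
    exact this
  · have := ha (gPlus (X 0) (X 1)) (by rw [aeval_gPlus]; simpa using hg)
    rw [← coe_aeval_eq_eval] at this
    change aeval a _ = 0 at this
    rw [aeval_gPlus] at this
    simpa using this
  · have := ha (X 2 ^ 2 - coeffA (X 1)) (by rw [hA]; simpa [sub_eq_zero] using hw)
    rw [← coe_aeval_eq_eval] at this
    change aeval a _ = 0 at this
    rw [hA] at this
    exact sub_eq_zero.mp this
  · intro K _ _ c htop hc
    rw [← h3 c] at htop
    refine genus_eq_thirtyThree htop ?_ (transcendental_of_ker 1 hc (infinite_image_gPlus 1 ?_)) ?_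
    · have := (hc (gPlus (X 0) (X 1))).mp fun a ha => by
        rw [← coe_aeval_eq_eval]
        change aeval a _ = 0
        rw [aeval_gPlus]
        simpa using ha.1
      rw [aeval_gPlus] at this
      simpa using this
    · intro x y h
      obtain ⟨w, hw⟩ := IsAlgClosed.exists_pow_nat_eq (coeffA y) (n := 2) (by norm_num)
      exact ⟨![x, y, w], ⟨h, hw⟩, rfl⟩
    · have := (hc (X 2 ^ 2 - coeffA (X 1))).mp fun a ha => by
        rw [← coe_aeval_eq_eval]
        change aeval a _ = 0
        rw [hA, sub_eq_zero]
        exact ha.2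
      rw [hA] at this
      exact sub_eq_zero.mp this

/-! ## Homogeneous coordinates -/

theorem hasCoords_rep {n : ℕ} (p : PP n) : HasCoords p p.rep := ⟨p.rep_nonzero, p.mk_rep⟩

theorem HasCoords.exists_smul {n : ℕ} {p : PP n} {v v' : Fin (n + 1) → ℂ} (h : HasCoords p v)
    (h' : HasCoords p v') : ∃ a : ℂ, a ≠ 0 ∧ v' = a • v := by
  obtain ⟨h0, rfl⟩ := h
  obtain ⟨h0', h1⟩ := h'
  obtain ⟨a, ha⟩ := (Projectivization.mk_eq_mk_iff' ℂ _ _ _ _).mp h1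
  refine ⟨a, ?_, ha.symm⟩
  rintro rfl
  exact h0' (by rw [← ha, zero_smul])

theorem HasCoords.smul {n : ℕ} {p : PP n} {v : Fin (n + 1) → ℂ} (h : HasCoords p v) {a : ℂ}
    (ha : a ≠ 0) : HasCoords p (a • v) := by
  obtain ⟨h0, rfl⟩ := h
  exact ⟨smul_ne_zero ha h0, (Projectivization.mk_eq_mk_iff' ℂ _ _ _ _).mpr ⟨a, rfl⟩⟩

theorem HasCoords.ext {n : ℕ} {p p' : PP n} {v : Fin (n + 1) → ℂ} (h : HasCoords p v)
    (h' : HasCoords p' v) : p = p' := by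
  obtain ⟨h0, rfl⟩ := h
  obtain ⟨h0', rfl⟩ := h'
  rfl

/-- The vector `(x, 1)` or `(1, x)`. -/
def chart {R : Type} [One R] (b : Bool) (x : R) : Fin 2 → R := if b then ![1, x] else ![x, 1]

/-- The vector of homogeneous coordinates in one of the four charts of `P^1 × P^1`. -/
def biChart {R : Type} [One R] (b b' : Bool) (x y : R) : Fin 4 → R :=
  ![chart b x 0, chart b x 1, chart b' y 0, chart b' y 1]

theorem pair_eta {R : Type} (v : Fin 2 → R) : ![v 0, v 1] = v := by
  funext i
  fin_cases i <;> rfl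

theorem exists_chart_smul {v : Fin 2 → ℂ} (hv : v ≠ 0) :
    ∃ (b : Bool) (x a : ℂ), a ≠ 0 ∧ v = a • chart b x := by
  by_cases h : v 1 = 0
  · have h0 : v 0 ≠ 0 := fun h0 => hv (by funext i; fin_cases i <;> simp [h, h0])
    refine ⟨true, v 1 / v 0, v 0, h0, ?_⟩
    rw [← pair_eta v]
    simp [chart, h]
  · refine ⟨false, v 0 / v 1, v 1, h, ?_⟩
    conv_lhs => rw [← pair_eta v]
    simp [chart, mul_div_cancel₀ _ h]

theorem exists_hasCoords_chart (p : PP 1) : ∃ (b : Bool) (x : ℂ), HasCoords p (chart b x) := by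
  obtain ⟨b, x, a, ha, h⟩ := exists_chart_smul p.rep_nonzero
  refine ⟨b, x, ?_⟩
  have h1 := (hasCoords_rep p).smul (inv_ne_zero ha)
  rwa [h, smul_smul, inv_mul_cancel₀ ha, one_smul] at h1

theorem hasCoords_affinePoint_fst (x y : ℂ) : HasCoords (affinePoint x y).1 ![x, 1] := ⟨_, rfl⟩

theorem hasCoords_affinePoint_snd (x y : ℂ) : HasCoords (affinePoint x y).2 ![y, 1] := ⟨_, rfl⟩

theorem IsBihomogeneous.eval_smul {H : MvPolynomial (Fin 4) ℂ} {d : ℕ × ℕ}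
    (hH : IsBihomogeneous H d) (s t x u y v : ℂ) :
    eval ![s * x, s * u, t * y, t * v] H = s ^ d.1 * t ^ d.2 * eval ![x, u, y, v] H := by
  rw [eval_eq', eval_eq', Finset.mul_sum]
  refine Finset.sum_congr rfl fun m hm => ?_
  have h := hH (mem_support_iff.mp hm)
  rw [Finsupp.weight_apply, Finsupp.sum_fintype _ _ (by simp)] at h
  simp only [Fin.sum_univ_four, Matrix.cons_val, Prod.smul_mk, smul_eq_mul, mul_one, mul_zero,
    Prod.mk_add_mk, add_zero, zero_add] at h
  rw [← h]
  simp only [Fin.prod_univ_four, Matrix.cons_val, mul_pow, pow_add]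
  ring

theorem IsBihomogeneous.eval_coords_eq_zero_iff {H : MvPolynomial (Fin 4) ℂ} {d : ℕ × ℕ}
    (hH : IsBihomogeneous H d) {c : PP 1 × PP 1} {x u y v : ℂ} (h1 : HasCoords c.1 ![x, u])
    (h2 : HasCoords c.2 ![y, v]) : eval (coords c) H = 0 ↔ eval ![x, u, y, v] H = 0 := by
  obtain ⟨s, hs, e1⟩ := (hasCoords_rep c.1).exists_smul h1
  obtain ⟨t, ht, e2⟩ := (hasCoords_rep c.2).exists_smul h2
  have e3 : x = s * c.1.rep 0 := congrFun e1 0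
  have e4 : u = s * c.1.rep 1 := congrFun e1 1
  have e5 : y = t * c.2.rep 0 := congrFun e2 0
  have e6 : v = t * c.2.rep 1 := congrFun e2 1
  rw [e3, e4, e5, e6, hH.eval_smul]
  simp [coords, hs, ht]

/-! ## The closure of the affine curves -/

/-- On an irreducible curve not contained in the axes, `x y p` vanishes only if `p` does. -/
theorem eval_eq_zero_of_forall_ne_zero {g : ℂ → ℂ → ℂ}
    (hdom : IsDomain (CoordRing {a : Fin 2 → ℂ | g (a 0) (a 1) = 0}))
    (hpt : ∃ x y : ℂ, g x y = 0 ∧ x ≠ 0 ∧ y ≠ 0) {p : MvPolynomial (Fin 2) ℂ}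
    (hp : ∀ x y : ℂ, g x y = 0 → x ≠ 0 → y ≠ 0 → eval ![x, y] p = 0) {x y : ℂ}
    (hxy : g x y = 0) : eval ![x, y] p = 0 := by
  have hprime := (Ideal.Quotient.isDomain_iff_prime _).mp hdom
  have h : X 0 * X 1 * p ∈ vanishingIdeal ℂ {a : Fin 2 → ℂ | g (a 0) (a 1) = 0} := by
    intro a ha
    change eval a (X 0 * X 1 * p) = 0
    rw [map_mul, map_mul, eval_X, eval_X]
    by_cases h0 : a 0 = 0
    · rw [h0, zero_mul, zero_mul]
    by_cases h1 : a 1 = 0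
    · rw [h1, mul_zero, zero_mul]
    have := hp _ _ ha h0 h1
    rw [pair_eta] at this
    rw [this, mul_zero]
  obtain ⟨x₀, y₀, hg, hx, hy⟩ := hpt
  rcases hprime.mem_or_mem h with h1 | h1
  · have := h1 ![x₀, y₀] hg
    change eval ![x₀, y₀] (X 0 * X 1) = 0 at this
    simp [hx, hy] at this
  · exact h1 ![x, y] hxy

/-- By the symmetries `x ↦ 1/x` and `y ↦ 1/y` all four charts carry the same equation. A form
vanishing on the affine curve vanishes in each chart off the axes, hence, by irreducibility, also at
the points at infinity. -/
theorem biClosure_eq {g : ℂ → ℂ → ℂ} {G : MvPolynomial (Fin 4) ℂ} {d : ℕ × ℕ}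
    (hG : IsBihomogeneous G d)
    (hdom : IsDomain (CoordRing {a : Fin 2 → ℂ | g (a 0) (a 1) = 0}))
    (hpt : ∃ x y : ℂ, g x y = 0 ∧ x ≠ 0 ∧ y ≠ 0)
    (hleft : ∀ x y, x ≠ 0 → g x y = 0 → g x⁻¹ y = 0)
    (hright : ∀ x y, y ≠ 0 → g x y = 0 → g x y⁻¹ = 0)
    (hchart : ∀ b b' x y, eval (biChart b b' x y) G = g x y) :
    biClosure {c | ∃ x y : ℂ, g x y = 0 ∧ c = affinePoint x y} = {c | eval (coords c) G = 0} := by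
  ext c
  constructor
  · intro hc
    refine hc G d hG ?_
    rintro _ ⟨x, y, hxy, rfl⟩
    rw [hG.eval_coords_eq_zero_iff (hasCoords_affinePoint_fst x y) (hasCoords_affinePoint_snd x y)]
    exact (hchart false false x y).trans hxy
  · intro hc H d' hH hvan
    obtain ⟨b, x, hx⟩ := exists_hasCoords_chart c.1
    obtain ⟨b', y, hy⟩ := exists_hasCoords_chart c.2
    rw [← pair_eta (chart b x)] at hx
    rw [← pair_eta (chart b' y)] at hy
    have hxy : g x y = 0 := by
      rw [← hchart b b' x y]
      exact (hG.eval_coords_eq_zero_iff hx hy).mp hc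
    rw [hH.eval_coords_eq_zero_iff hx hy]
    have hP : ∀ x y : ℂ, eval ![x, y] (aeval (biChart b b' (X 0) (X 1)) H : MvPolynomial (Fin 2) ℂ)
        = eval (biChart b b' x y) H := by
      intro x y
      rw [← coe_aeval_eq_eval, ← coe_aeval_eq_eval]
      change aeval ![x, y] (aeval _ H) = aeval _ H
      rw [← AlgHom.comp_apply, comp_aeval]
      congr 2
      funext i
      fin_cases i <;> cases b <;> cases b' <;> simp [biChart, chart]
    change eval (biChart b b' x y) H = 0
    rw [← hP]
    refine eval_eq_zero_of_forall_ne_zero hdom hpt (fun x y h hx0 hy0 => ?_) hxy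
    rw [hP]
    have hmem : ∀ (b : Bool) (x : ℂ), x ≠ 0 → ∃ x', (x' = x ∨ x' = x⁻¹) ∧
        ∀ p, HasCoords p ![x', 1] → HasCoords p ![chart b x 0, chart b x 1] := by
      intro b x hx0
      cases b
      · exact ⟨x, Or.inl rfl, fun p hp => hp⟩
      · refine ⟨x⁻¹, Or.inr rfl, fun p hp => ?_⟩
        have := hp.smul hx0
        simpa [chart, mul_inv_cancel₀ hx0] using this
    obtain ⟨x', hx', hx''⟩ := hmem b x hx0
    obtain ⟨y', hy', hy''⟩ := hmem b' y hy0
    have hg : g x' y' = 0 := by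
      have : g x' y = 0 := by
        rcases hx' with rfl | rfl
        · exact h
        · exact hleft _ _ hx0 h
      rcases hy' with rfl | rfl
      · exact this
      · exact hright _ _ hy0 this
    exact (hH.eval_coords_eq_zero_iff (hx'' _ (hasCoords_affinePoint_fst x' y'))
      (hy'' _ (hasCoords_affinePoint_snd x' y'))).mp (hvan _ ⟨x', y', hg, rfl⟩)

theorem isBihomogeneous_ofNat (n : ℕ) [n.AtLeastTwo] :
    IsBihomogeneous (no_index (OfNat.ofNat n)) (0, 0) :=
  isWeightedHomogeneous_C _ (n : ℂ)

theorem isBihomogeneous_sums {a b c d e : MvPolynomial (Fin 4) ℂ}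
    (ha : a = 2 * X 2 ^ 4) (hb : b = X 2 ^ 2 * X 3 ^ 2) (hc : c = 2 * X 3 ^ 4)
    (hd : d = X 2 ^ 4) (he : e = 24 * X 2 ^ 2 * X 3 ^ 2) :
    (IsBihomogeneous a (0, 4) ∧ IsBihomogeneous b (0, 4) ∧ IsBihomogeneous c (0, 4)) ∧
      IsBihomogeneous d (0, 4) ∧ IsBihomogeneous e (0, 4) ∧ IsBihomogeneous (X 3 ^ 4) (0, 4) ∧
      IsBihomogeneous (X 0 ^ 4) (4, 0) ∧ IsBihomogeneous (X 0 ^ 2) (2, 0) ∧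
      IsBihomogeneous (X 1 ^ 2) (2, 0) ∧ IsBihomogeneous (X 1 ^ 4) (4, 0) := by
  subst ha hb hc hd he
  have hX : ∀ (i : Fin 4) (n : ℕ), IsBihomogeneous (X i ^ n)
      (n • (![(1, 0), (1, 0), (0, 1), (0, 1)] : Fin 4 → ℕ × ℕ) i) :=
    fun i n => (isWeightedHomogeneous_X ℂ _ i).pow n
  exact ⟨⟨(isBihomogeneous_ofNat 2).mul (hX 2 4), (hX 2 2).mul (hX 3 2),
    (isBihomogeneous_ofNat 2).mul (hX 3 4)⟩, hX 2 4,
    ((isBihomogeneous_ofNat 24).mul (hX 2 2)).mul (hX 3 2), hX 3 4, hX 0 4, hX 0 2, hX 1 2, hX 1 4⟩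

theorem isBihomogeneous_formGPlus :
    IsBihomogeneous (formGPlus (X 0) (X 1) (X 2) (X 3)) (4, 4) := by
  obtain ⟨⟨h1, h2, h3⟩, h4, h5, h6, h7, h8, h9, h10⟩ := isBihomogeneous_sums rfl rfl rfl rfl rfl
  exact ((((h1.add h2).add h3).mul h7).sub ((((h4.sub h5).add h6).mul h8).mul h9)).add
    (((h1.add h2).add h3).mul h10)

theorem isBihomogeneous_formGMinus :
    IsBihomogeneous (formGMinus (X 0) (X 1) (X 2) (X 3)) (4, 4) := by
  obtain ⟨⟨h1, h2, h3⟩, h4, h5, h6, h7, h8, h9, h10⟩ := isBihomogeneous_sums rfl rfl rfl rfl rfl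
  exact ((((h1.sub h2).add h3).mul h7).add ((((h4.add h5).add h6).mul h8).mul h9)).add
    (((h1.sub h2).add h3).mul h10)

theorem map_formGPlus {R R' : Type} [CommRing R] [CommRing R'] (φ : R →+* R') (x u y v : R) :
    φ (formGPlus x u y v) = formGPlus (φ x) (φ u) (φ y) (φ v) := by
  simp [formGPlus, map_ofNat]

theorem map_formGMinus {R R' : Type} [CommRing R] [CommRing R'] (φ : R →+* R') (x u y v : R) :
    φ (formGMinus x u y v) = formGMinus (φ x) (φ u) (φ y) (φ v) := by
  simp [formGMinus, map_ofNat]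

theorem CPlus_eq : CPlus = {c | eval (coords c) (formGPlus (X 0) (X 1) (X 2) (X 3)) = 0} := by
  refine biClosure_eq isBihomogeneous_formGPlus hasGenus_gPlus.1 ?_ (fun x y _ h => gPlus_inv_left h)
    (fun x y _ h => gPlus_inv_right h) fun b b' x y => ?_
  · obtain ⟨x, hx⟩ := exists_gPlus_eq_zero (L := ℂ) (y := 1) (by norm_num [leadB])
    refine ⟨x, 1, hx, ?_, one_ne_zero⟩
    rintro rfl
    norm_num [gPlus] at hx
  · rw [map_formGPlus]
    cases b <;> cases b' <;> simp [biChart, chart, formGPlus, gPlus] <;> ring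

theorem gMinus_inv_left {x y : ℂ} (hx : x ≠ 0) (h : gMinus x y = 0) : gMinus x⁻¹ y = 0 := by
  have : gMinus x⁻¹ y = (x ^ 4)⁻¹ * gMinus x y := by
    simp only [gMinus]
    field_simp
    ring
  rw [this, h, mul_zero]

theorem gMinus_inv_right {x y : ℂ} (hy : y ≠ 0) (h : gMinus x y = 0) : gMinus x y⁻¹ = 0 := by
  have : gMinus x y⁻¹ = (y ^ 4)⁻¹ * gMinus x y := by
    simp only [gMinus]
    field_simp
    ring
  rw [this, h, mul_zero]

theorem CMinus_eq : CMinus = {c | eval (coords c) (formGMinus (X 0) (X 1) (X 2) (X 3)) = 0} := by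
  refine biClosure_eq isBihomogeneous_formGMinus hasGenus_gMinus.1 ?_
    (fun x y hx h => gMinus_inv_left hx h) (fun x y hy h => gMinus_inv_right hy h)
    fun b b' x y => ?_
  · obtain ⟨x, hx⟩ := exists_gPlus_eq_zero (L := ℂ) (y := Complex.I) (by
      norm_num [leadB, Complex.I_sq, Complex.I_pow_four])
    have h1 : gMinus (Complex.I * x) (Complex.I * Complex.I) = 0 := by
      rw [← hx, gPlus_eq_gMinus]
      rfl
    refine ⟨_, _, h1, ?_, by simp⟩
    intro h0
    rw [h0] at h1
    norm_num [gMinus] at h1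
  · rw [map_formGMinus]
    cases b <;> cases b' <;> simp [biChart, chart, formGMinus, gMinus] <;> ring

theorem mem_CPlus_iff {c : PP 1 × PP 1} {x u y v : ℂ} (h1 : HasCoords c.1 ![x, u])
    (h2 : HasCoords c.2 ![y, v]) : c ∈ CPlus ↔ formGPlus x u y v = 0 := by
  rw [CPlus_eq, Set.mem_ofPred_eq, isBihomogeneous_formGPlus.eval_coords_eq_zero_iff h1 h2,
    map_formGPlus]
  simp

theorem mem_CMinus_iff {c : PP 1 × PP 1} {x u y v : ℂ} (h1 : HasCoords c.1 ![x, u])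
    (h2 : HasCoords c.2 ![y, v]) : c ∈ CMinus ↔ formGMinus x u y v = 0 := by
  rw [CMinus_eq, Set.mem_ofPred_eq, isBihomogeneous_formGMinus.eval_coords_eq_zero_iff h1 h2,
    map_formGMinus]
  simp

theorem affinePart_CPlus : affinePart CPlus = {a | gPlus (a 0) (a 1) = 0} := by
  ext a
  refine (mem_CPlus_iff (hasCoords_affinePoint_fst _ _) (hasCoords_affinePoint_snd _ _)).trans ?_
  simp [formGPlus, gPlus]

theorem affinePart_CMinus : affinePart CMinus = {a | gMinus (a 0) (a 1) = 0} := by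
  ext a
  refine (mem_CMinus_iff (hasCoords_affinePoint_fst _ _) (hasCoords_affinePoint_snd _ _)).trans ?_
  simp [formGMinus, gMinus]

theorem hasGenus_CPlus : HasGenus (affinePart CPlus) 9 := affinePart_CPlus ▸ hasGenus_gPlus

theorem hasGenus_CMinus : HasGenus (affinePart CMinus) 9 := affinePart_CMinus ▸ hasGenus_gMinus

/-! ## Smoothness of the projective curves -/

section Forms

variable {R : Type} [CommRing R]

/-- The partial derivative of `formGPlus` with respect to `x`. -/
def formGX (x u y v : R) : R :=
  4 * (2 * y ^ 4 + y ^ 2 * v ^ 2 + 2 * v ^ 4) * x ^ 3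
    - 2 * (y ^ 4 - 24 * y ^ 2 * v ^ 2 + v ^ 4) * x * u ^ 2

/-- The partial derivative of `formGPlus` with respect to `u`. -/
def formGU (x u y v : R) : R :=
  4 * (2 * y ^ 4 + y ^ 2 * v ^ 2 + 2 * v ^ 4) * u ^ 3
    - 2 * (y ^ 4 - 24 * y ^ 2 * v ^ 2 + v ^ 4) * x ^ 2 * u

/-- The partial derivative of `formGPlus` with respect to `y`. -/
def formGY (x u y v : R) : R :=
  (8 * y ^ 3 + 2 * y * v ^ 2) * (x ^ 4 + u ^ 4) - (4 * y ^ 3 - 48 * y * v ^ 2) * x ^ 2 * u ^ 2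

/-- The partial derivative of `formGPlus` with respect to `v`. -/
def formGV (x u y v : R) : R :=
  (8 * v ^ 3 + 2 * v * y ^ 2) * (x ^ 4 + u ^ 4) - (4 * v ^ 3 - 48 * v * y ^ 2) * x ^ 2 * u ^ 2

/-- The partial derivative of `formA` with respect to `y`. -/
def formAY (y v : R) : R := 8 * y ^ 7 + 56 * y ^ 3 * v ^ 4

theorem derivation_formGPlus [Algebra ℂ R] (D : Derivation ℂ R R) (x u y v : R) :
    D (formGPlus x u y v) = formGX x u y v * D x + formGU x u y v * D u
      + formGY x u y v * D y + formGV x u y v * D v := by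
  simp only [formGPlus, formGX, formGU, formGY, formGV, map_add, map_sub, Derivation.leibniz,
    Derivation.leibniz_pow, derivation_map_ofNat, smul_eq_mul, nsmul_eq_mul, smul_zero, mul_zero,
    add_zero]
  push_cast
  ring

theorem derivation_formA [Algebra ℂ R] (D : Derivation ℂ R R) (y v : R) :
    D (formA y v) = formAY y v * D y + formAY v y * D v := by
  simp only [formA, formAY, map_add, Derivation.leibniz,
    Derivation.leibniz_pow, derivation_map_ofNat, smul_eq_mul, nsmul_eq_mul, smul_zero, mul_zero,
    add_zero]
  push_cast
  ring

theorem formGMinus_eq_formGPlus [Algebra ℂ R] (x u y v : R) : formGMinus x u y v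
    = formGPlus (algebraMap ℂ R Complex.I * x) u (algebraMap ℂ R Complex.I * y) v := by
  have h : algebraMap ℂ R Complex.I ^ 2 = -1 := by
    rw [← map_pow, Complex.I_sq, map_neg, map_one]
  have h4 : algebraMap ℂ R Complex.I ^ 4 = 1 := by
    rw [← map_pow, Complex.I_pow_four, map_one]
  simp only [formGMinus, formGPlus, mul_pow, h, h4]
  ring

variable {R' : Type} [CommRing R'] (φ : R →+* R')

theorem map_formGX (x u y v : R) : φ (formGX x u y v) = formGX (φ x) (φ u) (φ y) (φ v) := by
  simp [formGX, map_ofNat]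

theorem map_formGU (x u y v : R) : φ (formGU x u y v) = formGU (φ x) (φ u) (φ y) (φ v) := by
  simp [formGU, map_ofNat]

theorem map_formGY (x u y v : R) : φ (formGY x u y v) = formGY (φ x) (φ u) (φ y) (φ v) := by
  simp [formGY, map_ofNat]

theorem map_formGV (x u y v : R) : φ (formGV x u y v) = formGV (φ x) (φ u) (φ y) (φ v) := by
  simp [formGV, map_ofNat]

theorem map_formA (y v : R) : φ (formA y v) = formA (φ y) (φ v) := by
  simp [formA, map_ofNat]

theorem map_formAY (y v : R) : φ (formAY y v) = formAY (φ y) (φ v) := by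
  simp [formAY, map_ofNat]

end Forms

theorem exists_chart_pair {x u : ℂ} (h : ![x, u] ≠ 0) : ∃ a t : ℂ, a ≠ 0 ∧
    ((x = a * t ∧ u = a) ∨ (x = a ∧ u = a * t)) := by
  obtain ⟨b, t, a, ha, e⟩ := exists_chart_smul h
  refine ⟨a, t, ha, ?_⟩
  have e0 := congrFun e 0
  have e1 := congrFun e 1
  cases b <;> simp [chart] at e0 e1 <;> simp [e0, e1]

/-- In each chart the derivative with respect to the nonconstant coordinate is, up to a unit, the
affine partial derivative, so affine smoothness suffices. -/
theorem gradient_formGPlus_ne_zero {x u y v : ℂ} (hx : ![x, u] ≠ 0) (hy : ![y, v] ≠ 0)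
    (h : formGPlus x u y v = 0) :
    formGX x u y v ≠ 0 ∨ formGU x u y v ≠ 0 ∨ formGY x u y v ≠ 0 ∨ formGV x u y v ≠ 0 := by
  obtain ⟨a, t, ha, e⟩ := exists_chart_pair hx
  obtain ⟨b, s, hb, e'⟩ := exists_chart_pair hy
  have hg : gPlus t s = 0 := by
    have : a ^ 4 * b ^ 4 * gPlus t s = 0 := by
      rw [← h]
      rcases e with ⟨rfl, rfl⟩ | ⟨rfl, rfl⟩ <;> rcases e' with ⟨rfl, rfl⟩ | ⟨rfl, rfl⟩ <;>
        simp only [gPlus, formGPlus] <;> ring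
    simpa [ha, hb] using this
  have hX : formGX x u y v = a ^ 3 * b ^ 4 * gPlusX t s ∨
      formGU x u y v = a ^ 3 * b ^ 4 * gPlusX t s := by
    rcases e with ⟨rfl, rfl⟩ | ⟨rfl, rfl⟩
    · left
      rcases e' with ⟨rfl, rfl⟩ | ⟨rfl, rfl⟩ <;>
        simp only [gPlusX, leadB, midD, formGX] <;> ring
    · right
      rcases e' with ⟨rfl, rfl⟩ | ⟨rfl, rfl⟩ <;>
        simp only [gPlusX, leadB, midD, formGU] <;> ring
  have hY : formGY x u y v = a ^ 4 * b ^ 3 * gPlusY t s ∨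
      formGV x u y v = a ^ 4 * b ^ 3 * gPlusY t s := by
    rcases e' with ⟨rfl, rfl⟩ | ⟨rfl, rfl⟩
    · left
      rcases e with ⟨rfl, rfl⟩ | ⟨rfl, rfl⟩ <;> simp only [gPlusY, formGY] <;> ring
    · right
      rcases e with ⟨rfl, rfl⟩ | ⟨rfl, rfl⟩ <;> simp only [gPlusY, formGV] <;> ring
  by_contra hcon
  push Not at hcon
  obtain ⟨h1, h2, h3, h4⟩ := hcon
  rw [h1, h2, or_self] at hX
  rw [h3, h4, or_self] at hY
  have hX0 : gPlusX t s = 0 := by simpa [ha, hb] using hX.symm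
  exact gPlusY_ne_zero_of_gPlusX hg hX0 (by simpa [ha, hb] using hY.symm)

theorem formGX_or_formGU_ne_zero {x u y v : ℂ} (hx : ![x, u] ≠ 0) (hy : ![y, v] ≠ 0)
    (h : formGPlus x u y v = 0) (hA : formA y v = 0) :
    formGX x u y v ≠ 0 ∨ formGU x u y v ≠ 0 := by
  obtain ⟨a, t, ha, e⟩ := exists_chart_pair hx
  obtain ⟨b, s, hb, e'⟩ := exists_chart_pair hy
  have hg : gPlus t s = 0 := by
    have : a ^ 4 * b ^ 4 * gPlus t s = 0 := by
      rw [← h]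
      rcases e with ⟨rfl, rfl⟩ | ⟨rfl, rfl⟩ <;> rcases e' with ⟨rfl, rfl⟩ | ⟨rfl, rfl⟩ <;>
        simp only [gPlus, formGPlus] <;> ring
    simpa [ha, hb] using this
  have hA' : coeffA s = 0 := by
    have : b ^ 8 * coeffA s = 0 := by
      rw [← hA]
      rcases e' with ⟨rfl, rfl⟩ | ⟨rfl, rfl⟩ <;> simp only [coeffA, formA] <;> ring
    simpa [hb] using this
  have hne := gPlusX_ne_zero_of_coeffA hA' hg
  rcases e with ⟨rfl, rfl⟩ | ⟨rfl, rfl⟩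
  · left
    have : formGX (u * t) u y v = u ^ 3 * b ^ 4 * gPlusX t s := by
      rcases e' with ⟨rfl, rfl⟩ | ⟨rfl, rfl⟩ <;>
        simp only [gPlusX, leadB, midD, formGX] <;> ring
    rw [this]
    simp [ha, hb, hne]
  · right
    have : formGU x (x * t) y v = x ^ 3 * b ^ 4 * gPlusX t s := by
      rcases e' with ⟨rfl, rfl⟩ | ⟨rfl, rfl⟩ <;>
        simp only [gPlusX, leadB, midD, formGU] <;> ring
    rw [this]
    simp [ha, hb, hne]

theorem formAY_ne_zero {y v : ℂ} (hy : ![y, v] ≠ 0) (hA : formA y v = 0) :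
    formAY y v ≠ 0 ∨ formAY v y ≠ 0 := by
  obtain ⟨b, s, hb, e⟩ := exists_chart_pair hy
  have hA' : coeffA s = 0 := by
    have : b ^ 8 * coeffA s = 0 := by
      rw [← hA]
      rcases e with ⟨rfl, rfl⟩ | ⟨rfl, rfl⟩ <;> simp only [coeffA, formA] <;> ring
    simpa [hb] using this
  have hne := coeffA'_ne_zero hA'
  rcases e with ⟨rfl, rfl⟩ | ⟨rfl, rfl⟩
  · left
    have : formAY (v * s) v = v ^ 7 * coeffA' s := by simp only [formAY, coeffA']; ring
    rw [this]
    simp [hb, hne]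
  · right
    have : formAY (y * s) y = y ^ 7 * coeffA' s := by simp only [formAY, coeffA']; ring
    rw [this]
    simp [hb, hne]

theorem rep_pair_ne_zero (p : PP 1) : ![p.rep 0, p.rep 1] ≠ 0 := by
  rw [pair_eta]
  exact p.rep_nonzero

theorem isSmoothCurve_CPlus : IsSmoothCurve CPlus (formGPlus (X 0) (X 1) (X 2) (X 3)) (4, 4) := by
  refine ⟨isBihomogeneous_formGPlus, CPlus_eq, fun c hc => ?_⟩
  rw [CPlus_eq, Set.mem_ofPred_eq, map_formGPlus] at hc
  simp only [eval_X, coords, Matrix.cons_val] at hc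
  rcases gradient_formGPlus_ne_zero (rep_pair_ne_zero c.1) (rep_pair_ne_zero c.2) hc with
    h | h | h | h
  on_goal 1 => refine ⟨0, ?_⟩
  on_goal 2 => refine ⟨1, ?_⟩
  on_goal 3 => refine ⟨2, ?_⟩
  on_goal 4 => refine ⟨3, ?_⟩
  all_goals
    rw [derivation_formGPlus]
    simpa [map_formGX, map_formGU, map_formGY, map_formGV, coords, pderiv_X, Pi.single_apply] using h

theorem isSmoothCurve_CMinus :
    IsSmoothCurve CMinus (formGMinus (X 0) (X 1) (X 2) (X 3)) (4, 4) := by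
  refine ⟨isBihomogeneous_formGMinus, CMinus_eq, fun c hc => ?_⟩
  rw [CMinus_eq, Set.mem_ofPred_eq, map_formGMinus, formGMinus_eq_formGPlus] at hc
  simp only [eval_X, coords, Matrix.cons_val] at hc
  have hne : ∀ p : PP 1, ![algebraMap ℂ ℂ Complex.I * p.rep 0, p.rep 1] ≠ 0 := by
    intro p h
    apply rep_pair_ne_zero p
    have h0 : Complex.I * p.rep 0 = 0 := congrFun h 0
    have h1 : p.rep 1 = 0 := congrFun h 1
    rw [h1, (mul_eq_zero.mp h0).resolve_left Complex.I_ne_zero]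
    simp
  rcases gradient_formGPlus_ne_zero (hne c.1) (hne c.2) hc with h | h | h | h
  on_goal 1 => refine ⟨0, ?_⟩
  on_goal 2 => refine ⟨1, ?_⟩
  on_goal 3 => refine ⟨2, ?_⟩
  on_goal 4 => refine ⟨3, ?_⟩
  all_goals
    rw [formGMinus_eq_formGPlus, derivation_formGPlus]
    simpa [map_formGX, map_formGU, map_formGY, map_formGV, coords, pderiv_X, Pi.single_apply,
      algebraMap_eq] using h

/-! ## Weighted homogeneous coordinates -/

theorem WP.HasCoords.exists_smul {n : ℕ} {p : WP n} {x x' : Fin n → ℂ} {w w' : ℂ}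
    (h : p.HasCoords x w) (h' : p.HasCoords x' w') :
    ∃ a : ℂ, a ≠ 0 ∧ x' = a • x ∧ w' = a ^ 4 * w := by
  obtain ⟨h0, rfl⟩ := h
  obtain ⟨h0', h1⟩ := h'
  obtain ⟨a, ha, e1, e2⟩ := Quotient.exact h1.symm
  exact ⟨a, ha, e1, e2⟩

theorem WP.HasCoords.smul {n : ℕ} {p : WP n} {x : Fin n → ℂ} {w : ℂ}
    (h : p.HasCoords x w) {a : ℂ} (ha : a ≠ 0) : p.HasCoords (a • x) (a ^ 4 * w) := by
  obtain ⟨h0, rfl⟩ := h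
  have h1 : (a • x, a ^ 4 * w) ≠ 0 := by
    intro h1
    apply h0
    have e1 : a • x = 0 := congrArg Prod.fst h1
    have e2 : a ^ 4 * w = 0 := congrArg Prod.snd h1
    exact Prod.ext ((smul_eq_zero.mp e1).resolve_left ha)
      ((mul_eq_zero.mp e2).resolve_left (pow_ne_zero 4 ha))
  refine ⟨h1, Quotient.sound ?_⟩
  exact (wpSetoid n).iseqv.symm ⟨a, ha, rfl, rfl⟩

theorem WP.HasCoords.ext {n : ℕ} {p p' : WP n} {x : Fin n → ℂ} {w : ℂ} (h : p.HasCoords x w)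
    (h' : p'.HasCoords x w) : p = p' := by
  obtain ⟨h0, rfl⟩ := h
  obtain ⟨h0', rfl⟩ := h'
  rfl

theorem WP.exists_hasCoords {n : ℕ} (p : WP n) : ∃ x w, p.HasCoords x w := by
  induction p using Quotient.ind with
  | _ v => exact ⟨v.1.1, v.1.2, v.2, rfl⟩

theorem WP.exists_of_ne_zero {n : ℕ} {x : Fin n → ℂ} (hx : x ≠ 0) (w : ℂ) :
    ∃ p : WP n, p.HasCoords x w :=
  ⟨_, fun h => hx (congrArg Prod.fst h), rfl⟩

theorem HasCoords.ne_zero {n : ℕ} {p : PP n} {v : Fin (n + 1) → ℂ} (h : HasCoords p v) : v ≠ 0 :=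
  h.1

theorem exists_point {n : ℕ} {v : Fin (n + 1) → ℂ} (h : v ≠ 0) : ∃ p : PP n, HasCoords p v :=
  ⟨_, h, rfl⟩

theorem exists_hasCoords_pair (p : PP 1) : ∃ x u : ℂ, HasCoords p ![x, u] :=
  ⟨_, _, by rw [pair_eta]; exact hasCoords_rep p⟩

/-! ## The points of the double cover -/

theorem formA_smul (a y v : ℂ) : formA (a * y) (a * v) = a ^ 8 * formA y v := by
  simp only [formA]
  ring

theorem mem_coverFiber_iff {c : PP 1 × PP 1} {y v : ℂ} (hy : HasCoords c.2 ![y, v])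
    {q : PP 1 × WP 2} :
    q ∈ coverFiber c ↔ q.1 = c.1 ∧ ∃ w, q.2.HasCoords ![y, v] w ∧ w ^ 2 = formA y v := by
  refine and_congr_right fun _ => ⟨?_, fun ⟨w, h1, h2⟩ => ⟨y, v, w, hy, h1, h2⟩⟩
  rintro ⟨y', v', w, h1, h2, h3⟩
  obtain ⟨a, ha, e⟩ := h1.exists_smul hy
  refine ⟨a ^ 4 * w, ?_, ?_⟩
  · rw [e]
    exact h2.smul ha
  · have e0 : y = a * y' := congrFun e 0
    have e1 : v = a * v' := congrFun e 1
    rw [e0, e1, formA_smul, ← h3]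
    ring

theorem mem_CTilde_iff {q : PP 1 × WP 2} {x u y v w : ℂ} (h1 : HasCoords q.1 ![x, u])
    (h2 : q.2.HasCoords ![y, v] w) :
    q ∈ CTilde ↔ ![y, v] ≠ 0 ∧ formGPlus x u y v = 0 ∧ w ^ 2 = formA y v := by
  constructor
  · rintro ⟨c, hc, e, y', v', w', h3, h4, h5⟩
    obtain ⟨a, ha, e1, e2⟩ := h4.exists_smul h2
    have h6 : HasCoords c.2 ![y, v] := by
      rw [e1]
      exact h3.smul ha
    refine ⟨h6.ne_zero, (mem_CPlus_iff (e ▸ h1) h6).mp hc, ?_⟩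
    have e0 : y = a * y' := congrFun e1 0
    have e3 : v = a * v' := congrFun e1 1
    rw [e0, e3, formA_smul, ← h5, e2]
    ring
  · rintro ⟨h3, h4, h5⟩
    obtain ⟨p, hp⟩ := exists_point h3
    exact ⟨(q.1, p), (mem_CPlus_iff (c := (q.1, p)) h1 hp).mpr h4, rfl, y, v, w, hp, h2, h5⟩

theorem affinePartTilde_eq :
    affinePartTilde = {a | gPlus (a 0) (a 1) = 0 ∧ a 2 ^ 2 = coeffA (a 1)} := by
  have hg : ∀ x y : ℂ, formGPlus x 1 y 1 = gPlus x y := fun x y => by simp [formGPlus, gPlus]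
  have hA : ∀ y : ℂ, formA y 1 = coeffA y := fun y => by simp [formA, coeffA]
  ext a
  constructor
  · rintro ⟨q, hq, h1, h2⟩
    obtain ⟨-, h3, h4⟩ := (mem_CTilde_iff h1 h2).mp hq
    rw [hg] at h3
    rw [hA] at h4
    exact ⟨h3, h4⟩
  · rintro ⟨h1, h2⟩
    obtain ⟨p, hp⟩ := exists_point (n := 1) (v := ![a 0, 1]) (by simp)
    obtain ⟨r, hr⟩ := WP.exists_of_ne_zero (n := 2) (x := ![a 1, 1]) (by simp) (a 2)
    refine ⟨(p, r), (mem_CTilde_iff hp hr).mpr ⟨by simp, ?_, ?_⟩, hp, hr⟩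
    · rw [hg, h1]
    · rw [hA, h2]

theorem hasGenus_CTilde : HasGenus affinePartTilde 33 := affinePartTilde_eq ▸ hasGenus_cover

theorem cTildeIsSmooth : CTildeIsSmooth := by
  intro q hq x u y v w h1 h2
  obtain ⟨hy, hG, hw⟩ := (mem_CTilde_iff h1 h2).mp hq
  have hx := h1.ne_zero
  have e1 : gradient (formGPlus (X 0) (X 1) (X 2) (X 3)) ![x, u, y, v, w]
      = ![formGX x u y v, formGU x u y v, formGY x u y v, formGV x u y v, 0] := by
    funext i
    rw [gradient, derivation_formGPlus]
    fin_cases i <;>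
      simp [map_formGX, map_formGU, map_formGY, map_formGV, pderiv_X, Pi.single_apply]
  have e2 : gradient (X 4 ^ 2 - formA (X 2) (X 3)) ![x, u, y, v, w]
      = ![0, 0, -formAY y v, -formAY v y, 2 * w] := by
    funext i
    rw [gradient, map_sub, derivation_formA, Derivation.leibniz_pow]
    fin_cases i <;>
      simp [map_formAY, pderiv_X, Pi.single_apply]
  rw [e1, e2, LinearIndependent.pair_iff]
  intro s t h
  have h0 : s * formGX x u y v = 0 := by simpa using congrFun h 0
  have h3 : s * formGU x u y v = 0 := by simpa using congrFun h 1
  have h4 : s * formGY x u y v - t * formAY y v = 0 := by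
    simpa [sub_eq_add_neg] using congrFun h 2
  have h5 : s * formGV x u y v - t * formAY v y = 0 := by
    simpa [sub_eq_add_neg] using congrFun h 3
  have h6 : t * (2 * w) = 0 := by simpa using congrFun h 4
  -- At a branch point the second gradient has only `y, v`-components, not both zero, while the
  -- first has a nonzero `x`- or `u`-component. Elsewhere the `w`-component `2 w` belongs to the
  -- second gradient alone.
  by_cases hw0 : w = 0
  · have hA : formA y v = 0 := by rw [← hw, hw0]; ring
    have hs : s = 0 := by
      rcases formGX_or_formGU_ne_zero hx hy hG hA with h7 | h7
      · exact (mul_eq_zero.mp h0).resolve_right h7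
      · exact (mul_eq_zero.mp h3).resolve_right h7
    subst hs
    refine ⟨rfl, ?_⟩
    simp only [zero_mul, zero_sub, neg_eq_zero, mul_eq_zero] at h4 h5
    rcases formAY_ne_zero hy hA with h7 | h7
    · exact h4.resolve_right h7
    · exact h5.resolve_right h7
  · have ht : t = 0 := by simpa [hw0] using h6
    subst ht
    refine ⟨?_, rfl⟩
    simp only [zero_mul, sub_zero] at h4 h5
    rcases gradient_formGPlus_ne_zero hx hy hG with h7 | h7 | h7 | h7
    exacts [(mul_eq_zero.mp h0).resolve_right h7, (mul_eq_zero.mp h3).resolve_right h7,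
      (mul_eq_zero.mp h4).resolve_right h7, (mul_eq_zero.mp h5).resolve_right h7]

/-! ## Maschke's octic on the lines `l_c` -/

/-- Maschke's octic as a function of four arguments. -/
def octic {R : Type} [CommRing R] (a b c d : R) : R :=
  a ^ 8 + b ^ 8 + c ^ 8 + d ^ 8 + 14 * (a ^ 4 * b ^ 4 + a ^ 4 * c ^ 4 + a ^ 4 * d ^ 4
    + b ^ 4 * c ^ 4 + b ^ 4 * d ^ 4 + c ^ 4 * d ^ 4) + 168 * a ^ 2 * b ^ 2 * c ^ 2 * d ^ 2

theorem F_eq_octic : F = octic (X 0) (X 1) (X 2) (X 3) := by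
  have h0 : Finset.Ioi (0 : Fin 4) = {1, 2, 3} := by decide
  have h1 : Finset.Ioi (1 : Fin 4) = {2, 3} := by decide
  have h2 : Finset.Ioi (2 : Fin 4) = {3} := by decide
  have h3 : Finset.Ioi (3 : Fin 4) = ∅ := by decide
  simp only [F, octic, Fin.sum_univ_four, h0, h1, h2, h3]
  simp
  ring

theorem aeval_F {R : Type} [CommRing R] [Algebra ℂ R] (f : Fin 4 → R) :
    aeval f F = octic (f 0) (f 1) (f 2) (f 3) := by
  rw [F_eq_octic]
  simp [octic, map_ofNat]

theorem eval_F (f : Fin 4 → ℂ) : eval f F = octic (f 0) (f 1) (f 2) (f 3) := by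
  rw [← aeval_F]
  rfl

theorem eval_F_smul (a : ℂ) (f : Fin 4 → ℂ) : eval (a • f) F = a ^ 8 * eval f F := by
  simp only [eval_F, octic, Pi.smul_apply, smul_eq_mul]
  ring

/-- The coefficient `C` is the form `A` in the variables `x, u`, so everything below is symmetric in
the two factors. -/
theorem octic_line {R : Type} [CommRing R] (x u y v s t : R) :
    octic (s * x) (s * u) (t * y) (t * v)
      = formA y v * t ^ 8 + formB x u y v * s ^ 4 * t ^ 4 + formA x u * s ^ 8 := by
  simp only [octic, formA, formB]
  ring

theorem fc_eq (x y : ℂ) : fc x y = Polynomial.C (coeffA y) * Polynomial.X ^ 8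
    + Polynomial.C (coeffB x y) * Polynomial.X ^ 4 + Polynomial.C (coeffC x) := by
  rw [fc, aeval_F]
  simp only [octic, coeffA, coeffB, coeffC, map_add, map_mul, map_pow, map_ofNat, map_one,
    Matrix.cons_val]
  ring

theorem discr_eq {R : Type} [CommRing R] (x y : R) :
    discr x y = 48 * gPlus x y * gMinus x y := by
  simp only [discr, coeffA, coeffB, coeffC, gPlus, gMinus]
  ring

theorem formDiscr_eq {R : Type} [CommRing R] (x u y v : R) :
    formB x u y v ^ 2 - 4 * formA y v * formA x u
      = 48 * formGPlus x u y v * formGMinus x u y v := by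
  simp only [formA, formB, formGPlus, formGMinus]
  ring

theorem fc_eq_sq {x y : ℂ} (h : discr x y = 0) : ∃ l m : ℂ,
    fc x y = (Polynomial.C l * Polynomial.X ^ 4 + Polynomial.C m) ^ 2 := by
  have hd : coeffB x y ^ 2 = 4 * coeffA y * coeffC x := sub_eq_zero.mp h
  obtain ⟨l, m, h1, h2, h3⟩ : ∃ l m : ℂ, l ^ 2 = coeffA y ∧ 2 * l * m = coeffB x y ∧
      m ^ 2 = coeffC x := by
    obtain ⟨l, hl⟩ := IsAlgClosed.exists_pow_nat_eq (coeffA y) (n := 2) (by norm_num)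
    -- If `A = 0`, the vanishing discriminant gives `B = 0`, and `m` can be any root of `C`;
    -- otherwise `m = B / (2 l)` is forced.
    by_cases h0 : l = 0
    · obtain ⟨m, hm⟩ := IsAlgClosed.exists_pow_nat_eq (coeffC x) (n := 2) (by norm_num)
      refine ⟨l, m, hl, ?_, hm⟩
      rw [← hl, h0] at hd
      have : coeffB x y = 0 := by simpa using hd
      rw [h0, this]
      ring
    · refine ⟨l, coeffB x y / (2 * l), hl, by field_simp, ?_⟩
      rw [div_pow, hd, ← hl]
      field_simp
      ring
  refine ⟨l, m, ?_⟩
  rw [fc_eq, ← h1, ← h2, ← h3]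
  simp only [map_mul, map_pow, map_ofNat]
  ring

/-! ## Lines -/

theorem mem_line_iff {c : PP 1 × PP 1} {x u y v : ℂ} (h1 : HasCoords c.1 ![x, u])
    (h2 : HasCoords c.2 ![y, v]) {z : Fin 4 → ℂ} :
    z ∈ line c ↔ ∃ s t : ℂ, z = ![s * x, s * u, t * y, t * v] := by
  obtain ⟨a, ha, e1⟩ := (hasCoords_rep c.1).exists_smul h1
  obtain ⟨b, hb, e2⟩ := (hasCoords_rep c.2).exists_smul h2
  have e3 : x = a * c.1.rep 0 := congrFun e1 0
  have e4 : u = a * c.1.rep 1 := congrFun e1 1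
  have e5 : y = b * c.2.rep 0 := congrFun e2 0
  have e6 : v = b * c.2.rep 1 := congrFun e2 1
  rw [line, Submodule.mem_span_pair]
  constructor
  · rintro ⟨s, t, rfl⟩
    refine ⟨s / a, t / b, ?_⟩
    rw [e3, e4, e5, e6]
    funext i
    fin_cases i <;> simp [basePoint₁, basePoint₂] <;> field_simp
  · rintro ⟨s, t, rfl⟩
    refine ⟨s * a, t * b, ?_⟩
    rw [e3, e4, e5, e6]
    funext i
    fin_cases i <;> simp [basePoint₁, basePoint₂] <;> ring

/-- The single point with `s = t = 1` already determines both components of `c`. -/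
theorem eq_of_line_le {c c' : PP 1 × PP 1} (h : line c ≤ line c') : c = c' := by
  obtain ⟨x, u, h1⟩ := exists_hasCoords_pair c.1
  obtain ⟨y, v, h2⟩ := exists_hasCoords_pair c.2
  obtain ⟨x', u', h1'⟩ := exists_hasCoords_pair c'.1
  obtain ⟨y', v', h2'⟩ := exists_hasCoords_pair c'.2
  obtain ⟨s, t, e⟩ := (mem_line_iff h1' h2').mp
    (h ((mem_line_iff h1 h2).mpr ⟨1, 1, rfl⟩))
  have e0 : x = s * x' := by simpa using congrFun e 0
  have e1 : u = s * u' := by simpa using congrFun e 1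
  have e2 : y = t * y' := by simpa using congrFun e 2
  have e3 : v = t * v' := by simpa using congrFun e 3
  have key : ∀ {p p' : PP 1} {x u x' u' s : ℂ}, HasCoords p ![x, u] → HasCoords p' ![x', u'] →
      x = s * x' → u = s * u' → p = p' := by
    intro p p' x u x' u' s hp hp' h0 h1
    have hs : s ≠ 0 := by
      rintro rfl
      apply hp.ne_zero
      simp [h0, h1]
    have := hp'.smul hs
    simp only [Matrix.smul_cons, smul_eq_mul, Matrix.smul_empty, ← h0, ← h1] at this
    exact hp.ext this
  exact Prod.ext (key h1 h1' e0 e1) (key h2 h2' e2 e3)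

theorem line_injective : Function.Injective line := fun _ _ h => eq_of_line_le h.le

theorem mem_S_iff {p : PP 3} {a : Fin 4 → ℂ} (h : HasCoords p a) : p ∈ S ↔ eval a F = 0 := by
  obtain ⟨s, hs, rfl⟩ := (hasCoords_rep p).exists_smul h
  rw [eval_F_smul]
  simp [S, hs]

theorem submodule_le_iff {n : ℕ} {p : PP n} {a : Fin (n + 1) → ℂ} (h : HasCoords p a)
    {L : Submodule ℂ (Fin (n + 1) → ℂ)} : p.submodule ≤ L ↔ a ∈ L := by
  obtain ⟨h0, rfl⟩ := h
  rw [Projectivization.submodule_mk, Submodule.span_singleton_le_iff_mem]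

theorem mem_submodule_iff {n : ℕ} {p : PP n} {a b : Fin (n + 1) → ℂ} (h : HasCoords p a) :
    b ∈ p.submodule ↔ ∃ r : ℂ, r • a = b := by
  obtain ⟨h0, rfl⟩ := h
  rw [Projectivization.submodule_mk, Submodule.mem_span_singleton]

theorem liesInS_iff {L : Submodule ℂ (Fin 4 → ℂ)} : LiesInS L ↔ ∀ a ∈ L, eval a F = 0 := by
  constructor
  · intro h a ha
    by_cases h0 : a = 0
    · rw [h0, eval_F]
      simp [octic]
    · obtain ⟨p, hp⟩ := exists_point h0
      exact (mem_S_iff hp).mp (h p ((submodule_le_iff hp).mpr ha))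
  · intro h p hp
    exact h _ ((submodule_le_iff (hasCoords_rep p)).mp hp)

theorem liesInS_line_iff {c : PP 1 × PP 1} {x u y v : ℂ} (h1 : HasCoords c.1 ![x, u])
    (h2 : HasCoords c.2 ![y, v]) :
    LiesInS (line c) ↔ formA y v = 0 ∧ formB x u y v = 0 ∧ formA x u = 0 := by
  have hF : ∀ s t : ℂ, eval ![s * x, s * u, t * y, t * v] F
      = formA y v * t ^ 8 + formB x u y v * s ^ 4 * t ^ 4 + formA x u * s ^ 8 := by
    intro s t
    rw [eval_F, ← octic_line]
    rfl
  rw [liesInS_iff]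
  constructor
  · intro h
    have h' : ∀ s t : ℂ,
        formA y v * t ^ 8 + formB x u y v * s ^ 4 * t ^ 4 + formA x u * s ^ 8 = 0 :=
      fun s t => hF s t ▸ h _ ((mem_line_iff h1 h2).mpr ⟨s, t, rfl⟩)
    have hA : formA y v = 0 := by simpa using h' 0 1
    have hC : formA x u = 0 := by simpa using h' 1 0
    exact ⟨hA, by simpa [hA, hC] using h' 1 1, hC⟩
  · rintro ⟨hA, hB, hC⟩ a ha
    obtain ⟨s, t, rfl⟩ := (mem_line_iff h1 h2).mp ha
    rw [hF, hA, hB, hC]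
    ring

theorem pair_ne_zero_iff {y v : ℂ} (hy : ![y, v] ≠ 0) : y ^ 2 * v ^ 2 ≠ 0 ∨ y ^ 4 + v ^ 4 ≠ 0 := by
  by_contra h
  push Not at h
  obtain ⟨h1, h2⟩ := h
  apply hy
  rcases mul_eq_zero.mp h1 with h3 | h3
  · have h4 : y = 0 := by simpa using h3
    rw [h4] at h2
    have h5 : v = 0 := by simpa using h2
    simp [h4, h5]
  · have h4 : v = 0 := by simpa using h3
    rw [h4] at h2
    have h5 : y = 0 := by simpa using h2
    simp [h4, h5]

/-- Put `p = x⁴ + u⁴`, `P = x² u²`, `q = y⁴ + v⁴`, `Q = y² v²`. The two equations amount to `Q p = q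
P` and `p q = -12 P Q`, and `A = q² + 12 Q²`, `C = p² + 12 P²`. Eliminating shows that `A`
annihilates `p` and `P`, and `C` annihilates `q` and `Q`. -/
theorem forms_eq_zero_of_formGPlus_of_formGMinus {x u y v : ℂ} (hx : ![x, u] ≠ 0)
    (hy : ![y, v] ≠ 0) (h1 : formGPlus x u y v = 0) (h2 : formGMinus x u y v = 0) :
    formA y v = 0 ∧ formB x u y v = 0 ∧ formA x u = 0 := by
  have e1 : y ^ 2 * v ^ 2 * (x ^ 4 + u ^ 4) = (y ^ 4 + v ^ 4) * (x ^ 2 * u ^ 2) := by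
    simp only [formGPlus, formGMinus] at h1 h2
    linear_combination (h1 - h2) / 2
  have e2 : (x ^ 4 + u ^ 4) * (y ^ 4 + v ^ 4) = -12 * (x ^ 2 * u ^ 2) * (y ^ 2 * v ^ 2) := by
    simp only [formGPlus, formGMinus] at h1 h2
    linear_combination (h1 + h2) / 4
  have hB : formB x u y v = 0 := by
    simp only [formB]
    linear_combination 14 * e2
  have e3 : x ^ 2 * u ^ 2 * formA y v = 0 := by
    simp only [formA]
    linear_combination -(y ^ 4 + v ^ 4) * e1 + (y ^ 2 * v ^ 2) * e2
  have e4 : (x ^ 4 + u ^ 4) * formA y v = 0 := by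
    simp only [formA]
    linear_combination (y ^ 4 + v ^ 4) * e2 + 12 * (y ^ 2 * v ^ 2) * e1
  have e5 : y ^ 2 * v ^ 2 * formA x u = 0 := by
    simp only [formA]
    linear_combination (x ^ 4 + u ^ 4) * e1 + (x ^ 2 * u ^ 2) * e2
  have e6 : (y ^ 4 + v ^ 4) * formA x u = 0 := by
    simp only [formA]
    linear_combination (x ^ 4 + u ^ 4) * e2 - 12 * (x ^ 2 * u ^ 2) * e1
  refine ⟨?_, hB, ?_⟩
  · rcases pair_ne_zero_iff hx with h | h
    · exact (mul_eq_zero.mp e3).resolve_left h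
    · exact (mul_eq_zero.mp e4).resolve_left h
  · rcases pair_ne_zero_iff hy with h | h
    · exact (mul_eq_zero.mp e5).resolve_left h
    · exact (mul_eq_zero.mp e6).resolve_left h

theorem formB_add {x u y v : ℂ} :
    formB x u y v = 7 / 2 * (formGPlus x u y v + formGMinus x u y v) := by
  simp only [formB, formGPlus, formGMinus]
  ring

/-- For the converse, `B = 7/2 (g₊ + g₋)` vanishes, so the discriminant becomes `-48 g₊²`; it is
zero since `A = B = 0`. -/
theorem liesInS_line_iff_mem (c : PP 1 × PP 1) : LiesInS (line c) ↔ c ∈ CPlus ∩ CMinus := by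
  obtain ⟨x, u, h1⟩ := exists_hasCoords_pair c.1
  obtain ⟨y, v, h2⟩ := exists_hasCoords_pair c.2
  rw [liesInS_line_iff h1 h2, Set.mem_inter_iff, mem_CPlus_iff h1 h2, mem_CMinus_iff h1 h2]
  refine ⟨fun ⟨hA, hB, hC⟩ => ?_, fun ⟨h3, h4⟩ =>
    forms_eq_zero_of_formGPlus_of_formGMinus h1.ne_zero h2.ne_zero h3 h4⟩
  have h3 := formDiscr_eq x u y v
  rw [hA, hB] at h3
  have h4 := formB_add (x := x) (u := u) (y := y) (v := v)
  rw [hB] at h4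
  have h5 : formGMinus x u y v = -formGPlus x u y v := by linear_combination -2 / 7 * h4
  rw [h5] at h3
  have h6 : formGPlus x u y v ^ 2 = 0 := by linear_combination h3 / 48
  have h7 : formGPlus x u y v = 0 := by simpa using h6
  exact ⟨h7, by rw [h5, h7, neg_zero]⟩

/-- If `A = B = 0` at `c` then the line `l_c` is contained in the surface. -/
theorem formA_eq_zero_of_formA_of_formB {x u y v : ℂ} (hy : ![y, v] ≠ 0)
    (hA : formA y v = 0) (hB : formB x u y v = 0) : formA x u = 0 := by
  have e1 : (y ^ 4 + v ^ 4) ^ 2 = -12 * (y ^ 2 * v ^ 2) ^ 2 := by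
    simp only [formA] at hA
    linear_combination hA
  have e2 : (x ^ 4 + u ^ 4) * (y ^ 4 + v ^ 4) = -12 * (x ^ 2 * u ^ 2) * (y ^ 2 * v ^ 2) := by
    simp only [formB] at hB
    linear_combination hB / 14
  have hP : y ^ 2 * v ^ 2 ≠ 0 := by
    intro h
    rw [h] at e1
    have h2 : y ^ 4 + v ^ 4 = 0 := by simpa using e1
    rcases pair_ne_zero_iff hy with h3 | h3
    exacts [h3 h, h3 h2]
  have e3 : (y ^ 2 * v ^ 2) ^ 2 * formA x u = 0 := by
    have : (x ^ 4 + u ^ 4) ^ 2 * (y ^ 4 + v ^ 4) ^ 2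
        = 144 * (x ^ 2 * u ^ 2) ^ 2 * (y ^ 2 * v ^ 2) ^ 2 := by
      rw [← mul_pow, e2]
      ring
    rw [e1] at this
    simp only [formA]
    linear_combination -this / 12
  exact (mul_eq_zero.mp e3).resolve_left (pow_ne_zero 2 hP)

/-! ## Multiplicities -/

theorem card_roots_toFinset_of_simple {P : Polynomial ℂ}
    (h : ∀ t, P.eval t = 0 → P.derivative.eval t ≠ 0) : P.roots.toFinset.card = P.natDegree := by
  have hnodup : P.roots.Nodup := by
    rw [Multiset.nodup_iff_count_le_one]
    intro t
    rw [Polynomial.count_roots]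
    by_contra hlt
    push Not at hlt
    have hP : P ≠ 0 := by
      rintro rfl
      simp at hlt
    obtain ⟨h1, h2⟩ := (Polynomial.one_lt_rootMultiplicity_iff_isRoot hP).mp hlt
    exact h t h1 h2
  rw [Multiset.toFinset_card_of_nodup hnodup]
  exact (Polynomial.splits_iff_card_roots.mp (IsAlgClosed.splits P))

theorem rootMultiplicity_sq {P : Polynomial ℂ} {r : ℂ} (a : ℂ) (ha : a ≠ 0) (h : P.eval r = 0)
    (h' : P.derivative.eval r ≠ 0) :
    (Polynomial.C a * P ^ 2).rootMultiplicity r = 2 := by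
  have hP : P ≠ 0 := by
    rintro rfl
    simp at h'
  have h1 : P.rootMultiplicity r = 1 := by
    apply le_antisymm
    · by_contra hlt
      push Not at hlt
      exact h' ((Polynomial.one_lt_rootMultiplicity_iff_isRoot hP).mp hlt).2
    · exact (Polynomial.rootMultiplicity_pos hP).mpr h
  have h2 : Polynomial.C a * P ^ 2 ≠ 0 := mul_ne_zero (Polynomial.C_ne_zero.mpr ha) (pow_ne_zero 2 hP)
  rw [Polynomial.rootMultiplicity_mul h2, Polynomial.rootMultiplicity_C, pow_two,
    Polynomial.rootMultiplicity_mul (mul_ne_zero hP hP), h1]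

theorem restrictF_eq (a b : Fin 4 → ℂ) : restrictF a b
    = octic (Polynomial.C (a 0) + Polynomial.X * Polynomial.C (b 0))
      (Polynomial.C (a 1) + Polynomial.X * Polynomial.C (b 1))
      (Polynomial.C (a 2) + Polynomial.X * Polynomial.C (b 2))
      (Polynomial.C (a 3) + Polynomial.X * Polynomial.C (b 3)) := by
  rw [restrictF, aeval_F]

theorem restrictF_line (x u y v s t s' t' : ℂ) :
    restrictF ![s * x, s * u, t * y, t * v] ![s' * x, s' * u, t' * y, t' * v]
      = Polynomial.C (formA y v) * (Polynomial.C t + Polynomial.C t' * Polynomial.X) ^ 8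
        + Polynomial.C (formB x u y v) * (Polynomial.C s + Polynomial.C s' * Polynomial.X) ^ 4
          * (Polynomial.C t + Polynomial.C t' * Polynomial.X) ^ 4
        + Polynomial.C (formA x u) * (Polynomial.C s + Polynomial.C s' * Polynomial.X) ^ 8 := by
  have hB : Polynomial.C (formB x u y v)
      = formB (Polynomial.C x) (Polynomial.C u) (Polynomial.C y) (Polynomial.C v) := by
    simp [formB, map_ofNat]
  rw [map_formA, map_formA, hB, ← octic_line, restrictF_eq]
  simp only [Matrix.cons_val, map_mul]
  congr 1 <;> ring

/-! ## The four-tangent lines `l_c` -/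

theorem finrank_line (c : PP 1 × PP 1) : Module.finrank ℂ (line c) = 2 := by
  have h : LinearIndependent ℂ ![basePoint₁ c, basePoint₂ c] := by
    rw [LinearIndependent.pair_iff]
    intro s t h
    have h0 : s * c.1.rep 0 = 0 := by simpa [basePoint₁, basePoint₂] using congrFun h 0
    have h1 : s * c.1.rep 1 = 0 := by simpa [basePoint₁, basePoint₂] using congrFun h 1
    have h2 : t * c.2.rep 0 = 0 := by simpa [basePoint₁, basePoint₂] using congrFun h 2
    have h3 : t * c.2.rep 1 = 0 := by simpa [basePoint₁, basePoint₂] using congrFun h 3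
    constructor
    · rcases exists_rep_ne_zero c.1 with h | h
      exacts [(mul_eq_zero.mp h0).resolve_right h, (mul_eq_zero.mp h1).resolve_right h]
    · rcases exists_rep_ne_zero c.2 with h | h
      exacts [(mul_eq_zero.mp h2).resolve_right h, (mul_eq_zero.mp h3).resolve_right h]
  have h2 := finrank_span_eq_card h
  rw [Matrix.range_cons_cons_empty] at h2
  exact h2

theorem eval_F_line (x u y v s t : ℂ) : eval ![s * x, s * u, t * y, t * v] F
    = formA y v * t ^ 8 + formB x u y v * s ^ 4 * t ^ 4 + formA x u * s ^ 8 := by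
  rw [eval_F, ← octic_line]
  rfl

theorem eq_of_smul_pair_eq {x u s s' : ℂ} (h : ![x, u] ≠ 0) (h0 : s * x = s' * x)
    (h1 : s * u = s' * u) : s = s' := by
  by_contra hne
  apply h
  have hx : x = 0 := by
    have : (s - s') * x = 0 := by rw [sub_mul, h0, sub_self]
    exact (mul_eq_zero.mp this).resolve_left (sub_ne_zero.mpr hne)
  have hu : u = 0 := by
    have : (s - s') * u = 0 := by rw [sub_mul, h1, sub_self]
    exact (mul_eq_zero.mp this).resolve_left (sub_ne_zero.mpr hne)
  simp [hx, hu]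

theorem line_vec_ne_zero {x u y v s t : ℂ} (hx : ![x, u] ≠ 0) (hy : ![y, v] ≠ 0)
    (h : s ≠ 0 ∨ t ≠ 0) : ![s * x, s * u, t * y, t * v] ≠ 0 := by
  intro h0
  have e0 : s * x = 0 := congrFun h0 0
  have e1 : s * u = 0 := congrFun h0 1
  have e2 : t * y = 0 := congrFun h0 2
  have e3 : t * v = 0 := congrFun h0 3
  have hs : s = 0 := eq_of_smul_pair_eq hx (by rw [e0, zero_mul]) (by rw [e1, zero_mul])
  have ht : t = 0 := eq_of_smul_pair_eq hy (by rw [e2, zero_mul]) (by rw [e3, zero_mul])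
  rcases h with h | h
  exacts [h hs, h ht]

/-- With `β = B / (2 A)` the vanishing discriminant means `C = A β²`, so `F = A (t⁴ + β s⁴)²` on the
line. Since `β ≠ 0`, the quartic has four distinct zeros, none with `s = 0`. -/
theorem isFourTangent_line {c : PP 1 × PP 1} {x u y v : ℂ} (h1 : HasCoords c.1 ![x, u])
    (h2 : HasCoords c.2 ![y, v]) (hA : formA y v ≠ 0) (hC : formA x u ≠ 0)
    (hd : formB x u y v ^ 2 = 4 * formA y v * formA x u) : IsFourTangent (line c) := by
  classical
  have hx := h1.ne_zero
  have hy := h2.ne_zero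
  set A := formA y v with hAdef
  obtain ⟨β, hβ⟩ : ∃ β, β = formB x u y v / (2 * A) := ⟨_, rfl⟩
  have hB : formB x u y v = 2 * A * β := by
    rw [hβ]
    field_simp
  have hCβ : formA x u = A * β ^ 2 := by
    have : 4 * A * (formA x u - A * β ^ 2) = 0 := by
      rw [hB] at hd
      linear_combination -hd
    exact sub_eq_zero.mp ((mul_eq_zero.mp this).resolve_left (by simp [hA]))
  have hβ0 : β ≠ 0 := by
    rintro rfl
    exact hC (by rw [hCβ]; ring)
  have hF : ∀ s t : ℂ, eval ![s * x, s * u, t * y, t * v] F = A * (t ^ 4 + β * s ^ 4) ^ 2 := by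
    intro s t
    rw [eval_F_line, hB, hCβ, ← hAdef]
    ring
  refine ⟨finrank_line c, fun h => hA ((liesInS_line_iff h1 h2).mp h).1, ?_⟩
  let P : Polynomial ℂ := Polynomial.X ^ 4 + Polynomial.C β
  have hP : ∀ t, P.eval t = t ^ 4 + β := fun t => by simp [P]
  have hP4 : P.natDegree = 4 := Polynomial.natDegree_X_pow_add_C
  have hP0 : P ≠ 0 := by
    intro h
    rw [h] at hP4
    simp at hP4
  have hcard : P.roots.toFinset.card = 4 := by
    rw [card_roots_toFinset_of_simple, hP4]
    intro t ht h
    rw [hP] at ht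
    have : (3 : ℂ) + 1 = 0 ∨ t = 0 := by simpa [P] using h
    replace this : t = 0 := this.resolve_left (by norm_num)
    rw [this] at ht
    exact hβ0 (by simpa using ht)
  have hpt : ∀ t : ℂ, ∃ p : PP 3, HasCoords p ![1 * x, 1 * u, t * y, t * v] := fun t =>
    exists_point (line_vec_ne_zero hx hy (Or.inl one_ne_zero))
  choose pt hpt using hpt
  have hinj : Function.Injective pt := by
    intro t t' h
    obtain ⟨a, ha, e⟩ := (hpt t).exists_smul (h ▸ hpt t')
    have e0 : 1 * x = a * (1 * x) := congrFun e 0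
    have e1 : 1 * u = a * (1 * u) := congrFun e 1
    have e2 : t' * y = a * (t * y) := congrFun e 2
    have e3 : t' * v = a * (t * v) := congrFun e 3
    have ha1 : 1 = a := eq_of_smul_pair_eq hx (by simpa using e0) (by simpa using e1)
    rw [← ha1, one_mul] at e2 e3
    exact (eq_of_smul_pair_eq hy e2 e3).symm
  have hmem : ∀ p, p ∈ P.roots.toFinset.image pt ↔ p ∈ S ∧ p.submodule ≤ line c := by
    intro p
    rw [Finset.mem_image]
    constructor
    · rintro ⟨t, ht, rfl⟩
      rw [Multiset.mem_toFinset, Polynomial.mem_roots hP0, Polynomial.IsRoot, hP] at ht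
      refine ⟨(mem_S_iff (hpt t)).mpr ?_, (submodule_le_iff (hpt t)).mpr
        ((mem_line_iff h1 h2).mpr ⟨1, t, rfl⟩)⟩
      rw [hF]
      have : t ^ 4 + β * 1 ^ 4 = 0 := by simpa using ht
      rw [this]
      ring
    · rintro ⟨hpS, hpL⟩
      have hp := hasCoords_rep p
      obtain ⟨s, t, e⟩ := (mem_line_iff h1 h2).mp ((submodule_le_iff hp).mp hpL)
      rw [e] at hp
      rw [mem_S_iff hp, hF] at hpS
      have hst : t ^ 4 + β * s ^ 4 = 0 := by simpa [hA] using hpS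
      have hs : s ≠ 0 := by
        rintro rfl
        have ht : t = 0 := by simpa using hst
        apply hp.ne_zero
        simp [ht]
      refine ⟨t / s, ?_, ?_⟩
      · rw [Multiset.mem_toFinset, Polynomial.mem_roots hP0, Polynomial.IsRoot, hP]
        field_simp
        linear_combination hst
      · have := hp.smul (inv_ne_zero hs)
        refine (hpt (t / s)).ext ?_
        convert this using 1
        funext i
        fin_cases i <;> simp <;> field_simp
  refine ⟨P.roots.toFinset.image pt, ?_, hmem, ?_⟩
  · rw [Finset.card_image_of_injective _ hinj, hcard]
  · intro p hp b hb hbp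
    obtain ⟨hpS, hpL⟩ := (hmem p).mp hp
    have hp' := hasCoords_rep p
    obtain ⟨s, t, e⟩ := (mem_line_iff h1 h2).mp ((submodule_le_iff hp').mp hpL)
    obtain ⟨s', t', e'⟩ := (mem_line_iff h1 h2).mp hb
    rw [mem_submodule_iff hp'] at hbp
    rw [e] at hp' hbp ⊢
    rw [mem_S_iff hp', hF] at hpS
    have hst : t ^ 4 + β * s ^ 4 = 0 := by simpa [hA] using hpS
    have hs : s ≠ 0 := by
      rintro rfl
      have ht : t = 0 := by simpa using hst
      apply hp'.ne_zero
      simp [ht]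
    -- The direction `b` is not a multiple of the point `p`, so the parameter `T` moves away from
    -- `p` along the line.
    have hdet : s' * t - s * t' ≠ 0 := by
      intro h
      apply hbp
      refine ⟨s' / s, ?_⟩
      have ht' : t' = s' / s * t := by
        field_simp
        linear_combination -h
      rw [e', ht']
      funext i
      fin_cases i <;> simp <;> field_simp
    rw [e', restrictF_line, hB, hCβ, ← hAdef]
    have : Polynomial.C A * (Polynomial.C t + Polynomial.C t' * Polynomial.X) ^ 8
        + Polynomial.C (2 * A * β) * (Polynomial.C s + Polynomial.C s' * Polynomial.X) ^ 4
          * (Polynomial.C t + Polynomial.C t' * Polynomial.X) ^ 4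
        + Polynomial.C (A * β ^ 2) * (Polynomial.C s + Polynomial.C s' * Polynomial.X) ^ 8
        = Polynomial.C A * ((Polynomial.C t + Polynomial.C t' * Polynomial.X) ^ 4
          + Polynomial.C β * (Polynomial.C s + Polynomial.C s' * Polynomial.X) ^ 4) ^ 2 := by
      simp only [map_mul, map_pow, map_ofNat]
      ring
    rw [this]
    refine rootMultiplicity_sq A hA ?_ ?_
    · simpa using hst
    · have hder : Polynomial.eval 0 (Polynomial.derivative
          ((Polynomial.C t + Polynomial.C t' * Polynomial.X) ^ 4
          + Polynomial.C β * (Polynomial.C s + Polynomial.C s' * Polynomial.X) ^ 4))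
          = 4 * t ^ 3 * t' + β * (4 * s ^ 3 * s') := by
        simp [Polynomial.derivative_pow]
      rw [hder]
      intro h
      -- Elimination of `t⁴` using `t⁴ = -β s⁴`: a vanishing derivative would force the determinant
      -- to vanish.
      have : β * s ^ 3 * (s' * t - s * t') = 0 := by
        linear_combination t * h / 4 - t' * hst
      exact hdet ((mul_eq_zero.mp this).resolve_left (mul_ne_zero hβ0 (pow_ne_zero 3 hs)))

/-- Among four tangency points one has `s, t ≠ 0`. There `t ↦ A t⁸ + B s⁴ t⁴ + C s⁸` and its
derivative vanish, and as `t ≠ 0` the quadratic in `t⁴` has a double root. -/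
theorem discr_eq_zero_of_isFourTangent {c : PP 1 × PP 1} {x u y v : ℂ}
    (h1 : HasCoords c.1 ![x, u]) (h2 : HasCoords c.2 ![y, v]) (h : IsFourTangent (line c)) :
    formB x u y v ^ 2 - 4 * formA y v * formA x u = 0 := by
  classical
  obtain ⟨-, -, T, hT4, hT, hmult⟩ := h
  have hx := h1.ne_zero
  have hy := h2.ne_zero
  obtain ⟨p₁, hp₁⟩ := exists_point (line_vec_ne_zero hx hy (s := 1) (t := 0) (by simp))
  obtain ⟨p₂, hp₂⟩ := exists_point (line_vec_ne_zero hx hy (s := 0) (t := 1) (by simp))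
  obtain ⟨p, hpT, hp⟩ : ∃ p ∈ T, p ∉ ({p₁, p₂} : Finset (PP 3)) := by
    by_contra hcon
    push Not at hcon
    have h3 := Finset.card_le_card (fun p hp => hcon p hp : T ⊆ {p₁, p₂})
    have h4 := Finset.card_le_two (a := p₁) (b := p₂)
    omega
  obtain ⟨hpS, hpL⟩ := (hT p).mp hpT
  have hp' := hasCoords_rep p
  -- The direction `(0 : 0 : y : v)` varies `t` and keeps `s` fixed.
  have hm := hmult p hpT ![0 * x, 0 * u, 1 * y, 1 * v] ((mem_line_iff h1 h2).mpr ⟨0, 1, rfl⟩)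
  obtain ⟨s, t, e⟩ := (mem_line_iff h1 h2).mp ((submodule_le_iff hp').mp hpL)
  rw [mem_submodule_iff hp'] at hm
  rw [e] at hp' hm
  have hs : s ≠ 0 := by
    rintro rfl
    have ht : t ≠ 0 := by
      rintro rfl
      apply hp'.ne_zero
      simp
    apply hp
    have h3 := hp₂.smul ht
    rw [Finset.mem_insert, Finset.mem_singleton]
    right
    refine hp'.ext ?_
    convert h3 using 1
    funext i
    fin_cases i <;> simp
  have ht : t ≠ 0 := by
    rintro rfl
    apply hp
    have h3 := hp₁.smul hs
    rw [Finset.mem_insert, Finset.mem_singleton]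
    left
    refine hp'.ext ?_
    convert h3 using 1
    funext i
    fin_cases i <;> simp
  have hm2 := hm (by
    rintro ⟨r, hr⟩
    have e0 : r * (s * x) = 0 * x := congrFun hr 0
    have e1 : r * (s * u) = 0 * u := congrFun hr 1
    have e2 : r * (t * y) = 1 * y := congrFun hr 2
    have e3 : r * (t * v) = 1 * v := congrFun hr 3
    have h3 : r * s = 0 := eq_of_smul_pair_eq hx (by rw [← e0]; ring) (by rw [← e1]; ring)
    have h4 : r = 0 := (mul_eq_zero.mp h3).resolve_right hs
    have h5 : r * t = 1 := eq_of_smul_pair_eq hy (by rw [← e2]; ring) (by rw [← e3]; ring)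
    rw [h4, zero_mul] at h5
    exact zero_ne_one h5)
  set Q := restrictF ![s * x, s * u, t * y, t * v] ![0 * x, 0 * u, 1 * y, 1 * v] with hQ
  have hQ0 : Q ≠ 0 := by
    intro h
    rw [h] at hm2
    simp at hm2
  obtain ⟨h4, h3⟩ := (Polynomial.one_lt_rootMultiplicity_iff_isRoot hQ0).mp
    (by rw [hm2]; norm_num)
  rw [restrictF_line] at hQ
  have h5 : formA y v * t ^ 8 + formB x u y v * s ^ 4 * t ^ 4 + formA x u * s ^ 8 = 0 := by
    rw [Polynomial.IsRoot, hQ] at h4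
    simpa using h4
  have h6 : formA y v * (8 * t ^ 7) + formB x u y v * s ^ 4 * (4 * t ^ 3) = 0 := by
    rw [Polynomial.IsRoot, hQ] at h3
    simpa [Polynomial.derivative_pow] using h3
  have h7 : 2 * formA y v * t ^ 4 + formB x u y v * s ^ 4 = 0 := by
    have : 4 * t ^ 3 * (2 * formA y v * t ^ 4 + formB x u y v * s ^ 4) = 0 := by
      linear_combination h6
    exact (mul_eq_zero.mp this).resolve_left (by simp [ht])
  have h8 : s ^ 8 * (formB x u y v ^ 2 - 4 * formA y v * formA x u) = 0 := by
    linear_combination (2 * formA y v * t ^ 4 + formB x u y v * s ^ 4) * h7 - 4 * formA y v * h5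
  exact (mul_eq_zero.mp h8).resolve_left (pow_ne_zero 8 hs)

theorem formB_comm (x u y v : ℂ) : formB x u y v = formB y v x u := by
  simp only [formB]
  ring

theorem isFourTangent_or_liesInS_iff (c : PP 1 × PP 1) :
    IsFourTangent (line c) ∨ LiesInS (line c) ↔ c ∈ CPlus ∪ CMinus := by
  obtain ⟨x, u, h1⟩ := exists_hasCoords_pair c.1
  obtain ⟨y, v, h2⟩ := exists_hasCoords_pair c.2
  have hmem : c ∈ CPlus ∪ CMinus ↔ formB x u y v ^ 2 - 4 * formA y v * formA x u = 0 := by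
    rw [Set.mem_union, mem_CPlus_iff h1 h2, mem_CMinus_iff h1 h2, formDiscr_eq]
    simp
  rw [hmem]
  constructor
  · rintro (h | h)
    · exact discr_eq_zero_of_isFourTangent h1 h2 h
    · obtain ⟨hA, hB, -⟩ := (liesInS_line_iff h1 h2).mp h
      rw [hA, hB]
      ring
  · intro h
    rw [liesInS_line_iff h1 h2]
    -- With zero discriminant, `A = 0` or `C = 0` forces `B = 0`, and then the remaining coefficient
    -- vanishes too: the line lies in `S`.
    by_cases hA : formA y v = 0
    · right
      have hB : formB x u y v = 0 := by
        rw [hA] at h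
        simpa using h
      exact ⟨hA, hB, formA_eq_zero_of_formA_of_formB h2.ne_zero hA hB⟩
    by_cases hC : formA x u = 0
    · right
      have hB : formB x u y v = 0 := by
        rw [hC] at h
        simpa using h
      exact ⟨formA_eq_zero_of_formA_of_formB h1.ne_zero hC (formB_comm x u y v ▸ hB), hB, hC⟩
    · left
      exact isFourTangent_line h1 h2 hA hC (sub_eq_zero.mp h)

/-! ## Sections over lines -/

theorem eval_smul_of_isHomogeneous {n d : ℕ} {H : MvPolynomial (Fin n) ℂ} (hH : H.IsHomogeneous d)
    (a : ℂ) (v : Fin n → ℂ) : eval (a • v) H = a ^ d * eval v H := by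
  rw [eval_eq', eval_eq', Finset.mul_sum]
  refine Finset.sum_congr rfl fun m hm => ?_
  have h : ∑ i, m i = d := by
    rw [← hH (mem_support_iff.mp hm), Finsupp.weight_apply, Finsupp.sum_fintype _ _ (by simp)]
    simp
  simp only [Pi.smul_apply, smul_eq_mul, mul_pow, Finset.prod_mul_distrib]
  rw [Finset.prod_pow_eq_pow_sum, h]
  ring

/-- The image of the section `x ↦ (x, Q(x))` over a line. -/
def sectionCurve (Q : MvPolynomial (Fin 4) ℂ) (L : Submodule ℂ (Fin 4 → ℂ)) : Set (WP 4) :=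
  {P | ∃ x ∈ L, x ≠ 0 ∧ P.HasCoords x (eval x Q)}

theorem mem_sectionCurve_iff {Q : MvPolynomial (Fin 4) ℂ} (hQ : Q.IsHomogeneous 4)
    {L : Submodule ℂ (Fin 4 → ℂ)} {P : WP 4} {x : Fin 4 → ℂ} {W : ℂ} (hP : P.HasCoords x W) :
    P ∈ sectionCurve Q L ↔ x ∈ L ∧ x ≠ 0 ∧ W = eval x Q := by
  constructor
  · rintro ⟨x', hx', h0, h⟩
    obtain ⟨a, ha, rfl, rfl⟩ := h.exists_smul hP
    exact ⟨L.smul_mem a hx', smul_ne_zero ha h0, (eval_smul_of_isHomogeneous hQ a x').symm⟩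
  · rintro ⟨h1, h2, rfl⟩
    exact ⟨x, h1, h2, hP⟩

theorem mem_doubleOctic_iff {P : WP 4} {x : Fin 4 → ℂ} {W : ℂ} (hP : P.HasCoords x W) :
    P ∈ DoubleOctic ↔ W ^ 2 = eval x F := by
  constructor
  · rintro ⟨x', W', h, h'⟩
    obtain ⟨a, ha, rfl, rfl⟩ := h.exists_smul hP
    rw [eval_F_smul, ← h']
    ring
  · exact fun h => ⟨x, W, hP, h⟩

theorem mem_preimage_iff {L : Submodule ℂ (Fin 4 → ℂ)} {P : WP 4} {x : Fin 4 → ℂ} {W : ℂ}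
    (hP : P.HasCoords x W) : P ∈ preimage L ↔ W ^ 2 = eval x F ∧ x ∈ L := by
  rw [preimage, Set.mem_ofPred_eq, mem_doubleOctic_iff hP]
  refine and_congr_right fun _ => ⟨?_, fun h => ⟨x, h, W, hP⟩⟩
  rintro ⟨x', hx', W', h⟩
  obtain ⟨a, ha, rfl, -⟩ := h.exists_smul hP
  exact L.smul_mem a hx'

theorem ne_zero_of_sq_eq {P : WP 4} {x : Fin 4 → ℂ} {W : ℂ} (hP : P.HasCoords x W)
    (h : W ^ 2 = eval x F) : x ≠ 0 := by
  rintro rfl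
  obtain ⟨h0, -⟩ := hP
  apply h0
  rw [eval_F] at h
  have : W = 0 := by simpa [octic] using h
  rw [this]
  rfl

theorem exists_independent {L : Submodule ℂ (Fin 4 → ℂ)} (hL : Module.finrank ℂ L = 2)
    {b : Fin 4 → ℂ} (hb : b ∈ L) (hb0 : b ≠ 0) :
    ∃ a ∈ L, LinearIndependent ℂ ![a, b] ∧ ∀ z ∈ L, ∃ s t : ℂ, z = s • a + t • b := by
  obtain ⟨a, haL, ha⟩ : ∃ a ∈ L, a ∉ Submodule.span ℂ {b} := by
    by_contra hcon
    push Not at hcon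
    have h1 := Submodule.finrank_mono (show L ≤ Submodule.span ℂ {b} from hcon)
    rw [hL, finrank_span_singleton hb0] at h1
    omega
  have hind : LinearIndependent ℂ ![a, b] := by
    rw [LinearIndependent.pair_iff]
    intro s t h
    have hs : s = 0 := by
      by_contra hs
      apply ha
      rw [Submodule.mem_span_singleton]
      refine ⟨-(s⁻¹ * t), ?_⟩
      have : s⁻¹ • (s • a + t • b) = 0 := by rw [h, smul_zero]
      rw [smul_add, smul_smul, inv_mul_cancel₀ hs, one_smul, smul_smul] at this
      rw [neg_smul]
      exact (eq_neg_of_add_eq_zero_left this).symm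
    subst hs
    rw [zero_smul, zero_add] at h
    exact ⟨rfl, (smul_eq_zero.mp h).resolve_right hb0⟩
  refine ⟨a, haL, hind, ?_⟩
  have hle : Submodule.span ℂ {a, b} ≤ L := by
    rw [Submodule.span_le]
    rintro z (rfl | rfl)
    exacts [haL, hb]
  have h2 := finrank_span_eq_card hind
  rw [Matrix.range_cons_cons_empty] at h2
  have heq := Submodule.eq_of_le_of_finrank_eq hle (by rw [h2, hL]; rfl)
  intro z hz
  rw [← heq, Submodule.mem_span_pair] at hz
  obtain ⟨s, t, rfl⟩ := hz
  exact ⟨s, t, rfl⟩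

theorem exists_linear_form (f : (Fin 4 → ℂ) →ₗ[ℂ] ℂ) :
    ∃ H : MvPolynomial (Fin 4) ℂ, H.IsHomogeneous 1 ∧ ∀ v, eval v H = f v := by
  refine ⟨∑ i, C (f (Pi.single i 1)) * X i, ?_, fun v => ?_⟩
  · refine IsHomogeneous.sum _ _ _ fun i _ => ?_
    simpa using (isHomogeneous_C _ (f (Pi.single i 1))).mul (isHomogeneous_X ℂ i)
  · rw [map_sum, LinearMap.pi_apply_eq_sum_univ f v]
    refine Finset.sum_congr rfl fun i _ => ?_
    rw [map_mul, eval_C, eval_X, smul_eq_mul, mul_comm]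
    congr 2
    funext j
    simp [Pi.single_apply, eq_comm]

/-- Linear forms on the whole space that give the parameters on the line. They allow any binary form
in `s, t` to be written as a form in four variables. -/
theorem exists_dual_forms {a b : Fin 4 → ℂ} (h : LinearIndependent ℂ ![a, b]) :
    ∃ α β : MvPolynomial (Fin 4) ℂ, α.IsHomogeneous 1 ∧ β.IsHomogeneous 1 ∧
      ∀ s t : ℂ, eval (s • a + t • b) α = s ∧ eval (s • a + t • b) β = t := by
  obtain ⟨g, hg⟩ := LinearMap.exists_leftInverse_of_injective
    (Fintype.linearCombination ℂ ![a, b]) (LinearMap.ker_eq_bot.mpr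
      (linearIndependent_iff_injective_fintypeLinearCombination.mp h))
  have hg' : ∀ s t : ℂ, g (s • a + t • b) = ![s, t] := by
    intro s t
    have := LinearMap.congr_fun hg ![s, t]
    simpa [Fintype.linearCombination_apply] using this
  obtain ⟨α, h1, h2⟩ := exists_linear_form (LinearMap.proj 0 ∘ₗ g)
  obtain ⟨β, h3, h4⟩ := exists_linear_form (LinearMap.proj 1 ∘ₗ g)
  refine ⟨α, β, h1, h3, fun s t => ⟨?_, ?_⟩⟩
  · rw [h2, LinearMap.comp_apply, hg']
    rfl
  · rw [h4, LinearMap.comp_apply, hg']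
    rfl

theorem exists_ne_zero_of_finrank {L : Submodule ℂ (Fin 4 → ℂ)} (hL : Module.finrank ℂ L = 2) :
    ∃ b ∈ L, b ≠ 0 := by
  refine L.exists_mem_ne_zero_of_ne_bot ?_
  rintro rfl
  simp at hL

theorem isRationalCurve_sectionCurve {Q : MvPolynomial (Fin 4) ℂ} (hQ : Q.IsHomogeneous 4)
    {L : Submodule ℂ (Fin 4 → ℂ)} (hL : Module.finrank ℂ L = 2) :
    IsRationalCurve (sectionCurve Q L) := by
  obtain ⟨b, hb, hb0⟩ := exists_ne_zero_of_finrank hL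
  obtain ⟨a, ha, hind, hspan⟩ := exists_independent hL hb hb0
  let φ : Fin 4 → MvPolynomial (Fin 2) ℂ := fun i => C (a i) * X 0 + C (b i) * X 1
  have hφ : ∀ z : Fin 2 → ℂ, (fun i => eval z (φ i)) = z 0 • a + z 1 • b := by
    intro z
    funext i
    simp [φ, mul_comm]
  have hhom : ∀ i, (φ i).IsHomogeneous 1 := by
    intro i
    refine IsHomogeneous.add ?_ ?_
    · simpa using (isHomogeneous_C _ (a i)).mul (isHomogeneous_X ℂ (0 : Fin 2))
    · simpa using (isHomogeneous_C _ (b i)).mul (isHomogeneous_X ℂ (1 : Fin 2))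
  have hψ : ∀ z : Fin 2 → ℂ, eval z (aeval φ Q) = eval (z 0 • a + z 1 • b) Q := by
    intro z
    rw [← hφ]
    change aeval z (aeval φ Q) = aeval _ Q
    rw [← AlgHom.comp_apply, comp_aeval]
    rfl
  have hne : ∀ z : Fin 2 → ℂ, z ≠ 0 → z 0 • a + z 1 • b ≠ 0 := by
    intro z hz h
    obtain ⟨h0, h1⟩ := LinearIndependent.pair_iff.mp hind _ _ h
    apply hz
    funext i
    fin_cases i
    exacts [h0, h1]
  refine ⟨1, φ, aeval φ Q, one_pos, hhom, ?_, ?_, ?_⟩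
  · simpa using hQ.aeval φ hhom
  · intro z hz
    by_contra hcon
    push Not at hcon
    apply hne z hz
    rw [← hφ]
    funext i
    exact hcon i
  · ext P
    simp only [Set.mem_ofPred_eq, hφ, hψ]
    constructor
    · rintro ⟨x, hx, hx0, hP⟩
      obtain ⟨s, t, rfl⟩ := hspan x hx
      refine ⟨![s, t], ?_, hP⟩
      intro h
      apply hx0
      have h0 : s = 0 := congrFun h 0
      have h1 : t = 0 := congrFun h 1
      rw [h0, h1, zero_smul, zero_smul, add_zero]
    · rintro ⟨z, hz, hP⟩
      exact ⟨_, L.add_mem (L.smul_mem _ ha) (L.smul_mem _ hb), hne z hz, hP⟩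

theorem mapsIsomorphicallyTo_sectionCurve {Q : MvPolynomial (Fin 4) ℂ} (hQ : Q.IsHomogeneous 4)
    (L : Submodule ℂ (Fin 4 → ℂ)) : MapsIsomorphicallyTo (sectionCurve Q L) L :=
  ⟨Q, hQ, rfl⟩

/-! ## The inverse images of four-tangent lines -/

/-- Over `ℂ` the polynomial splits, and both the linear factors and the leading coefficient form
squares. -/
theorem exists_eq_sq_of_rootMultiplicity {P : Polynomial ℂ}
    (h : ∀ r, P.eval r = 0 → P.rootMultiplicity r = 2) : ∃ R : Polynomial ℂ, P = R ^ 2 := by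
  classical
  have hroots : P.roots = 2 • P.roots.dedup := by
    ext r
    rw [Multiset.count_nsmul, Multiset.count_dedup, Polynomial.count_roots]
    by_cases hP : P = 0
    · simp [hP]
    split_ifs with hr
    · rw [h r ((Polynomial.mem_roots hP).mp hr)]
    · rw [Polynomial.mem_roots hP] at hr
      rw [Polynomial.rootMultiplicity_eq_zero hr]
  obtain ⟨l, hl⟩ := IsAlgClosed.exists_pow_nat_eq P.leadingCoeff (n := 2) (by norm_num)
  refine ⟨Polynomial.C l * (P.roots.dedup.map fun a => Polynomial.X - Polynomial.C a).prod, ?_⟩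
  have h1 := (IsAlgClosed.splits P).eq_prod_roots
  rw [hroots, Multiset.map_nsmul, Multiset.prod_nsmul, ← hl] at h1
  rw [mul_pow, ← map_pow]
  exact h1

theorem eval_restrictF (a b : Fin 4 → ℂ) (t : ℂ) :
    (restrictF a b).eval t = eval (a + t • b) F := by
  rw [restrictF_eq, eval_F]
  simp [octic]
  simp only [mul_comm t]

theorem natDegree_restrictF_le (a b : Fin 4 → ℂ) : (restrictF a b).natDegree ≤ 8 := by
  rw [restrictF_eq]
  unfold octic
  compute_degree

/-- If `F` is a square on the points `a + t b` then it is the square of a quartic form on the line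
through `a` and `b`. -/
theorem exists_form_of_restrictF_eq_sq {a b : Fin 4 → ℂ} (hind : LinearIndependent ℂ ![a, b])
    {R : Polynomial ℂ} (hR : restrictF a b = R ^ 2) :
    ∃ Q : MvPolynomial (Fin 4) ℂ, Q.IsHomogeneous 4 ∧
      ∀ s t : ℂ, eval (s • a + t • b) Q ^ 2 = eval (s • a + t • b) F := by
  obtain ⟨α, β, hα, hβ, hαβ⟩ := exists_dual_forms hind
  have hdeg : R.natDegree < 5 := by
    have h1 := natDegree_restrictF_le a b
    rw [hR, Polynomial.natDegree_pow] at h1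
    omega
  let Q : MvPolynomial (Fin 4) ℂ :=
    ∑ i ∈ Finset.range 5, C (R.coeff i) * β ^ i * α ^ (4 - i)
  have hQ : ∀ s t : ℂ, eval (s • a + t • b) Q
      = ∑ i ∈ Finset.range 5, R.coeff i * t ^ i * s ^ (4 - i) := by
    intro s t
    simp only [Q, map_sum, map_mul, map_pow, eval_C, (hαβ s t).1, (hαβ s t).2]
  refine ⟨Q, ?_, fun s t => ?_⟩
  · refine IsHomogeneous.sum _ _ _ fun i hi => ?_
    have hi' : i < 5 := Finset.mem_range.mp hi
    have := ((isHomogeneous_C (Fin 4) (R.coeff i)).mul (hβ.pow i)).mul (hα.pow (4 - i))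
    convert this using 1
    omega
  · have key : ∀ s t : ℂ, s ≠ 0 → (∑ i ∈ Finset.range 5, R.coeff i * t ^ i * s ^ (4 - i)) ^ 2
        = eval (s • a + t • b) F := by
      intro s t hs
      have h1 : s • a + t • b = s • (a + (t / s) • b) := by
        rw [smul_add, smul_smul, mul_div_cancel₀ _ hs]
      rw [h1, eval_F_smul, ← eval_restrictF, hR, Polynomial.eval_pow,
        Polynomial.eval_eq_sum_range' hdeg]
      have h2 : ∀ i ∈ Finset.range 5, R.coeff i * t ^ i * s ^ (4 - i)
          = s ^ 4 * (R.coeff i * (t / s) ^ i) := by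
        intro i hi
        have h3 : s ^ 4 = s ^ i * s ^ (4 - i) := by
          rw [← pow_add]
          congr 1
          have := Finset.mem_range.mp hi
          omega
        rw [h3, div_pow]
        field_simp
      rw [Finset.sum_congr rfl h2, ← Finset.mul_sum]
      ring
    rw [hQ]
    let P : Polynomial ℂ :=
      (∑ i ∈ Finset.range 5, Polynomial.C (R.coeff i * t ^ i) * Polynomial.X ^ (4 - i)) ^ 2
    have hP : ∀ s, P.eval s = (∑ i ∈ Finset.range 5, R.coeff i * t ^ i * s ^ (4 - i)) ^ 2 := by
      intro s
      simp [P, Polynomial.eval_finsetSum]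
    -- For `s ≠ 0` the identity follows from homogeneity by division by `s`. Both sides are
    -- polynomials in `s`, so it extends to `s = 0`, the point `b`.
    have heq : P = restrictF (t • b) a := by
      refine Polynomial.eq_of_infinite_eval_eq _ _
        ((Set.finite_singleton (0 : ℂ)).infinite_compl.mono fun s hs => ?_)
      rw [Set.mem_ofPred_eq, hP, key s t hs, eval_restrictF, add_comm]
    rw [← hP, heq, eval_restrictF, add_comm]

/-- On a four-tangent line `F` is the square of a quartic form. -/
theorem exists_form_of_isFourTangent {L : Submodule ℂ (Fin 4 → ℂ)} (h : IsFourTangent L) :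
    ∃ Q : MvPolynomial (Fin 4) ℂ, Q.IsHomogeneous 4 ∧ ∀ x ∈ L, eval x Q ^ 2 = eval x F := by
  obtain ⟨hL, hS, T, -, hT, hmult⟩ := h
  rw [liesInS_iff] at hS
  push Not at hS
  obtain ⟨b, hb, hbF⟩ := hS
  have hb0 : b ≠ 0 := by
    rintro rfl
    apply hbF
    rw [eval_F]
    simp [octic]
  obtain ⟨a, ha, hind, hspan⟩ := exists_independent hL hb hb0
  obtain ⟨R, hR⟩ := exists_eq_sq_of_rootMultiplicity (P := restrictF a b) fun r hr => by
    rw [eval_restrictF] at hr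
    have hne : a + r • b ≠ 0 := by
      intro h0
      have := LinearIndependent.pair_iff.mp hind 1 r (by rw [one_smul, h0])
      exact one_ne_zero this.1
    obtain ⟨p, hp⟩ := exists_point hne
    have hpT : p ∈ T := (hT p).mpr ⟨(mem_S_iff hp).mpr hr,
      (submodule_le_iff hp).mpr (L.add_mem ha (L.smul_mem r hb))⟩
    obtain ⟨l, hl, e⟩ := hp.exists_smul (hasCoords_rep p)
    have h1 := hmult p hpT (l • b) (L.smul_mem l hb) (by
      rw [mem_submodule_iff hp]
      rintro ⟨k, hk⟩
      have h2 : k • a + (k * r - l) • b = 0 := by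
        rw [sub_smul, mul_smul, ← add_sub_assoc, ← smul_add, hk, sub_self]
      obtain ⟨h3, h4⟩ := LinearIndependent.pair_iff.mp hind _ _ h2
      rw [h3, zero_mul, zero_sub, neg_eq_zero] at h4
      exact hl h4)
    -- The representative of `p` is `l (a + r b)`; expanding there in the direction `l b` is the
    -- shift `T ↦ T + r`, up to the factor `l⁸`. Multiplicity at `0` becomes multiplicity at `r`.
    have h2 : restrictF p.rep (l • b)
        = Polynomial.C (l ^ 8) * (restrictF a b).comp (Polynomial.X + Polynomial.C r) := by
      refine Polynomial.funext fun t => ?_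
      rw [eval_restrictF, Polynomial.eval_mul, Polynomial.eval_C, Polynomial.eval_comp,
        eval_restrictF, e, smul_comm t l b, ← smul_add, eval_F_smul]
      refine congrArg (fun v => l ^ 8 * eval v F) ?_
      simp only [Polynomial.eval_add, Polynomial.eval_X, Polynomial.eval_C]
      module
    rw [h2] at h1
    rw [Polynomial.rootMultiplicity_eq_rootMultiplicity, ← h1]
    have h3 : Polynomial.C (l ^ 8) * (restrictF a b).comp (Polynomial.X + Polynomial.C r) ≠ 0 := by
      intro h0
      rw [h0] at h1
      simp at h1
    rw [Polynomial.rootMultiplicity_mul h3, Polynomial.rootMultiplicity_C, zero_add]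
  obtain ⟨Q, hQ, h2⟩ := exists_form_of_restrictF_eq_sq hind hR
  refine ⟨Q, hQ, fun x hx => ?_⟩
  obtain ⟨s, t, rfl⟩ := hspan x hx
  exact h2 s t

/-- The two curves are `W = Q` and `W = -Q`. They differ over any point of the line outside `S`. -/
theorem preimage_isFourTangent {L : Submodule ℂ (Fin 4 → ℂ)} (h : IsFourTangent L) :
    ∃ Z₁ Z₂ : Set (WP 4), Z₁ ≠ Z₂ ∧ preimage L = Z₁ ∪ Z₂ ∧
      IsRationalCurve Z₁ ∧ IsRationalCurve Z₂ ∧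
      MapsIsomorphicallyTo Z₁ L ∧ MapsIsomorphicallyTo Z₂ L := by
  obtain ⟨Q, hQ, hsq⟩ := exists_form_of_isFourTangent h
  have hQ' : (-Q).IsHomogeneous 4 := hQ.neg
  refine ⟨sectionCurve Q L, sectionCurve (-Q) L, ?_, ?_, isRationalCurve_sectionCurve hQ h.1,
    isRationalCurve_sectionCurve hQ' h.1, mapsIsomorphicallyTo_sectionCurve hQ L,
    mapsIsomorphicallyTo_sectionCurve hQ' L⟩
  · intro heq
    have hS := h.2.1
    rw [liesInS_iff] at hS
    push Not at hS
    obtain ⟨b, hb, hbF⟩ := hS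
    have hb0 : b ≠ 0 := by
      rintro rfl
      apply hbF
      rw [eval_F]
      simp [octic]
    obtain ⟨P, hP⟩ := WP.exists_of_ne_zero hb0 (eval b Q)
    have h1 : P ∈ sectionCurve Q L := ⟨b, hb, hb0, hP⟩
    rw [heq, mem_sectionCurve_iff hQ' hP, map_neg] at h1
    have h2 : eval b Q = 0 := self_eq_neg.mp h1.2.2
    apply hbF
    rw [← hsq b hb, h2]
    ring
  · ext P
    obtain ⟨x, W, hP⟩ := P.exists_hasCoords
    rw [mem_preimage_iff hP, Set.mem_union, mem_sectionCurve_iff hQ hP,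
      mem_sectionCurve_iff hQ' hP, map_neg]
    constructor
    · rintro ⟨h1, h2⟩
      have h0 := ne_zero_of_sq_eq hP h1
      rw [← hsq x h2] at h1
      rcases sq_eq_sq_iff_eq_or_eq_neg.mp h1 with h3 | h3
      · exact Or.inl ⟨h2, h0, h3⟩
      · exact Or.inr ⟨h2, h0, h3⟩
    · rintro (⟨h1, -, rfl⟩ | ⟨h1, -, rfl⟩)
      · exact ⟨hsq x h1, h1⟩
      · exact ⟨by rw [neg_sq]; exact hsq x h1, h1⟩

/-! ## The rational curves over the lines `l_c` -/

theorem mem_liftedLine_iff {q : PP 1 × WP 2} {x u y v w : ℂ} (h1 : HasCoords q.1 ![x, u])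
    (h2 : q.2.HasCoords ![y, v] w) {P : WP 4} {z : Fin 4 → ℂ} {W : ℂ} (hP : P.HasCoords z W) :
    P ∈ liftedLine q ↔ W ^ 2 = eval z F ∧ ∃ s t : ℂ, z = ![s * x, s * u, t * y, t * v] ∧
      2 * w * W = 2 * formA y v * t ^ 4 + formB x u y v * s ^ 4 := by
  constructor
  · rintro ⟨hX, x', u', y', v', w', s', t', W', h1', h2', hP', h⟩
    refine ⟨(mem_doubleOctic_iff hP).mp hX, ?_⟩
    obtain ⟨l, hl, e1⟩ := h1'.exists_smul h1
    obtain ⟨m, hm, e2, rfl⟩ := h2'.exists_smul h2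
    obtain ⟨r, hr, rfl, rfl⟩ := hP'.exists_smul hP
    have ex : x = l * x' := congrFun e1 0
    have eu : u = l * u' := congrFun e1 1
    have ey : y = m * y' := congrFun e2 0
    have ev : v = m * v' := congrFun e2 1
    refine ⟨r * s' / l, r * t' / m, ?_, ?_⟩
    · rw [ex, eu, ey, ev]
      funext i
      fin_cases i <;> simp <;> field_simp
    · have hB : formB x u y v = l ^ 4 * m ^ 4 * formB x' u' y' v' := by
        rw [ex, eu, ey, ev]
        simp only [formB]
        ring
      rw [hB, ey, ev, formA_smul]
      field_simp
      linear_combination h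
  · rintro ⟨h3, s, t, rfl, h4⟩
    exact ⟨(mem_doubleOctic_iff hP).mpr h3, x, u, y, v, w, s, t, W, h1, h2, hP, h4⟩

/-- The first identity completes the square in `4 A F` using `B² = 4 A C`. If `w = 0`, then `A = B =
C = 0` and the line lies in `S`. -/
theorem sq_eq_of_formGPlus {x u y v w : ℂ} (hy : ![y, v] ≠ 0) (hG : formGPlus x u y v = 0)
    (hw : w ^ 2 = formA y v) (s t : ℂ) :
    (2 * formA y v * t ^ 4 + formB x u y v * s ^ 4) ^ 2
      = (2 * w) ^ 2 * eval ![s * x, s * u, t * y, t * v] F ∧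
    (w = 0 → 2 * formA y v * t ^ 4 + formB x u y v * s ^ 4 = 0 ∧
      eval ![s * x, s * u, t * y, t * v] F = 0) := by
  have hd : formB x u y v ^ 2 = 4 * formA y v * formA x u := by
    have := formDiscr_eq x u y v
    rw [hG] at this
    linear_combination this
  rw [eval_F_line]
  constructor
  · rw [mul_pow, hw]
    linear_combination s ^ 8 * hd
  · rintro rfl
    have hA : formA y v = 0 := by rw [← hw]; ring
    have hB : formB x u y v = 0 := by
      rw [hA] at hd
      simpa using hd
    rw [hA, hB, formA_eq_zero_of_formA_of_formB hy hA hB]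
    simp

theorem linearIndependent_basePoints {x u y v : ℂ} (hx : ![x, u] ≠ 0) (hy : ![y, v] ≠ 0) :
    LinearIndependent ℂ ![![x, u, 0, 0], ![0, 0, y, v]] := by
  rw [LinearIndependent.pair_iff]
  intro s t h
  have h0 : s * x = 0 := by simpa using congrFun h 0
  have h1 : s * u = 0 := by simpa using congrFun h 1
  have h2 : t * y = 0 := by simpa using congrFun h 2
  have h3 : t * v = 0 := by simpa using congrFun h 3
  exact ⟨eq_of_smul_pair_eq hx (by rw [h0, zero_mul]) (by rw [h1, zero_mul]),
    eq_of_smul_pair_eq hy (by rw [h2, zero_mul]) (by rw [h3, zero_mul])⟩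

/-- For `w ≠ 0` solve the equation for `W`. For `w = 0` the convention `0⁻¹ = 0` makes `Q` zero,
which is right: the line lies in `S` and `W² = F` leaves only `W = 0`. -/
theorem exists_form_liftedLine {c : PP 1 × PP 1} {q : PP 1 × WP 2} {x u y v w : ℂ}
    (hx : HasCoords c.1 ![x, u]) (hy : HasCoords c.2 ![y, v]) (hG : formGPlus x u y v = 0)
    (hq1 : q.1 = c.1) (hq2 : q.2.HasCoords ![y, v] w) (hw : w ^ 2 = formA y v) :
    ∃ Q : MvPolynomial (Fin 4) ℂ, Q.IsHomogeneous 4 ∧ liftedLine q = sectionCurve Q (line c) ∧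
      ∀ s t : ℂ, eval ![s * x, s * u, t * y, t * v] Q
        = (2 * w)⁻¹ * (2 * formA y v * t ^ 4 + formB x u y v * s ^ 4) := by
  obtain ⟨α, β, hα, hβ, hαβ⟩ :=
    exists_dual_forms (linearIndependent_basePoints hx.ne_zero hy.ne_zero)
  have hvec : ∀ s t : ℂ, s • ![x, u, 0, 0] + t • ![0, 0, y, v] = ![s * x, s * u, t * y, t * v] := by
    intro s t
    funext i
    fin_cases i <;> simp
  let Q : MvPolynomial (Fin 4) ℂ :=
    C ((2 * w)⁻¹ * (2 * formA y v)) * β ^ 4 + C ((2 * w)⁻¹ * formB x u y v) * α ^ 4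
  have hQ : Q.IsHomogeneous 4 := by
    have h1 := (isHomogeneous_C (Fin 4) ((2 * w)⁻¹ * (2 * formA y v))).mul (hβ.pow 4)
    have h2 := (isHomogeneous_C (Fin 4) ((2 * w)⁻¹ * formB x u y v)).mul (hα.pow 4)
    exact IsHomogeneous.add (by simpa using h1) (by simpa using h2)
  have hQv : ∀ s t : ℂ, eval ![s * x, s * u, t * y, t * v] Q
      = (2 * w)⁻¹ * (2 * formA y v * t ^ 4 + formB x u y v * s ^ 4) := by
    intro s t
    rw [← hvec]
    simp only [Q, map_add, map_mul, map_pow, eval_C, (hαβ s t).1, (hαβ s t).2]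
    ring
  refine ⟨Q, hQ, ?_, hQv⟩
  ext P
  obtain ⟨z, W, hP⟩ := P.exists_hasCoords
  rw [mem_liftedLine_iff (hq1 ▸ hx) hq2 hP, mem_sectionCurve_iff hQ hP, mem_line_iff hx hy]
  constructor
  · rintro ⟨h1, s, t, rfl, h2⟩
    refine ⟨⟨s, t, rfl⟩, ne_zero_of_sq_eq hP h1, ?_⟩
    rw [hQv]
    by_cases hw0 : w = 0
    · rw [((sq_eq_of_formGPlus hy.ne_zero hG hw s t).2 hw0).2] at h1
      rw [((sq_eq_of_formGPlus hy.ne_zero hG hw s t).2 hw0).1, mul_zero]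
      simpa using h1
    · rw [← h2]
      field_simp
  · rintro ⟨⟨s, t, rfl⟩, -, rfl⟩
    rw [hQv]
    obtain ⟨h1, h2⟩ := sq_eq_of_formGPlus hy.ne_zero hG hw s t
    by_cases hw0 : w = 0
    · rw [(h2 hw0).1, (h2 hw0).2]
      refine ⟨by simp, s, t, rfl, ?_⟩
      rw [(h2 hw0).1]
      simp
    · refine ⟨?_, s, t, rfl, ?_⟩
      · rw [mul_pow, h1]
        field_simp
      · field_simp

theorem exists_section_of_mem_coverFiber {c : PP 1 × PP 1} (hc : c ∈ CPlus) {q : PP 1 × WP 2}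
    (hq : q ∈ coverFiber c) :
    ∃ Q : MvPolynomial (Fin 4) ℂ, Q.IsHomogeneous 4 ∧ liftedLine q = sectionCurve Q (line c) := by
  obtain ⟨x, u, hx⟩ := exists_hasCoords_pair c.1
  obtain ⟨y, v, hy⟩ := exists_hasCoords_pair c.2
  obtain ⟨h1, w, h2, h3⟩ := (mem_coverFiber_iff hy).mp hq
  obtain ⟨Q, hQ, h4, -⟩ := exists_form_liftedLine hx hy ((mem_CPlus_iff hx hy).mp hc) h1 h2 h3
  exact ⟨Q, hQ, h4⟩

theorem isRationalCurve_liftedLine {q : PP 1 × WP 2} (hq : q ∈ CTilde) :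
    IsRationalCurve (liftedLine q) := by
  obtain ⟨c, hc, hqc⟩ := hq
  obtain ⟨Q, hQ, h⟩ := exists_section_of_mem_coverFiber hc hqc
  rw [h]
  exact isRationalCurve_sectionCurve hQ (finrank_line c)

theorem mapsIsomorphicallyTo_liftedLine {c : PP 1 × PP 1} (hc : c ∈ CPlus) {q : PP 1 × WP 2}
    (hq : q ∈ coverFiber c) : MapsIsomorphicallyTo (liftedLine q) (line c) := by
  obtain ⟨Q, hQ, h⟩ := exists_section_of_mem_coverFiber hc hq
  rw [h]
  exact mapsIsomorphicallyTo_sectionCurve hQ _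

theorem preimage_line {c : PP 1 × PP 1} (hc : c ∈ CPlus) :
    preimage (line c) = ⋃ q ∈ coverFiber c, liftedLine q := by
  obtain ⟨x, u, hx⟩ := exists_hasCoords_pair c.1
  obtain ⟨y, v, hy⟩ := exists_hasCoords_pair c.2
  have hG := (mem_CPlus_iff hx hy).mp hc
  ext P
  obtain ⟨z, W, hP⟩ := P.exists_hasCoords
  simp only [Set.mem_iUnion, exists_prop]
  rw [mem_preimage_iff hP, mem_line_iff hx hy]
  constructor
  · rintro ⟨h1, s, t, rfl⟩
    obtain ⟨w, hw⟩ := IsAlgClosed.exists_pow_nat_eq (formA y v) (n := 2) (by norm_num)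
    have h2 := (sq_eq_of_formGPlus hy.ne_zero hG hw s t).1
    rw [← h1, ← mul_pow] at h2
    obtain ⟨w', hw', h3⟩ : ∃ w' : ℂ, w' ^ 2 = formA y v ∧
        2 * w' * W = 2 * formA y v * t ^ 4 + formB x u y v * s ^ 4 := by
      rcases sq_eq_sq_iff_eq_or_eq_neg.mp h2 with h3 | h3
      · exact ⟨w, hw, h3.symm⟩
      · exact ⟨-w, by rw [neg_sq, hw], by rw [h3]; ring⟩
    obtain ⟨r, hr⟩ := WP.exists_of_ne_zero (n := 2) hy.ne_zero w'
    refine ⟨(c.1, r), (mem_coverFiber_iff hy).mpr ⟨rfl, w', hr, hw'⟩, ?_⟩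
    exact (mem_liftedLine_iff (q := (c.1, r)) hx hr hP).mpr ⟨h1, s, t, rfl, h3⟩
  · rintro ⟨q, hq, hPq⟩
    obtain ⟨h1, w, h2, -⟩ := (mem_coverFiber_iff hy).mp hq
    obtain ⟨h3, s, t, rfl, -⟩ := (mem_liftedLine_iff (h1 ▸ hx) h2 hP).mp hPq
    exact ⟨h3, s, t, rfl⟩

/-! ### Recovering the line and the square root of `A` from a section. -/

theorem le_of_sectionCurve_eq {Q Q' : MvPolynomial (Fin 4) ℂ} (hQ' : Q'.IsHomogeneous 4)
    {L L' : Submodule ℂ (Fin 4 → ℂ)}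
    (h : sectionCurve Q L = sectionCurve Q' L') : L ≤ L' ∧ ∀ z ∈ L, z ≠ 0 → eval z Q = eval z Q' := by
  have key : ∀ z ∈ L, z ≠ 0 → z ∈ L' ∧ eval z Q = eval z Q' := by
    intro z hz h0
    obtain ⟨P, hP⟩ := WP.exists_of_ne_zero h0 (eval z Q)
    have h1 : P ∈ sectionCurve Q L := ⟨z, hz, h0, hP⟩
    rw [h, mem_sectionCurve_iff hQ' hP] at h1
    exact ⟨h1.1, h1.2.2⟩
  refine ⟨fun z hz => ?_, fun z hz h0 => (key z hz h0).2⟩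
  by_cases h0 : z = 0
  · rw [h0]
    exact L'.zero_mem
  · exact (key z hz h0).1

theorem liftedLine_injOn : Set.InjOn liftedLine CTilde := by
  rintro q ⟨c, hc, hq⟩ q' ⟨c', hc', hq'⟩ h
  have hcc : c = c' := by
    obtain ⟨Q, hQ, e⟩ := exists_section_of_mem_coverFiber hc hq
    obtain ⟨Q', hQ', e'⟩ := exists_section_of_mem_coverFiber hc' hq'
    rw [e, e'] at h
    exact eq_of_line_le (le_of_sectionCurve_eq hQ' h).1
  subst hcc
  obtain ⟨x, u, hx⟩ := exists_hasCoords_pair c.1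
  obtain ⟨y, v, hy⟩ := exists_hasCoords_pair c.2
  have hG := (mem_CPlus_iff hx hy).mp hc
  obtain ⟨h1, w, h2, h3⟩ := (mem_coverFiber_iff hy).mp hq
  obtain ⟨h1', w', h2', h3'⟩ := (mem_coverFiber_iff hy).mp hq'
  obtain ⟨Q, hQ, e, hv⟩ := exists_form_liftedLine hx hy hG h1 h2 h3
  obtain ⟨Q', hQ', e', hv'⟩ := exists_form_liftedLine hx hy hG h1' h2' h3'
  rw [e, e'] at h
  -- The section takes the value `2 A / (2 w) = w` at `(s, t) = (0, 1)`, also when `w = 0`, so it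
  -- determines `w`.
  have hval : ∀ w : ℂ, w ^ 2 = formA y v →
      (2 * w)⁻¹ * (2 * formA y v * 1 ^ 4 + formB x u y v * 0 ^ 4) = w := by
    intro w hw
    rw [← hw]
    by_cases h0 : w = 0
    · simp [h0]
    · field_simp
      ring
  have h4 := (le_of_sectionCurve_eq hQ' h).2 ![0 * x, 0 * u, 1 * y, 1 * v]
    ((mem_line_iff hx hy).mpr ⟨0, 1, rfl⟩) (line_vec_ne_zero hx.ne_zero hy.ne_zero (by simp))
  rw [hv, hv', hval w h3, hval w' h3'] at h4
  subst h4
  exact Prod.ext (h1.trans h1'.symm) (h2.ext h2')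

/-- Pointwise the sign could vary; as polynomials in `s, t` over a domain, the two sections agree up
to one global sign. -/
theorem eq_of_sq_eq_sq {a b : Fin 4 → ℂ} {Q Q' : MvPolynomial (Fin 4) ℂ}
    (h : ∀ s t : ℂ, eval (s • a + t • b) Q ^ 2 = eval (s • a + t • b) Q' ^ 2) :
    (∀ s t : ℂ, eval (s • a + t • b) Q = eval (s • a + t • b) Q') ∨
      ∀ s t : ℂ, eval (s • a + t • b) Q = -eval (s • a + t • b) Q' := by
  let φ : Fin 4 → MvPolynomial (Fin 2) ℂ := fun i => C (a i) * X 0 + C (b i) * X 1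
  have hφ : ∀ (H : MvPolynomial (Fin 4) ℂ) (z : Fin 2 → ℂ),
      eval z (aeval φ H) = eval (z 0 • a + z 1 • b) H := by
    intro H z
    have : (fun i => aeval z (φ i)) = z 0 • a + z 1 • b := by
      funext i
      simp [φ, mul_comm]
    rw [← this]
    change aeval z (aeval φ H) = aeval _ H
    rw [← AlgHom.comp_apply, comp_aeval]
  have hsq : aeval φ Q ^ 2 = aeval φ Q' ^ 2 := by
    refine MvPolynomial.funext fun z => ?_
    rw [map_pow, map_pow, hφ, hφ]
    exact h _ _
  rcases sq_eq_sq_iff_eq_or_eq_neg.mp hsq with h1 | h1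
  · left
    intro s t
    have := congrArg (eval ![s, t]) h1
    rw [hφ, hφ] at this
    exact this
  · right
    intro s t
    have := congrArg (eval ![s, t]) h1
    rw [map_neg, hφ, hφ] at this
    exact this

theorem liftedLine_bijOn : Set.BijOn liftedLine CTilde
    {Z | Z ⊆ DoubleOctic ∧ ∃ c ∈ CPlus, MapsIsomorphicallyTo Z (line c)} := by
  refine ⟨?_, liftedLine_injOn, ?_⟩
  · rintro q ⟨c, hc, hq⟩
    exact ⟨fun P hP => hP.1, c, hc, mapsIsomorphicallyTo_liftedLine hc hq⟩
  · rintro Z ⟨hZ, c, hc, Q₀, hQ₀, hZQ⟩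
    change Z = sectionCurve Q₀ (line c) at hZQ
    obtain ⟨x, u, hx⟩ := exists_hasCoords_pair c.1
    obtain ⟨y, v, hy⟩ := exists_hasCoords_pair c.2
    have hG := (mem_CPlus_iff hx hy).mp hc
    have hsq : ∀ z ∈ line c, z ≠ 0 → eval z Q₀ ^ 2 = eval z F := by
      intro z hz h0
      obtain ⟨P, hP⟩ := WP.exists_of_ne_zero h0 (eval z Q₀)
      have h1 : P ∈ Z := by
        rw [hZQ]
        exact ⟨z, hz, h0, hP⟩
      exact (mem_doubleOctic_iff hP).mp (hZ h1)
    -- For a given section `Q₀` with `Q₀² = F` on the line, the candidate root of `A` is its value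
    -- at `(0 : 0 : y : v)`.
    obtain ⟨w, hw⟩ : ∃ w, w = eval ![0 * x, 0 * u, 1 * y, 1 * v] Q₀ := ⟨_, rfl⟩
    have hw2 : w ^ 2 = formA y v := by
      rw [hw, hsq _ ((mem_line_iff hx hy).mpr ⟨0, 1, rfl⟩)
        (line_vec_ne_zero hx.ne_zero hy.ne_zero (by simp)), eval_F_line]
      ring
    obtain ⟨r, hr⟩ := WP.exists_of_ne_zero (n := 2) hy.ne_zero w
    have hq : (c.1, r) ∈ coverFiber c := (mem_coverFiber_iff hy).mpr ⟨rfl, w, hr, hw2⟩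
    obtain ⟨Q, hQ, e, hv⟩ := exists_form_liftedLine hx hy hG (q := (c.1, r)) rfl hr hw2
    refine ⟨(c.1, r), ⟨c, hc, hq⟩, ?_⟩
    rw [e, hZQ]
    have hvec : ∀ s t : ℂ,
        s • ![x, u, 0, 0] + t • ![0, 0, y, v] = ![s * x, s * u, t * y, t * v] := by
      intro s t
      funext i
      fin_cases i <;> simp
    have hsq' : ∀ s t : ℂ, eval ![s * x, s * u, t * y, t * v] Q ^ 2
        = eval ![s * x, s * u, t * y, t * v] F := by
      intro s t
      obtain ⟨h1, h2⟩ := sq_eq_of_formGPlus hy.ne_zero hG hw2 s t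
      rw [hv]
      by_cases hw0 : w = 0
      · rw [(h2 hw0).1, (h2 hw0).2]
        simp
      · rw [mul_pow, h1]
        field_simp
    have hsq0 : ∀ s t : ℂ, eval ![s * x, s * u, t * y, t * v] Q₀ ^ 2
        = eval ![s * x, s * u, t * y, t * v] F := by
      intro s t
      by_cases h0 : ![s * x, s * u, t * y, t * v] = 0
      · have h1 := eval_smul_of_isHomogeneous hQ₀ 0 0
        have h2 := eval_F_smul 0 0
        rw [smul_zero] at h1 h2
        rw [h0, h1, h2]
        simp
      · exact hsq _ ((mem_line_iff hx hy).mpr ⟨s, t, rfl⟩) h0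
    have heq : ∀ s t : ℂ, eval ![s * x, s * u, t * y, t * v] Q
        = eval ![s * x, s * u, t * y, t * v] Q₀ := by
      intro s t
      by_cases hw0 : w = 0
      · have h1 := hsq' s t
        have h2 := hsq0 s t
        rw [((sq_eq_of_formGPlus hy.ne_zero hG hw2 s t).2 hw0).2] at h1 h2
        rw [pow_eq_zero_iff two_ne_zero] at h1 h2
        rw [h1, h2]
      · have h3 := eq_of_sq_eq_sq (a := ![x, u, 0, 0]) (b := ![0, 0, y, v]) (Q := Q) (Q' := Q₀)
          fun s t => by rw [hvec, hsq', hsq0]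
        simp only [hvec] at h3
        rcases h3 with h3 | h3
        · exact h3 s t
        · exfalso
          -- The sign is fixed at `(s, t) = (0, 1)`: both sections have the value `w ≠ 0` there.
          have h4 := h3 0 1
          rw [hv, ← hw, ← hw2] at h4
          apply hw0
          field_simp at h4
          have h5 : 4 * w ^ 2 = 0 := by linear_combination h4
          simpa using h5
    ext P
    constructor
    · rintro ⟨z, hz, h0, hP⟩
      obtain ⟨s, t, rfl⟩ := (mem_line_iff hx hy).mp hz
      exact ⟨_, hz, h0, by rw [← heq]; exact hP⟩
    · rintro ⟨z, hz, h0, hP⟩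
      obtain ⟨s, t, rfl⟩ := (mem_line_iff hx hy).mp hz
      exact ⟨_, hz, h0, by rw [heq]; exact hP⟩

/-! ## The branch points of the double cover -/

theorem WP.HasCoords.eq_of_pair {p : WP 2} {y v w w' : ℂ} (hy : ![y, v] ≠ 0)
    (h : p.HasCoords ![y, v] w) (h' : p.HasCoords ![y, v] w') : w = w' := by
  obtain ⟨a, -, e1, e2⟩ := h.exists_smul h'
  have e3 : 1 * y = a * y := (one_mul y).trans (congrFun e1 0)
  have e4 : 1 * v = a * v := (one_mul v).trans (congrFun e1 1)
  rw [← eq_of_smul_pair_eq hy e3 e4] at e2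
  simpa using e2.symm

theorem ncard_coverFiber (c : PP 1 × PP 1) {y v : ℂ} (hy : HasCoords c.2 ![y, v]) :
    (formA y v = 0 → (coverFiber c).ncard = 1) ∧ (formA y v ≠ 0 → (coverFiber c).ncard = 2) := by
  have hr : ∀ w : ℂ, ∃ r : WP 2, r.HasCoords ![y, v] w := fun w =>
    WP.exists_of_ne_zero (n := 2) hy.ne_zero w
  choose r hr using hr
  have hmem : ∀ q, q ∈ coverFiber c ↔ ∃ w, w ^ 2 = formA y v ∧ q = (c.1, r w) := by
    intro q
    rw [mem_coverFiber_iff hy]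
    constructor
    · rintro ⟨h1, w, h2, h3⟩
      exact ⟨w, h3, Prod.ext h1 (h2.ext (hr w))⟩
    · rintro ⟨w, h1, rfl⟩
      exact ⟨rfl, w, hr w, h1⟩
  constructor
  · intro hA
    rw [Set.ncard_eq_one]
    refine ⟨(c.1, r 0), Set.ext fun q => ?_⟩
    rw [hmem, Set.mem_singleton_iff, hA]
    constructor
    · rintro ⟨w, h1, rfl⟩
      rw [pow_eq_zero_iff two_ne_zero] at h1
      rw [h1]
    · rintro rfl
      exact ⟨0, by norm_num, rfl⟩
  · intro hA
    obtain ⟨w, hw⟩ := IsAlgClosed.exists_pow_nat_eq (formA y v) (n := 2) (by norm_num)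
    have hw0 : w ≠ 0 := by
      rintro rfl
      exact hA (by rw [← hw]; ring)
    rw [Set.ncard_eq_two]
    refine ⟨(c.1, r w), (c.1, r (-w)), ?_, Set.ext fun q => ?_⟩
    · intro h
      have h1 : r w = r (-w) := congrArg Prod.snd h
      have h2 := (hr w).eq_of_pair hy.ne_zero (h1 ▸ hr (-w))
      exact hw0 (self_eq_neg.mp h2)
    · rw [hmem, Set.mem_insert_iff, Set.mem_singleton_iff]
      constructor
      · rintro ⟨w', h1, rfl⟩
        rw [← hw] at h1
        rcases sq_eq_sq_iff_eq_or_eq_neg.mp h1 with rfl | rfl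
        exacts [Or.inl rfl, Or.inr rfl]
      · rintro (rfl | rfl)
        exacts [⟨w, hw, rfl⟩, ⟨-w, by rw [neg_sq, hw], rfl⟩]

theorem ncard_coverFiber_eq (c : PP 1 × PP 1) :
    (coverFiber c).ncard = 1 ∨ (coverFiber c).ncard = 2 := by
  obtain ⟨y, v, hy⟩ := exists_hasCoords_pair c.2
  by_cases hA : formA y v = 0
  · exact Or.inl ((ncard_coverFiber c hy).1 hA)
  · exact Or.inr ((ncard_coverFiber c hy).2 hA)

/-- The polynomial `A`. -/
def polyA : Polynomial ℂ := Polynomial.X ^ 8 + 14 * Polynomial.X ^ 4 + 1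

/-- The polynomial `g_+` in `x` for fixed `y`. -/
def polyG (y : ℂ) : Polynomial ℂ :=
  Polynomial.C (leadB y) * Polynomial.X ^ 4 - Polynomial.C (midD y) * Polynomial.X ^ 2
    + Polynomial.C (leadB y)

theorem eval_polyA (y : ℂ) : polyA.eval y = coeffA y := by
  simp [polyA, coeffA]

theorem eval_polyG (x y : ℂ) : (polyG y).eval x = gPlus x y := by
  simp [polyG, gPlus_eq_leadB_midD]

theorem natDegree_polyA : polyA.natDegree = 8 := by
  unfold polyA
  compute_degree!

theorem natDegree_polyG {y : ℂ} (h : leadB y ≠ 0) : (polyG y).natDegree = 4 := by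
  unfold polyG
  compute_degree!

theorem card_roots_polyA : polyA.roots.toFinset.card = 8 := by
  rw [card_roots_toFinset_of_simple, natDegree_polyA]
  intro y hy
  rw [eval_polyA] at hy
  have : polyA.derivative.eval y = coeffA' y := by
    simp [polyA, coeffA']
    ring
  rw [this]
  exact coeffA'_ne_zero hy

theorem card_roots_polyG {y : ℂ} (hA : coeffA y = 0) : (polyG y).roots.toFinset.card = 4 := by
  rw [card_roots_toFinset_of_simple, natDegree_polyG (leadB_ne_zero_of_coeffA hA)]
  intro x hx
  rw [eval_polyG] at hx
  have : (polyG y).derivative.eval x = gPlusX x y := by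
    simp [polyG, gPlusX]
    ring
  rw [this]
  exact gPlusX_ne_zero_of_coeffA hA hx

theorem affinePoint_injective {x y x' y' : ℂ} (h : affinePoint x y = affinePoint x' y') :
    x = x' ∧ y = y' := by
  have key : ∀ {p : PP 1} {x x' : ℂ}, HasCoords p ![x, 1] → HasCoords p ![x', 1] → x = x' := by
    intro p x x' h1 h2
    obtain ⟨a, -, e⟩ := h1.exists_smul h2
    have e0 : x' = a * x := congrFun e 0
    have e1 : 1 = a * 1 := congrFun e 1
    rw [mul_one] at e1
    rw [e0, ← e1, one_mul]
  exact ⟨key (hasCoords_affinePoint_fst x y) (h ▸ hasCoords_affinePoint_fst x' y'),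
    key (hasCoords_affinePoint_snd x y) (h ▸ hasCoords_affinePoint_snd x' y')⟩

/-- No branch point is at infinity: `A(y, 0) = y⁸`, and `u = 0` would give `b x⁴ = 0` with `b ≠ 0`.
-/
theorem exists_affinePoint_of_formA {c : PP 1 × PP 1} (hc : c ∈ CPlus) {y v : ℂ}
    (hy : HasCoords c.2 ![y, v]) (hA : formA y v = 0) :
    ∃ a b : ℂ, c = affinePoint a b ∧ coeffA b = 0 ∧ gPlus a b = 0 := by
  have hv : v ≠ 0 := by
    rintro rfl
    have : y = 0 := by simpa [formA] using hA
    apply hy.ne_zero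
    simp [this]
  have hy' : HasCoords c.2 ![y / v, 1] := by
    have := hy.smul (inv_ne_zero hv)
    convert this using 1
    funext i
    fin_cases i <;> simp <;> field_simp
  have hA' : coeffA (y / v) = 0 := by
    have : formA y v = v ^ 8 * coeffA (y / v) := by
      simp only [formA, coeffA]
      field_simp
    rw [hA] at this
    exact (mul_eq_zero.mp this.symm).resolve_left (pow_ne_zero 8 hv)
  obtain ⟨x, u, hx⟩ := exists_hasCoords_pair c.1
  have hG := (mem_CPlus_iff hx hy').mp hc
  have hu : u ≠ 0 := by
    rintro rfl
    have h1 : leadB (y / v) * x ^ 4 = 0 := by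
      rw [← hG]
      simp only [leadB, formGPlus]
      ring
    have h2 : x = 0 := by simpa [leadB_ne_zero_of_coeffA hA'] using h1
    apply hx.ne_zero
    simp [h2]
  have hx' : HasCoords c.1 ![x / u, 1] := by
    have := hx.smul (inv_ne_zero hu)
    convert this using 1
    funext i
    fin_cases i <;> simp <;> field_simp
  refine ⟨x / u, y / v, Prod.ext (hx'.ext (hasCoords_affinePoint_fst _ _))
    (hy'.ext (hasCoords_affinePoint_snd _ _)), hA', ?_⟩
  rw [← (mem_CPlus_iff hx' hy').mp hc]
  simp [gPlus, formGPlus]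

/-- `A` has eight simple zeros, and over each of them `g₊` has four simple zeros in `x`. -/
theorem ncard_branch_points : {c ∈ CPlus | (coverFiber c).ncard = 1}.ncard = 32 := by
  classical
  let T : Finset (Σ _ : ℂ, ℂ) := polyA.roots.toFinset.sigma fun y => (polyG y).roots.toFinset
  have hA0 : polyA ≠ 0 := by
    intro h
    have := natDegree_polyA
    rw [h] at this
    simp at this
  have hrootA : ∀ y, y ∈ polyA.roots.toFinset ↔ coeffA y = 0 := by
    intro y
    rw [Multiset.mem_toFinset, Polynomial.mem_roots hA0, Polynomial.IsRoot, eval_polyA]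
  have hrootG : ∀ x y, coeffA y = 0 → (x ∈ (polyG y).roots.toFinset ↔ gPlus x y = 0) := by
    intro x y hy
    have h0 : polyG y ≠ 0 := by
      intro h
      have := natDegree_polyG (leadB_ne_zero_of_coeffA hy)
      rw [h] at this
      simp at this
    rw [Multiset.mem_toFinset, Polynomial.mem_roots h0, Polynomial.IsRoot, eval_polyG]
  have hT : T.card = 32 := by
    rw [Finset.card_sigma, Finset.sum_congr rfl fun y hy => card_roots_polyG ((hrootA y).mp hy),
      Finset.sum_const, card_roots_polyA]
    rfl
  have heq : {c ∈ CPlus | (coverFiber c).ncard = 1}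
      = (fun a : Σ _ : ℂ, ℂ => affinePoint a.2 a.1) '' T := by
    ext c
    constructor
    · rintro ⟨hc, hcard⟩
      obtain ⟨y, v, hy⟩ := exists_hasCoords_pair c.2
      have hA : formA y v = 0 := by
        by_contra hA
        rw [(ncard_coverFiber c hy).2 hA] at hcard
        norm_num at hcard
      obtain ⟨a, b, rfl, h1, h2⟩ := exists_affinePoint_of_formA hc hy hA
      refine ⟨⟨b, a⟩, ?_, rfl⟩
      exact Finset.mem_coe.mpr (Finset.mem_sigma.mpr ⟨(hrootA b).mpr h1, (hrootG a b h1).mpr h2⟩)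
    · rintro ⟨⟨y, x⟩, h, rfl⟩
      obtain ⟨h1, h2⟩ := Finset.mem_sigma.mp (Finset.mem_coe.mp h)
      have hA := (hrootA y).mp h1
      have hG := (hrootG x y hA).mp h2
      refine ⟨?_, (ncard_coverFiber _ (hasCoords_affinePoint_snd x y)).1 ?_⟩
      · refine (mem_CPlus_iff (hasCoords_affinePoint_fst x y)
          (hasCoords_affinePoint_snd x y)).mpr ?_
        rw [← hG]
        simp [gPlus, formGPlus]
      · rw [← hA]
        simp [formA, coeffA]
  rw [heq, Set.ncard_image_of_injective, Set.ncard_coe_finset, hT]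
  rintro ⟨y, x⟩ ⟨y', x'⟩ h
  obtain ⟨rfl, rfl⟩ := affinePoint_injective h
  rfl

/-! ## The curves in the Grassmannian -/

theorem hasCoords_pluckerPoint {c : PP 1 × PP 1} {x u y v : ℂ} (hx : HasCoords c.1 ![x, u])
    (hy : HasCoords c.2 ![y, v]) :
    HasCoords (pluckerPoint c) ![0, x * y, x * v, u * y, u * v, 0] := by
  obtain ⟨s, hs, e1⟩ := (hasCoords_rep c.1).exists_smul hx
  obtain ⟨t, ht, e2⟩ := (hasCoords_rep c.2).exists_smul hy
  have e3 : x = s * c.1.rep 0 := congrFun e1 0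
  have e4 : u = s * c.1.rep 1 := congrFun e1 1
  have e5 : y = t * c.2.rep 0 := congrFun e2 0
  have e6 : v = t * c.2.rep 1 := congrFun e2 1
  have h : HasCoords (pluckerPoint c) (pluckerVector (basePoint₁ c) (basePoint₂ c)) :=
    ⟨pluckerVector_ne_zero c, rfl⟩
  have h2 := h.smul (mul_ne_zero hs ht)
  convert h2 using 1
  rw [e3, e4, e5, e6]
  funext i
  fin_cases i <;> simp [pluckerVector, basePoint₁, basePoint₂] <;> ring

theorem exists_rep_pluckerPoint (c : PP 1 × PP 1) : ∃ a : ℂ, a ≠ 0 ∧ (pluckerPoint c).rep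
    = a • ![0, c.1.rep 0 * c.2.rep 0, c.1.rep 0 * c.2.rep 1, c.1.rep 1 * c.2.rep 0,
      c.1.rep 1 * c.2.rep 1, 0] := by
  have h := hasCoords_pluckerPoint (c := c) (by rw [pair_eta]; exact hasCoords_rep c.1)
    (by rw [pair_eta]; exact hasCoords_rep c.2)
  exact h.exists_smul (hasCoords_rep _)

theorem hasCoords_rep_smul {p : PP 1} {a x u : ℂ} (hx : x = a * p.rep 0) (hu : u = a * p.rep 1)
    (h : x ≠ 0 ∨ u ≠ 0) : HasCoords p ![x, u] := by
  have ha : a ≠ 0 := by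
    rintro rfl
    rw [zero_mul] at hx hu
    rcases h with h | h
    exacts [h hx, h hu]
  have h1 := (hasCoords_rep p).smul ha
  convert h1 using 1
  funext i
  fin_cases i
  · exact hx
  · exact hu

theorem pluckerPoint_injective : Function.Injective pluckerPoint := by
  have key : ∀ {p p' : PP 1} {x u : ℂ} {a a' : ℂ}, (x ≠ 0 ∨ u ≠ 0) → x = a * p.rep 0 →
      u = a * p.rep 1 → x = a' * p'.rep 0 → u = a' * p'.rep 1 → p = p' := by
    intro p p' x u a a' h h1 h2 h3 h4
    exact (hasCoords_rep_smul h1 h2 h).ext (hasCoords_rep_smul h3 h4 h)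
  intro c c' h
  obtain ⟨a, ha, e⟩ := exists_rep_pluckerPoint c
  obtain ⟨a', ha', e'⟩ := exists_rep_pluckerPoint c'
  rw [← h, e] at e'
  have e1 : a * (c.1.rep 0 * c.2.rep 0) = a' * (c'.1.rep 0 * c'.2.rep 0) := congrFun e' 1
  have e2 : a * (c.1.rep 0 * c.2.rep 1) = a' * (c'.1.rep 0 * c'.2.rep 1) := congrFun e' 2
  have e3 : a * (c.1.rep 1 * c.2.rep 0) = a' * (c'.1.rep 1 * c'.2.rep 0) := congrFun e' 3
  have e4 : a * (c.1.rep 1 * c.2.rep 1) = a' * (c'.1.rep 1 * c'.2.rep 1) := congrFun e' 4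
  refine Prod.ext ?_ ?_
  · rcases exists_rep_ne_zero c.2 with h2 | h2
    · refine key (x := a * (c.1.rep 0 * c.2.rep 0)) (u := a * (c.1.rep 1 * c.2.rep 0))
        (a := a * c.2.rep 0) (a' := a' * c'.2.rep 0) ?_ (by ring) (by ring) (by rw [e1]; ring)
        (by rw [e3]; ring)
      rcases exists_rep_ne_zero c.1 with h1 | h1
      · exact Or.inl (mul_ne_zero ha (mul_ne_zero h1 h2))
      · exact Or.inr (mul_ne_zero ha (mul_ne_zero h1 h2))
    · refine key (x := a * (c.1.rep 0 * c.2.rep 1)) (u := a * (c.1.rep 1 * c.2.rep 1))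
        (a := a * c.2.rep 1) (a' := a' * c'.2.rep 1) ?_ (by ring) (by ring) (by rw [e2]; ring)
        (by rw [e4]; ring)
      rcases exists_rep_ne_zero c.1 with h1 | h1
      · exact Or.inl (mul_ne_zero ha (mul_ne_zero h1 h2))
      · exact Or.inr (mul_ne_zero ha (mul_ne_zero h1 h2))
  · rcases exists_rep_ne_zero c.1 with h1 | h1
    · refine key (x := a * (c.1.rep 0 * c.2.rep 0)) (u := a * (c.1.rep 0 * c.2.rep 1))
        (a := a * c.1.rep 0) (a' := a' * c'.1.rep 0) ?_ (by ring) (by ring) (by rw [e1]; ring)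
        (by rw [e2]; ring)
      rcases exists_rep_ne_zero c.2 with h2 | h2
      · exact Or.inl (mul_ne_zero ha (mul_ne_zero h1 h2))
      · exact Or.inr (mul_ne_zero ha (mul_ne_zero h1 h2))
    · refine key (x := a * (c.1.rep 1 * c.2.rep 0)) (u := a * (c.1.rep 1 * c.2.rep 1))
        (a := a * c.1.rep 1) (a' := a' * c'.1.rep 1) ?_ (by ring) (by ring) (by rw [e3]; ring)
        (by rw [e4]; ring)
      rcases exists_rep_ne_zero c.2 with h2 | h2
      · exact Or.inl (mul_ne_zero ha (mul_ne_zero h1 h2))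
      · exact Or.inr (mul_ne_zero ha (mul_ne_zero h1 h2))

theorem isBihomogeneous_aeval {n d : ℕ} {H : MvPolynomial (Fin n) ℂ} (hH : H.IsHomogeneous d)
    {e : ℕ × ℕ} {Φ : Fin n → MvPolynomial (Fin 4) ℂ} (hΦ : ∀ i, IsBihomogeneous (Φ i) e) :
    IsBihomogeneous (aeval Φ H) (d • e) := by
  rw [aeval_def, eval₂_eq']
  refine IsWeightedHomogeneous.sum _ _ _ fun m hm => ?_
  have h : ∑ i, m i = d := by
    rw [← hH (mem_support_iff.mp hm), Finsupp.weight_apply, Finsupp.sum_fintype _ _ (by simp)]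
    simp
  have h1 := IsWeightedHomogeneous.prod Finset.univ (fun i => Φ i ^ m i) (fun i => m i • e)
    fun i _ => (hΦ i).pow (m i)
  rw [← Finset.sum_smul, h] at h1
  exact h1.C_mul _

theorem subset_biClosure (s : Set (PP 1 × PP 1)) : s ⊆ biClosure s :=
  fun c hc _ _ _ h => h c hc

theorem eval_rep_eq_zero_iff {n d : ℕ} {H : MvPolynomial (Fin (n + 1)) ℂ} (hH : H.IsHomogeneous d)
    {p : PP n} {v : Fin (n + 1) → ℂ} (h : HasCoords p v) : eval p.rep H = 0 ↔ eval v H = 0 := by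
  obtain ⟨a, ha, rfl⟩ := (hasCoords_rep p).exists_smul h
  rw [eval_smul_of_isHomogeneous hH]
  simp [ha]

/-- The bihomogeneous Plücker coordinates of the lines `l_c`. -/
def pluckerForms : Fin 6 → MvPolynomial (Fin 4) ℂ :=
  ![0, X 0 * X 2, X 0 * X 3, X 1 * X 2, X 1 * X 3, 0]

theorem isBihomogeneous_pluckerForms (i : Fin 6) : IsBihomogeneous (pluckerForms i) (1, 1) := by
  have hX : ∀ i : Fin 4, IsBihomogeneous (X i)
      ((![(1, 0), (1, 0), (0, 1), (0, 1)] : Fin 4 → ℕ × ℕ) i) :=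
    fun i => isWeightedHomogeneous_X ℂ _ i
  fin_cases i
  · exact isWeightedHomogeneous_zero _ _ _
  · exact (hX 0).mul (hX 2)
  · exact (hX 0).mul (hX 3)
  · exact (hX 1).mul (hX 2)
  · exact (hX 1).mul (hX 3)
  · exact isWeightedHomogeneous_zero _ _ _

theorem eval_pluckerForms (x u y v : ℂ) : (fun i => eval ![x, u, y, v] (pluckerForms i))
    = ![0, x * y, x * v, u * y, u * v, 0] := by
  funext i
  fin_cases i <;> simp [pluckerForms]

theorem eval_aeval_pluckerForms (H : MvPolynomial (Fin 6) ℂ) (x u y v : ℂ) :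
    eval ![x, u, y, v] (aeval pluckerForms H) = eval ![0, x * y, x * v, u * y, u * v, 0] H := by
  rw [← eval_pluckerForms]
  change aeval ![x, u, y, v] (aeval pluckerForms H) = aeval _ H
  rw [← AlgHom.comp_apply, comp_aeval]
  rfl

/-- A nonzero `2 × 2` matrix of determinant zero has rank one; the row and the column through a
nonzero entry give the factors. -/
theorem exists_factorization {p₁ p₂ p₃ p₄ : ℂ} (h : p₁ * p₄ = p₂ * p₃)
    (h0 : p₁ ≠ 0 ∨ p₂ ≠ 0 ∨ p₃ ≠ 0 ∨ p₄ ≠ 0) : ∃ x u y v : ℂ, ![x, u] ≠ 0 ∧ ![y, v] ≠ 0 ∧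
      ∃ a : ℂ, a ≠ 0 ∧ x * y = a * p₁ ∧ x * v = a * p₂ ∧ u * y = a * p₃ ∧ u * v = a * p₄ := by
  rcases h0 with h0 | h0 | h0 | h0
  · refine ⟨p₁, p₃, p₁, p₂, by simp [h0], by simp [h0], p₁, h0, ?_⟩
    exact ⟨rfl, rfl, by ring, by linear_combination -h⟩
  · refine ⟨p₂, p₄, p₁, p₂, by simp [h0], by simp [h0], p₂, h0, ?_⟩
    exact ⟨by ring, rfl, by linear_combination h, by ring⟩
  · refine ⟨p₁, p₃, p₃, p₄, by simp [h0], by simp [h0], p₃, h0, ?_⟩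
    exact ⟨by ring, by linear_combination h, rfl, rfl⟩
  · refine ⟨p₂, p₄, p₃, p₄, by simp [h0], by simp [h0], p₄, h0, ?_⟩
    exact ⟨by linear_combination -h, by ring, rfl, rfl⟩

/-- The Plücker map is the Segre embedding onto the quadric `p₁ p₄ = p₂ p₃` in `p₀ = p₅ = 0`. These
equations together with `q`, which pulls back to `G`, cut out the image of the curve, so the closure
adds nothing to it. -/
theorem isIsomorphism_pluckerPoint {s : Set (PP 1 × PP 1)} {G : MvPolynomial (Fin 4) ℂ} {d : ℕ × ℕ}
    (hG : IsBihomogeneous G d) (hs : biClosure s = {c | eval (coords c) G = 0})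
    {q : MvPolynomial (Fin 6) ℂ} {e : ℕ} (hq : q.IsHomogeneous e)
    (hqG : ∀ x u y v : ℂ, eval ![0, x * y, x * v, u * y, u * v, 0] q = eval ![x, u, y, v] G) :
    IsIsomorphism pluckerPoint (biClosure s) (projClosure (pluckerPoint '' s)) := by
  refine ⟨⟨?_, pluckerPoint_injective.injOn, ?_⟩, ?_, ?_, ?_⟩
  · intro c hc H d hH hvan
    obtain ⟨x, u, hx⟩ := exists_hasCoords_pair c.1
    obtain ⟨y, v, hy⟩ := exists_hasCoords_pair c.2
    have hbi := isBihomogeneous_aeval hH isBihomogeneous_pluckerForms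
    rw [eval_rep_eq_zero_iff hH (hasCoords_pluckerPoint hx hy), ← eval_aeval_pluckerForms,
      ← hbi.eval_coords_eq_zero_iff hx hy]
    refine hc _ _ hbi fun c' hc' => ?_
    obtain ⟨x', u', hx'⟩ := exists_hasCoords_pair c'.1
    obtain ⟨y', v', hy'⟩ := exists_hasCoords_pair c'.2
    rw [hbi.eval_coords_eq_zero_iff hx' hy', eval_aeval_pluckerForms,
      ← eval_rep_eq_zero_iff hH (hasCoords_pluckerPoint hx' hy')]
    exact hvan _ ⟨c', hc', rfl⟩
  · intro p hp
    -- Forms that vanish on the image of the zero set of `G` vanish at `p`; next this is applied to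
    -- the equations of the image.
    have hcond : ∀ (H : MvPolynomial (Fin 6) ℂ) (d : ℕ), H.IsHomogeneous d →
        (∀ x u y v, eval ![x, u, y, v] G = 0 → eval ![0, x * y, x * v, u * y, u * v, 0] H = 0) →
        eval p.rep H = 0 := by
      intro H d' hH hvan
      refine hp H d' hH ?_
      rintro _ ⟨c, hc, rfl⟩
      obtain ⟨x, u, hx⟩ := exists_hasCoords_pair c.1
      obtain ⟨y, v, hy⟩ := exists_hasCoords_pair c.2
      rw [eval_rep_eq_zero_iff hH (hasCoords_pluckerPoint hx hy)]
      have h1 := subset_biClosure s hc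
      rw [hs] at h1
      exact hvan _ _ _ _ ((hG.eval_coords_eq_zero_iff hx hy).mp h1)
    have h0 : p.rep 0 = 0 := by
      simpa using hcond (X 0) 1 (isHomogeneous_X ℂ _) (by simp)
    have h5 : p.rep 5 = 0 := by
      simpa using hcond (X 5) 1 (isHomogeneous_X ℂ _) (by simp)
    have hdet : p.rep 1 * p.rep 4 = p.rep 2 * p.rep 3 := by
      have := hcond (X 1 * X 4 - X 2 * X 3) 2
        (IsHomogeneous.sub ((isHomogeneous_X ℂ _).mul (isHomogeneous_X ℂ _))
          ((isHomogeneous_X ℂ _).mul (isHomogeneous_X ℂ _)))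
        (by
          intro x u y v _
          simp
          ring)
      simpa [sub_eq_zero] using this
    have hqp : eval p.rep q = 0 := hcond q e hq fun x u y v h => by rw [hqG, h]
    obtain ⟨x, u, y, v, hx, hy, a, ha, e1, e2, e3, e4⟩ := exists_factorization hdet (by
      by_contra hcon
      push Not at hcon
      obtain ⟨h1, h2, h3, h4⟩ := hcon
      apply p.rep_nonzero
      funext i
      fin_cases i
      exacts [h0, h1, h2, h3, h4, h5])
    obtain ⟨c₁, hc₁⟩ := exists_point hx
    obtain ⟨c₂, hc₂⟩ := exists_point hy
    have hvec : ![0, x * y, x * v, u * y, u * v, 0] = a • p.rep := by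
      funext i
      fin_cases i <;> simp [e1, e2, e3, e4, h0, h5]
    have hcoords := (hasCoords_rep p).smul ha
    rw [← hvec] at hcoords
    refine ⟨(c₁, c₂), ?_, (hasCoords_pluckerPoint (c := (c₁, c₂)) hc₁ hc₂).ext hcoords⟩
    rw [hs, Set.mem_ofPred_eq, hG.eval_coords_eq_zero_iff (c := (c₁, c₂)) hc₁ hc₂, ← hqG,
      ← eval_rep_eq_zero_iff hq hcoords]
    exact hqp
  · intro c _
    have h : ∀ c : PP 1 × PP 1,
        HasCoords (pluckerPoint c) (fun i => eval (coords c) (pluckerForms i)) := by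
      intro c
      rw [coords, eval_pluckerForms]
      exact hasCoords_pluckerPoint (by rw [pair_eta]; exact hasCoords_rep c.1)
        (by rw [pair_eta]; exact hasCoords_rep c.2)
    refine ⟨(1, 1), pluckerForms, isBihomogeneous_pluckerForms, ?_, fun c' _ _ => h c'⟩
    by_contra hcon
    push Not at hcon
    exact (h c).ne_zero (funext hcon)
  · intro c _
    -- The ratio `x : u` is read off from the two Plücker coordinates that share the factor `y`, or
    -- from the two that share `v`, whichever is nonzero at `c`.
    obtain ⟨i, j, k, hk, hij⟩ : ∃ (i j : Fin 6) (k : Fin 2), c.2.rep k ≠ 0 ∧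
        ∀ c' : PP 1 × PP 1, ∃ a : ℂ, a ≠ 0 ∧
          (pluckerPoint c').rep i = a * c'.2.rep k * c'.1.rep 0 ∧
          (pluckerPoint c').rep j = a * c'.2.rep k * c'.1.rep 1 := by
      rcases exists_rep_ne_zero c.2 with h | h
      · refine ⟨1, 3, 0, h, fun c' => ?_⟩
        obtain ⟨a, ha, e⟩ := exists_rep_pluckerPoint c'
        refine ⟨a, ha, ?_, ?_⟩ <;> rw [e] <;> simp <;> ring
      · refine ⟨2, 4, 1, h, fun c' => ?_⟩
        obtain ⟨a, ha, e⟩ := exists_rep_pluckerPoint c'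
        refine ⟨a, ha, ?_, ?_⟩ <;> rw [e] <;> simp <;> ring
    have hfun : ∀ w : Fin 6 → ℂ, (fun l => eval w (![X i, X j] l : MvPolynomial (Fin 6) ℂ))
        = ![w i, w j] := by
      intro w
      funext l
      fin_cases l <;> simp
    refine ⟨1, ![X i, X j], fun l => ?_, ?_, fun c' _ h => ?_⟩
    · fin_cases l
      exacts [isHomogeneous_X ℂ _, isHomogeneous_X ℂ _]
    · obtain ⟨a, ha, e1, e2⟩ := hij c
      rcases exists_rep_ne_zero c.1 with h | h
      · refine ⟨0, ?_⟩
        simpa [e1, ha, hk] using h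
      · refine ⟨1, ?_⟩
        simpa [e2, ha, hk] using h
    · obtain ⟨a, ha, e1, e2⟩ := hij c'
      rw [hfun]
      refine hasCoords_rep_smul e1 e2 ?_
      obtain ⟨l, hl⟩ := h
      fin_cases l
      · left
        simpa using hl
      · right
        simpa using hl
  · intro c _
    obtain ⟨i, j, k, hk, hij⟩ : ∃ (i j : Fin 6) (k : Fin 2), c.1.rep k ≠ 0 ∧
        ∀ c' : PP 1 × PP 1, ∃ a : ℂ, a ≠ 0 ∧
          (pluckerPoint c').rep i = a * c'.1.rep k * c'.2.rep 0 ∧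
          (pluckerPoint c').rep j = a * c'.1.rep k * c'.2.rep 1 := by
      rcases exists_rep_ne_zero c.1 with h | h
      · refine ⟨1, 2, 0, h, fun c' => ?_⟩
        obtain ⟨a, ha, e⟩ := exists_rep_pluckerPoint c'
        refine ⟨a, ha, ?_, ?_⟩ <;> rw [e] <;> simp <;> ring
      · refine ⟨3, 4, 1, h, fun c' => ?_⟩
        obtain ⟨a, ha, e⟩ := exists_rep_pluckerPoint c'
        refine ⟨a, ha, ?_, ?_⟩ <;> rw [e] <;> simp <;> ring
    have hfun : ∀ w : Fin 6 → ℂ, (fun l => eval w (![X i, X j] l : MvPolynomial (Fin 6) ℂ))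
        = ![w i, w j] := by
      intro w
      funext l
      fin_cases l <;> simp
    refine ⟨1, ![X i, X j], fun l => ?_, ?_, fun c' _ h => ?_⟩
    · fin_cases l
      exacts [isHomogeneous_X ℂ _, isHomogeneous_X ℂ _]
    · obtain ⟨a, ha, e1, e2⟩ := hij c
      rcases exists_rep_ne_zero c.2 with h | h
      · refine ⟨0, ?_⟩
        simpa [e1, ha, hk] using h
      · refine ⟨1, ?_⟩
        simpa [e2, ha, hk] using h
    · obtain ⟨a, ha, e1, e2⟩ := hij c'
      rw [hfun]
      refine hasCoords_rep_smul e1 e2 ?_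
      obtain ⟨l, hl⟩ := h
      fin_cases l
      · left
        simpa using hl
      · right
        simpa using hl

/-- The quartic that cuts out the lines of `C_+` (for `e = 1`) or `C_-` (for `e = -1`) among
the lines `l_c`, in Plücker coordinates. -/
def pluckerQuartic (e : ℂ) : MvPolynomial (Fin 6) ℂ :=
  C 2 * X 1 ^ 4 + C e * (X 1 ^ 2 * X 2 ^ 2) + C 2 * X 2 ^ 4 - C e * (X 1 ^ 2 * X 3 ^ 2)
    + C 24 * (X 1 ^ 2 * X 4 ^ 2) - C e * (X 2 ^ 2 * X 4 ^ 2) + C 2 * X 3 ^ 4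
    + C e * (X 3 ^ 2 * X 4 ^ 2) + C 2 * X 4 ^ 4

theorem isHomogeneous_pluckerQuartic (e : ℂ) : (pluckerQuartic e).IsHomogeneous 4 := by
  have h4 : ∀ (a : ℂ) (i : Fin 6), (C a * X i ^ 4 : MvPolynomial (Fin 6) ℂ).IsHomogeneous 4 := by
    intro a i
    simpa using (isHomogeneous_C (Fin 6) a).mul ((isHomogeneous_X ℂ i).pow 4)
  have h2 : ∀ (a : ℂ) (i j : Fin 6),
      (C a * (X i ^ 2 * X j ^ 2) : MvPolynomial (Fin 6) ℂ).IsHomogeneous 4 := by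
    intro a i j
    simpa using (isHomogeneous_C (Fin 6) a).mul
      (((isHomogeneous_X ℂ i).pow 2).mul ((isHomogeneous_X ℂ j).pow 2))
  exact ((((((((h4 _ _).add (h2 _ _ _)).add (h4 _ _)).sub (h2 _ _ _)).add (h2 _ _ _)).sub
    (h2 _ _ _)).add (h4 _ _)).add (h2 _ _ _)).add (h4 _ _)

theorem isIsomorphism_CPlus :
    IsIsomorphism pluckerPoint CPlus (projClosure (pluckerPoint '' affineLocusPlus)) := by
  refine isIsomorphism_pluckerPoint isBihomogeneous_formGPlus CPlus_eq
    (isHomogeneous_pluckerQuartic 1) fun x u y v => ?_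
  rw [map_formGPlus]
  simp [pluckerQuartic, formGPlus]
  ring

theorem isIsomorphism_CMinus :
    IsIsomorphism pluckerPoint CMinus (projClosure (pluckerPoint '' affineLocusMinus)) := by
  refine isIsomorphism_pluckerPoint isBihomogeneous_formGMinus CMinus_eq
    (isHomogeneous_pluckerQuartic (-1)) fun x u y v => ?_
  rw [map_formGMinus]
  simp [pluckerQuartic, formGMinus]
  ring

end Maschke

end

/-! ### The theorem assembled. -/

theorem mainTheorem5 :
    -- the octic polynomial on the line, its discriminant and the factorization
    (∀ x y : ℂ, fc x y = Polynomial.C (coeffA y) * Polynomial.X ^ 8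
      + Polynomial.C (coeffB x y) * Polynomial.X ^ 4 + Polynomial.C (coeffC x)) ∧
    (discr (X 0) (X 1) : MvPolynomial (Fin 2) ℤ)
      = 48 * gPlus (X 0) (X 1) * gMinus (X 0) (X 1) ∧
    (∀ x y : ℂ, gMinus x y = gPlus (Complex.I * x) (Complex.I * y)) ∧
    (∀ x y : ℂ, discr x y = 0 → ∃ l m : ℂ,
      fc x y = (Polynomial.C l * Polynomial.X ^ 4 + Polynomial.C m) ^ 2) ∧
    -- the curves are smooth of bidegree (4, 4), irreducible, of genus 9
    IsSmoothCurve CPlus (formGPlus (X 0) (X 1) (X 2) (X 3)) (4, 4) ∧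
    IsSmoothCurve CMinus (formGMinus (X 0) (X 1) (X 2) (X 3)) (4, 4) ∧
    HasGenus (affinePart CPlus) 9 ∧
    HasGenus (affinePart CMinus) 9 ∧
    -- they parametrize four-tangent lines
    Function.Injective line ∧
    (∀ c : PP 1 × PP 1, IsFourTangent (line c) ∨ LiesInS (line c) ↔ c ∈ CPlus ∪ CMinus) ∧
    (∀ c : PP 1 × PP 1, LiesInS (line c) ↔ c ∈ CPlus ∩ CMinus) ∧
    -- they are isomorphic to the closures of the loci of these lines in the Grassmannian
    IsIsomorphism pluckerPoint CPlus (projClosure (pluckerPoint '' affineLocusPlus)) ∧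
    IsIsomorphism pluckerPoint CMinus (projClosure (pluckerPoint '' affineLocusMinus)) ∧
    -- the inverse image of a four-tangent line splits
    (∀ L : Submodule ℂ (Fin 4 → ℂ), IsFourTangent L → ∃ Z₁ Z₂ : Set (WP 4), Z₁ ≠ Z₂ ∧
      preimage L = Z₁ ∪ Z₂ ∧ IsRationalCurve Z₁ ∧ IsRationalCurve Z₂ ∧
      MapsIsomorphicallyTo Z₁ L ∧ MapsIsomorphicallyTo Z₂ L) ∧
    -- the double cover, branched over 32 points, is smooth and irreducible of genus 33
    (∀ c ∈ CPlus, (coverFiber c).ncard = 1 ∨ (coverFiber c).ncard = 2) ∧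
    {c ∈ CPlus | (coverFiber c).ncard = 1}.ncard = 32 ∧
    CTildeIsSmooth ∧
    HasGenus affinePartTilde 33 ∧
    -- it parametrizes rational curves in the double octic
    (∀ q ∈ CTilde, IsRationalCurve (liftedLine q)) ∧
    (∀ c ∈ CPlus, ∀ q ∈ coverFiber c, MapsIsomorphicallyTo (liftedLine q) (line c)) ∧
    (∀ c ∈ CPlus, preimage (line c) = ⋃ q ∈ coverFiber c, liftedLine q) ∧
    Set.BijOn liftedLine CTilde
      {Z | Z ⊆ DoubleOctic ∧ ∃ c ∈ CPlus, MapsIsomorphicallyTo Z (line c)} :=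
  ⟨fc_eq, discr_eq _ _, fun x y => gMinus_eq_gPlus x y, fun _ _ h => fc_eq_sq h,
    isSmoothCurve_CPlus, isSmoothCurve_CMinus, hasGenus_CPlus, hasGenus_CMinus,
    line_injective, isFourTangent_or_liesInS_iff, liesInS_line_iff_mem,
    isIsomorphism_CPlus, isIsomorphism_CMinus, fun _ h => preimage_isFourTangent h,
    fun c _ => ncard_coverFiber_eq c, ncard_branch_points, cTildeIsSmooth, hasGenus_CTilde,
    fun _ h => isRationalCurve_liftedLine h, fun _ hc _ hq => mapsIsomorphicallyTo_liftedLine hc hq,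
    fun _ hc => preimage_line hc, liftedLine_bijOn⟩
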